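/- In the Minimum Eccentricity Shortest Path Problem (MESP), one is given a finite connected simple undirected graph $G$ and an integer $k \ge 0$, and has to decide whether $G$ contains a path $P$ that is a shortest path between its endpoints and has eccentricity $\max_{u \in V(G)} \min_{x \in V(P)} d_G(u,x)$ at most $k$. The distance to cluster graph of $G$ is the least size of a set $X \subseteq V(G)$ such that $G \setminus X$ is a vertex-disjoint union of cliques. Theorem. There is an algorithm (a single program of a random access machine whose unit-cost operations are memory access, comparison, addition and truncated subtraction of natural numbers) that solves MESP and that runs in time $\mathcal{O}(2^{4p}\, p \cdot n^6)$ on every connected graph with $n$ vertices and distance to cluster graph $p \ge 1$, for every $k$; the constant in the $\mathcal{O}$ is absolute, and neither $p$ nor a smallest set $X$ as above is part of the input. -/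

import Mathlib

/-! ### Graph notions -/

namespace MESP

/-- A walk (a sequence of consecutively adjacent vertices) is a shortest path if no walk with the
same endpoints has fewer edges. Such a walk never repeats a vertex. -/
def IsShortestPath {V : Type*} {G : SimpleGraph V} {u v : V} (w : G.Walk u v) : Prop :=
  ∀ q : G.Walk u v, w.length ≤ q.length

/-- The distance `d_G(u, S)` between a vertex and a set of vertices
(in `ℕ∞`, with value `⊤` if no vertex of `S` can be reached from `u`). -/
noncomputable def distToSet {V : Type*} (G : SimpleGraph V) (u : V) (S : Set V) : ℕ∞ :=
  ⨅ s ∈ S, G.edist u s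

/-- The eccentricity `ecc_G(S) = max_u d_G(u, S)` of a set of vertices. -/
noncomputable def ecc {V : Type*} (G : SimpleGraph V) (S : Set V) : ℕ∞ :=
  ⨆ u, distToSet G u S

/-- `(G, k)` is a yes-instance of the Minimum Eccentricity Shortest Path Problem: some path of `G`
is a shortest path between its endpoints and has eccentricity at most `k`. -/
def IsYesInstance {V : Type*} (G : SimpleGraph V) (k : ℕ) : Prop :=
  ∃ (u v : V) (w : G.Walk u v), IsShortestPath w ∧ ecc G {x | x ∈ w.support} ≤ (k : ℕ∞)

/-- A cluster graph is a vertex-disjoint union of cliques: every connected component is a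
clique. -/
def IsClusterGraph {V : Type*} (G : SimpleGraph V) : Prop :=
  ∀ u v : V, G.Reachable u v → u ≠ v → G.Adj u v

/-- `X` is a modulator to cluster graph: deleting `X` leaves a cluster graph. -/
def IsClusterModulator {V : Type*} (G : SimpleGraph V) (X : Finset V) : Prop :=
  IsClusterGraph (G.induce {v | v ∉ X})

/-- The distance to cluster graph: the size of a smallest modulator to cluster graph.
(For a finite graph, the set of all vertices is a modulator, so the infimum is a minimum.) -/
noncomputable def distToCluster {V : Type*} (G : SimpleGraph V) : ℕ :=
  sInf {m | ∃ X : Finset V, IsClusterModulator G X ∧ X.card = m}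

end MESP

/-! ### A random access machine with unit costs

The machine works on natural numbers. It has scalar variables and one-dimensional arrays, both named
by numerals; a program, being a finite text, names only finitely many of them. The only arithmetic
operations are addition and truncated subtraction (in particular there is no multiplication and
there are no bit operations). Every operation, every comparison, every access to a variable or an
array cell and every executed statement costs one step. -/

namespace RAM

/-- Expressions. -/
inductive Expr : Type
  /-- a numeral -/
  | lit (c : ℕ) : Expr
  /-- the value of a scalar variable -/
  | var (x : ℕ) : Expr
  /-- the content of the cell of array `a` whose index is the value of `i` -/
  | get (a : ℕ) (i : Expr) : Expr
  /-- sum -/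
  | add (e f : Expr) : Expr
  /-- truncated difference -/
  | sub (e f : Expr) : Expr
  /-- `1` if `e < f`, and `0` otherwise -/
  | lt (e f : Expr) : Expr
  /-- `1` if `e = f`, and `0` otherwise -/
  | eq (e f : Expr) : Expr

/-- Programs. -/
inductive Prog : Type
  /-- do nothing -/
  | skip : Prog
  /-- `x := e` -/
  | assign (x : ℕ) (e : Expr) : Prog
  /-- `a[i] := e` -/
  | store (a : ℕ) (i e : Expr) : Prog
  /-- first `p`, then `q` -/
  | seq (p q : Prog) : Prog
  /-- if `b` is nonzero then `p` else `q` -/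
  | cond (b : Expr) (p q : Prog) : Prog
  /-- while `b` is nonzero do `p` -/
  | loop (b : Expr) (p : Prog) : Prog

/-- The memory: the values of the scalar variables and of the array cells. -/
structure State : Type where
  var : ℕ → ℕ
  arr : ℕ → ℕ → ℕ

/-- The memory after `x := c`. -/
def State.setVar (σ : State) (x c : ℕ) : State :=
  { σ with var := Function.update σ.var x c }

/-- The memory after `a[i] := c`. -/
def State.setArr (σ : State) (a i c : ℕ) : State :=
  { σ with arr := Function.update σ.arr a (Function.update (σ.arr a) i c) }

/-- The value of an expression. -/
def Expr.eval (σ : State) : Expr → ℕ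
  | .lit c => c
  | .var x => σ.var x
  | .get a i => σ.arr a (i.eval σ)
  | .add e f => e.eval σ + f.eval σ
  | .sub e f => e.eval σ - f.eval σ
  | .lt e f => if e.eval σ < f.eval σ then 1 else 0
  | .eq e f => if e.eval σ = f.eval σ then 1 else 0

/-- The number of steps needed to evaluate an expression: one for each of its nodes. -/
def Expr.cost : Expr → ℕ
  | .lit _ => 1
  | .var _ => 1
  | .get _ i => i.cost + 1
  | .add e f => e.cost + f.cost + 1
  | .sub e f => e.cost + f.cost + 1
  | .lt e f => e.cost + f.cost + 1
  | .eq e f => e.cost + f.cost + 1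

/-- `Exec p σ t τ`: started with memory `σ`, the program `p` halts after exactly `t` steps, with
memory `τ`. -/
inductive Exec : Prog → State → ℕ → State → Prop
  | skip (σ : State) : Exec .skip σ 1 σ
  | assign (σ : State) (x : ℕ) (e : Expr) :
      Exec (.assign x e) σ (e.cost + 1) (σ.setVar x (e.eval σ))
  | store (σ : State) (a : ℕ) (i e : Expr) :
      Exec (.store a i e) σ (i.cost + e.cost + 1) (σ.setArr a (i.eval σ) (e.eval σ))
  | seq {p q : Prog} {σ τ ρ : State} {s t : ℕ} :
      Exec p σ s τ → Exec q τ t ρ → Exec (.seq p q) σ (s + t + 1) ρ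
  | cond_true {b : Expr} {p q : Prog} {σ τ : State} {t : ℕ} :
      b.eval σ ≠ 0 → Exec p σ t τ → Exec (.cond b p q) σ (b.cost + t + 1) τ
  | cond_false {b : Expr} {p q : Prog} {σ τ : State} {t : ℕ} :
      b.eval σ = 0 → Exec q σ t τ → Exec (.cond b p q) σ (b.cost + t + 1) τ
  | loop_true {b : Expr} {p : Prog} {σ τ ρ : State} {s t : ℕ} :
      b.eval σ ≠ 0 → Exec p σ s τ → Exec (.loop b p) τ t ρ →
        Exec (.loop b p) σ (b.cost + s + t + 1) ρ
  | loop_false {b : Expr} {p : Prog} {σ : State} :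
      b.eval σ = 0 → Exec (.loop b p) σ (b.cost + 1) σ

/-- The machine is deterministic: running time and final memory are determined by the program and
the initial memory. -/
theorem Exec.deterministic {p : Prog} {σ τ τ' : State} {t t' : ℕ}
    (h : Exec p σ t τ) (h' : Exec p σ t' τ') : t = t' ∧ τ = τ' := by
  induction h generalizing t' τ' with
  | skip => cases h'; exact ⟨rfl, rfl⟩
  | assign => cases h'; exact ⟨rfl, rfl⟩
  | store => cases h'; exact ⟨rfl, rfl⟩
  | seq _ _ ih₁ ih₂ =>
    cases h' with
    | seq a b =>
      obtain ⟨rfl, rfl⟩ := ih₁ a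
      obtain ⟨rfl, rfl⟩ := ih₂ b
      exact ⟨rfl, rfl⟩
  | cond_true hb _ ih =>
    cases h' with
    | cond_true _ a => obtain ⟨rfl, rfl⟩ := ih a; exact ⟨rfl, rfl⟩
    | cond_false hb' _ => exact absurd hb' hb
  | cond_false hb _ ih =>
    cases h' with
    | cond_true hb' _ => exact absurd hb hb'
    | cond_false _ a => obtain ⟨rfl, rfl⟩ := ih a; exact ⟨rfl, rfl⟩
  | loop_true hb _ _ ih₁ ih₂ =>
    cases h' with
    | loop_true _ a b =>
      obtain ⟨rfl, rfl⟩ := ih₁ a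
      obtain ⟨rfl, rfl⟩ := ih₂ b
      exact ⟨rfl, rfl⟩
    | loop_false hb' => exact absurd hb' hb
  | loop_false hb =>
    cases h' with
    | loop_true hb' _ _ => exact absurd hb hb'
    | loop_false _ => exact ⟨rfl, rfl⟩

open Classical in
/-- The initial memory for the instance `(G, k)`, where `G` has vertices `0, …, n - 1`: variable `0`
holds `n`, variable `1` holds `k`, and array `0` holds the adjacency matrix of `G` row by row.
Everything else is `0`. -/
noncomputable def inputState {n : ℕ} (G : SimpleGraph (Fin n)) (k : ℕ) : State where
  var x := if x = 0 then n else if x = 1 then k else 0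
  arr a x := if a = 0 ∧ ∃ i j : Fin n, G.Adj i j ∧ x = i * n + j then 1 else 0

end RAM

/-!
Deleting `X` leaves a cluster graph exactly if `X` meets every induced path on three vertices. A
smallest such `X` is found greedily: run through all triples of vertices and, whenever a triple is
an induced path that avoids the vertices picked so far, pick one of its three vertices. All possible
choices are described by a number with one digit in base `4` for each picked vertex, and the sizes
`0, 1, 2, …` of `X` are tried in turn, so that `p` need not be known.

For a path `P` with endpoint `s`, guess for each `y ∈ X` whether `y` is on `P` and, if not, by how
much the distance of `y` to `P` is smaller than the distance of `y` to `s` and the vertices of `X`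
on `P`. The difference is at most `2`, since three consecutive vertices of a shortest path outside
`X` would form an induced path. Hence one digit in base `4` suffices for each `y`, and `4 ^ p`
guesses for all distances from `X` to `P`.

Given the guess, a vertex outside `X` that `X` does not cover forces `P` to visit its clique, and
this already covers the whole clique if `k ≥ 1`. So `P` is a solution if it comes close enough to
every `y ∈ X` and visits the clique of every leader, the least uncovered vertex of a clique. As `P`
enters a new clique only from `X`, there are at most `p + 1` leaders, and so at most `2 * p + 1`
targets. A dynamic program over the length of a walk, its first vertex and the set of targets that
it has to meet decides in `O(2 ^ (2 * p) * n ^ 4)` steps whether a shortest path meets all of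
them. For `k = 0` the question is whether some shortest path contains all vertices.
-/

namespace MESP

/-! ### Shortest paths and cliques outside a modulator -/

section Modulator

variable {V : Type*} {G : SimpleGraph V} {X : Finset V}

/-- `X` contains a vertex of every induced path on three vertices. -/
def HitsP3 (G : SimpleGraph V) (X : Finset V) : Prop :=
  ∀ ⦃a b c⦄, a ∉ X → b ∉ X → c ∉ X → a ≠ c → G.Adj a b → G.Adj b c → G.Adj a c

/-- `u` and `w` belong to the same clique of `G \ X`. The notion is meant for modulators `X`, for
which it is transitive. -/
structure SameClique (G : SimpleGraph V) (X : Finset V) (u w : V) : Prop where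
  left : u ∉ X
  right : w ∉ X
  eq_or_adj : u = w ∨ G.Adj u w

namespace SameClique

variable {u v w : V}

theorem refl (hu : u ∉ X) : SameClique G X u u := ⟨hu, hu, .inl rfl⟩

theorem symm (h : SameClique G X u w) : SameClique G X w u :=
  ⟨h.right, h.left, h.eq_or_adj.imp Eq.symm SimpleGraph.Adj.symm⟩

theorem trans (hX : HitsP3 G X) (h : SameClique G X u v) (h' : SameClique G X v w) :
    SameClique G X u w := by
  refine ⟨h.left, h'.right, or_iff_not_imp_left.2 fun huw => ?_⟩
  obtain rfl | huv := h.eq_or_adj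
  · exact h'.eq_or_adj.resolve_left huw
  obtain rfl | hvw := h'.eq_or_adj
  · exact huv
  exact hX h.left h.right h'.right huw huv hvw

theorem of_adj (hu : u ∉ X) (hw : w ∉ X) (h : G.Adj u w) : SameClique G X u w :=
  ⟨hu, hw, .inr h⟩

theorem of_walk (hX : HitsP3 G X) (q : G.Walk u w) (hq : ∀ x ∈ q.support, x ∉ X) :
    SameClique G X u w := by
  induction q with
  | nil => exact refl (hq _ (by simp))
  | cons h q ih =>
    simp only [SimpleGraph.Walk.support_cons, List.mem_cons, forall_eq_or_imp] at hq
    exact (of_adj hq.1 (hq.2 _ q.start_mem_support) h).trans hX (ih hq.2)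

theorem dist_le_one (h : SameClique G X u w) : G.dist u w ≤ 1 := by
  obtain rfl | h := h.eq_or_adj
  · simp
  · exact (SimpleGraph.dist_eq_one_iff_adj.2 h).le

end SameClique

theorem isClusterModulator_iff_hitsP3 : IsClusterModulator G X ↔ HitsP3 G X := by
  constructor
  · intro h a b c ha hb hc hac hab hbc
    have hab' : (G.induce {v | v ∉ X}).Adj ⟨a, ha⟩ ⟨b, hb⟩ := hab
    have hbc' : (G.induce {v | v ∉ X}).Adj ⟨b, hb⟩ ⟨c, hc⟩ := hbc
    exact h ⟨a, ha⟩ ⟨c, hc⟩ (hab'.reachable.trans hbc'.reachable) (by simpa using hac)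
  · rintro hX u v ⟨q⟩ huv
    have hclique : SameClique G X u v := .of_walk hX
      (q.map (SimpleGraph.Embedding.induce {v | v ∉ X}).toHom) fun x hx => by
        obtain ⟨y, -, rfl⟩ := List.mem_map.1 (SimpleGraph.Walk.support_map _ q ▸ hx)
        exact y.2
    exact hclique.eq_or_adj.resolve_left (Subtype.coe_injective.ne huv)

theorem distToCluster_le_card (hX : HitsP3 G X) : distToCluster G ≤ X.card :=
  Nat.sInf_le ⟨X, isClusterModulator_iff_hitsP3.2 hX, rfl⟩

theorem exists_hitsP3_card_eq_distToCluster [Finite V] (G : SimpleGraph V) :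
    ∃ X, HitsP3 G X ∧ X.card = distToCluster G := by
  have := Fintype.ofFinite V
  have hne : {m | ∃ X : Finset V, IsClusterModulator G X ∧ X.card = m}.Nonempty :=
    ⟨_, Finset.univ, isClusterModulator_iff_hitsP3.2 fun a _ _ ha => absurd (Finset.mem_univ a) ha,
      rfl⟩
  obtain ⟨X, hX, hcard⟩ := Nat.sInf_mem hne
  exact ⟨X, isClusterModulator_iff_hitsP3.1 hX, hcard⟩

theorem card_le_of_forall_sameClique [DecidableEq V] (hX : HitsP3 G X) {v : V} {L : Finset V}
    (hL : ∀ u ∈ L, ∀ u' ∈ L, SameClique G X u u' → u = u') (hv : ∀ u ∈ L, SameClique G X u v) :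
    L.card ≤ if v ∈ X then 0 else 1 := by
  split_ifs with hvX
  · exact (Finset.card_eq_zero.2 (Finset.eq_empty_of_forall_notMem fun u hu =>
      (hv u hu).right hvX)).le
  · exact Finset.card_le_one.2 fun u hu u' hu' =>
      hL u hu u' hu' ((hv u hu).trans hX (hv u' hu').symm)

/-- A walk enters a new clique of `G \ X` only from `X`. -/
theorem card_le_countP_support_add [DecidableEq V] (hX : HitsP3 G X) {v s : V} (q : G.Walk v s)
    {L : Finset V} (hL : ∀ u ∈ L, ∀ u' ∈ L, SameClique G X u u' → u = u')
    (hq : ∀ u ∈ L, ∃ w ∈ q.support, SameClique G X u w) :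
    L.card ≤ q.support.countP (· ∈ X) + if v ∈ X then 0 else 1 := by
  classical
  induction q generalizing L with
  | nil =>
    refine (card_le_of_forall_sameClique hX hL fun u hu => ?_).trans (Nat.le_add_left _ _)
    obtain ⟨w, hw, h⟩ := hq u hu
    exact List.mem_singleton.1 hw ▸ h
  | @cons v w s hvw q ih =>
    have hrest : (L.filter (¬ SameClique G X · v)).card ≤
        q.support.countP (· ∈ X) + if w ∈ X then 0 else 1 := by
      refine ih (fun u hu u' hu' => hL u (Finset.filter_subset _ _ hu) u'
        (Finset.filter_subset _ _ hu')) fun u hu => ?_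
      obtain ⟨x, hx, h⟩ := hq u (Finset.filter_subset _ _ hu)
      obtain rfl | hx := List.mem_cons.1 (SimpleGraph.Walk.support_cons hvw q ▸ hx)
      · exact absurd h (Finset.mem_filter.1 hu).2
      · exact ⟨x, hx, h⟩
    have hhead : (L.filter (SameClique G X · v)).card ≤ if v ∈ X then 0 else 1 :=
      card_le_of_forall_sameClique hX (fun u hu u' hu' => hL u (Finset.filter_subset _ _ hu) u'
        (Finset.filter_subset _ _ hu')) fun u hu => (Finset.mem_filter.1 hu).2
    have hsplit := L.card_filter_add_card_filter_not (SameClique G X · v)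
    by_cases hvX : v ∈ X <;> by_cases hwX : w ∈ X <;>
      simp only [hvX, hwX, if_true, if_false, SimpleGraph.Walk.support_cons, List.countP_cons,
        decide_true, decide_false] at hrest hhead ⊢ <;> try omega
    refine (ih hL fun u hu => ?_).trans (by simp [hwX])
    obtain ⟨x, hx, h⟩ := hq u hu
    obtain rfl | hx := List.mem_cons.1 (SimpleGraph.Walk.support_cons hvw q ▸ hx)
    · exact ⟨w, q.start_mem_support, h.trans hX (.of_adj hvX hwX hvw)⟩
    · exact ⟨x, hx, h⟩

theorem card_le_card_add_one_of_isPath (hX : HitsP3 G X) {v s : V} {q : G.Walk v s}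
    (hpath : q.IsPath) {L : Finset V} (hL : ∀ u ∈ L, ∀ u' ∈ L, SameClique G X u u' → u = u')
    (hq : ∀ u ∈ L, ∃ w ∈ q.support, SameClique G X u w) : L.card ≤ X.card + 1 := by
  classical
  have hcount : q.support.countP (· ∈ X) ≤ X.card := by
    rw [List.countP_eq_length_filter, ← List.toFinset_card_of_nodup (hpath.support_nodup.filter _)]
    exact Finset.card_le_card fun x hx => by simp_all
  have := card_le_countP_support_add hX q hL hq
  split_ifs at this <;> omega

/-! ### Distances -/

theorem dist_le_succ_iff (hG : G.Connected) {u v : V} {r : ℕ} :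
    G.dist u v ≤ r + 1 ↔ u = v ∨ ∃ w, G.Adj u w ∧ G.dist w v ≤ r := by
  constructor
  · intro h
    obtain ⟨q, hq⟩ := hG.exists_walk_length_eq_dist u v
    cases q with
    | nil => exact .inl rfl
    | cons huw q =>
      rw [SimpleGraph.Walk.length_cons] at hq
      exact .inr ⟨_, huw, (SimpleGraph.dist_le q).trans (by omega)⟩
  · rintro (rfl | ⟨w, huw, hw⟩)
    · simp
    · have := hG.dist_triangle (u := u) (v := w) (w := v)
      have := SimpleGraph.dist_eq_one_iff_adj.2 huw
      omega

theorem dist_lt_card [Fintype V] (hG : G.Connected) (u v : V) : G.dist u v < Fintype.card V := by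
  obtain ⟨q, hq⟩ := hG.exists_walk_length_eq_dist u v
  exact hq ▸ (q.isPath_of_length_eq_dist hq).length_lt

theorem dist_getVert_of_length_eq_dist {s v : V} {q : G.Walk v s} (hq : q.length = G.dist v s)
    {i j : ℕ} (hij : i ≤ j) (hj : j ≤ q.length) :
    G.dist (q.getVert i) (q.getVert j) = j - i := by
  have hsub : ((q.drop i).take (j - i)).IsSubwalk q :=
    (SimpleGraph.Walk.isSubwalk_take _ _).trans (SimpleGraph.Walk.isSubwalk_drop _ _)
  have hlength := SimpleGraph.length_eq_dist_of_subwalk hq hsub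
  rw [SimpleGraph.Walk.take_length, SimpleGraph.Walk.drop_length,
    SimpleGraph.Walk.drop_getVert, Nat.add_sub_cancel' hij] at hlength
  omega

/-- The distance between a vertex and a set of vertices; it is `0` if the set is empty. -/
noncomputable def minDist (G : SimpleGraph V) (u : V) (S : Set V) : ℕ :=
  sInf (G.dist u '' S)

theorem minDist_le {u y : V} {S : Set V} (hy : y ∈ S) : minDist G u S ≤ G.dist u y :=
  Nat.sInf_le ⟨y, hy, rfl⟩

theorem exists_dist_eq_minDist {u : V} {S : Set V} (hS : S.Nonempty) :
    ∃ y ∈ S, G.dist u y = minDist G u S :=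
  Nat.sInf_mem (hS.image _)

theorem minDist_le_iff {u : V} {S : Set V} (hS : S.Nonempty) {r : ℕ} :
    minDist G u S ≤ r ↔ ∃ y ∈ S, G.dist u y ≤ r :=
  ⟨fun h => let ⟨y, hy, hdist⟩ := exists_dist_eq_minDist (G := G) (u := u) hS
    ⟨y, hy, hdist.trans_le h⟩, fun ⟨_, hy, h⟩ => (minDist_le hy).trans h⟩

theorem ecc_le_iff (hG : G.Connected) {S : Set V} {k : ℕ} :
    ecc G S ≤ k ↔ ∀ u, ∃ w ∈ S, G.dist u w ≤ k := by
  rw [ecc, iSup_le_iff]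
  refine forall_congr' fun u => ⟨fun h => ?_, fun ⟨w, hw, hk⟩ => (iInf₂_le w hw).trans ?_⟩
  · by_contra! hfar
    have hlt : ((k + 1 : ℕ) : ℕ∞) ≤ distToSet G u S := le_iInf₂ fun w hw => by
      rw [← (hG u w).coe_dist_eq_edist]
      exact_mod_cast hfar w hw
    exact absurd (hlt.trans h) (by norm_cast; omega)
  · rw [← (hG u w).coe_dist_eq_edist]
    exact_mod_cast hk

theorem isShortestPath_iff {u v : V} {q : G.Walk u v} :
    IsShortestPath q ↔ q.length = G.dist u v := by
  refine ⟨fun h => ?_, fun h q' => h ▸ SimpleGraph.dist_le q'⟩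
  obtain ⟨q', hq'⟩ := q.reachable.exists_walk_length_eq_dist
  exact le_antisymm (hq' ▸ h q') (SimpleGraph.dist_le q)

theorem isYesInstance_iff (hG : G.Connected) {k : ℕ} : IsYesInstance G k ↔
    ∃ (v s : V) (q : G.Walk v s), q.length = G.dist v s ∧
      ∀ u, ∃ w ∈ q.support, G.dist u w ≤ k := by
  simp only [IsYesInstance, isShortestPath_iff, ecc_le_iff hG, Set.mem_ofPred_eq]

theorem forall_mem_support_iff [Fintype V] {v s : V} {q : G.Walk v s} (hq : q.IsPath) :
    (∀ u, u ∈ q.support) ↔ q.length + 1 = Fintype.card V := by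
  classical
  rw [← SimpleGraph.Walk.length_support, ← List.toFinset_card_of_nodup hq.support_nodup,
    Finset.card_eq_iff_eq_univ, Finset.eq_univ_iff_forall]
  simp only [List.mem_toFinset]

theorem isYesInstance_zero_iff [Fintype V] (hG : G.Connected) :
    IsYesInstance G 0 ↔ ∃ v s, G.dist v s + 1 = Fintype.card V := by
  have hcover {v s : V} {q : G.Walk v s} (hq : q.length = G.dist v s) :
      (∀ u, ∃ w ∈ q.support, G.dist u w ≤ 0) ↔ G.dist v s + 1 = Fintype.card V := by
    rw [← hq, ← forall_mem_support_iff (q.isPath_of_length_eq_dist hq)]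
    simp only [Nat.le_zero, hG.dist_eq_zero_iff, exists_eq_right']
  rw [isYesInstance_iff hG]
  refine exists₂_congr fun v s => ⟨fun ⟨q, hq, h⟩ => (hcover hq).1 h, fun h => ?_⟩
  obtain ⟨q, hq⟩ := hG.exists_walk_length_eq_dist v s
  exact ⟨q, hq, (hcover hq).2 h⟩

/-! ### Guessing the distances to a path -/

/-- The bounds for the distances to a path with endpoint `s` that are encoded by `f`: the path
contains those `z ∈ X` with `f z = 0`, and the distance of `y` to these vertices and `s` exceeds
its distance to the path by `f y - 1`. -/
noncomputable def guess (G : SimpleGraph V) (X : Finset V) (s : V) (f : V → ℕ) (y : V) : ℕ :=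
  minDist G y (insert s {z | z ∈ X ∧ f z = 0}) - (f y - 1)

theorem guess_congr {s : V} {f f' : V → ℕ} (h : ∀ y ∈ X, f y = f' y) {y : V} (hy : y ∈ X) :
    guess G X s f y = guess G X s f' y := by
  have hzero : {z | z ∈ X ∧ f z = 0} = {z | z ∈ X ∧ f' z = 0} :=
    Set.ext fun z => and_congr_right fun hz => by rw [h z hz]
  rw [guess, guess, hzero, h y hy]

/-- Three consecutive vertices of a shortest path that avoids `X` would be an induced path. -/
theorem exists_dist_le_two (hX : HitsP3 G X) {v s : V} {q : G.Walk v s}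
    (hq : q.length = G.dist v s) {w : V} (hw : w ∈ q.support) :
    ∃ y ∈ insert s {z | z ∈ X ∧ z ∈ q.support}, G.dist w y ≤ 2 := by
  obtain ⟨i, rfl, hi⟩ := SimpleGraph.Walk.mem_support_iff_exists_getVert.1 hw
  by_cases hlast : q.length ≤ i + 2
  · have := dist_getVert_of_length_eq_dist hq hi le_rfl
    rw [q.getVert_length] at this
    exact ⟨s, .inl rfl, by omega⟩
  by_contra! hfar
  have hnotMem (j : ℕ) (hij : i ≤ j) (hji : j ≤ i + 2) : q.getVert j ∉ X := fun hj => by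
    have := hfar _ (.inr ⟨hj, q.getVert_mem_support j⟩)
    have := dist_getVert_of_length_eq_dist hq hij (by omega)
    omega
  have hdist := dist_getVert_of_length_eq_dist hq (i.le_add_right 2) (by omega)
  have hne : q.getVert i ≠ q.getVert (i + 2) := fun h => by simp [h] at hdist
  have hadj := hX (hnotMem i le_rfl (by omega)) (hnotMem (i + 1) (by omega) (by omega))
    (hnotMem (i + 2) (by omega) le_rfl) hne (q.adj_getVert_succ (by omega))
    (q.adj_getVert_succ (by omega))
  rw [SimpleGraph.dist_eq_one_iff_adj.2 hadj] at hdist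
  omega

theorem exists_guess_eq_minDist (hG : G.Connected) (hX : HitsP3 G X) {v s : V} {q : G.Walk v s}
    (hq : q.length = G.dist v s) : ∃ f : V → ℕ, (∀ y, f y < 4) ∧
      ∀ y ∈ X, guess G X s f y = minDist G y {w | w ∈ q.support} := by
  classical
  set S : Set V := {w | w ∈ q.support}
  set T : Set V := insert s {z | z ∈ X ∧ z ∈ q.support}
  have hsT : s ∈ T := .inl rfl
  have hTS : T ⊆ S := Set.insert_subset q.end_mem_support fun z hz => hz.2
  have hST (y : V) : minDist G y S ≤ minDist G y T := by
    obtain ⟨z, hz, h⟩ := exists_dist_eq_minDist (G := G) (u := y) ⟨s, hsT⟩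
    exact h ▸ minDist_le (hTS hz)
  have hTS2 (y : V) : minDist G y T ≤ minDist G y S + 2 := by
    obtain ⟨w, hw, hyw⟩ := exists_dist_eq_minDist (G := G) (u := y) ⟨s, hTS hsT⟩
    obtain ⟨z, hz, hwz⟩ := exists_dist_le_two hX hq hw
    have := minDist_le (G := G) (u := y) (S := T) hz
    have := hG.dist_triangle (u := y) (v := w) (w := z)
    omega
  refine ⟨fun y => if y ∈ q.support then 0 else minDist G y T - minDist G y S + 1, fun y => ?_,
    fun y hy => ?_⟩
  · have := hTS2 y
    dsimp only
    split_ifs <;> omega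
  · have hT : insert s {z | z ∈ X ∧ (if z ∈ q.support then 0 else
        minDist G z T - minDist G z S + 1) = 0} = T := by
      simp only [ite_eq_left_iff, Nat.add_eq_zero_iff, one_ne_zero, and_false, imp_false,
        not_not, T]
    have := hST y
    simp only [guess, hT]
    split_ifs with hyq
    · have := minDist_le (G := G) (u := y) (show y ∈ T from .inr ⟨hy, hyq⟩)
      simp only [SimpleGraph.dist_self] at this
      omega
    · omega

/-! ### Certificates -/

variable [LinearOrder V] {δ : V → ℕ} {k : ℕ}

/-- Assume that every `y ∈ X` has distance at most `δ y` from a path. An uncovered vertex is one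
outside `X` which this does not bring within distance `k` of the path. -/
def IsUncovered (G : SimpleGraph V) (X : Finset V) (δ : V → ℕ) (k : ℕ) (u : V) : Prop :=
  u ∉ X ∧ ∀ y ∈ X, k < G.dist u y + δ y

/-- The least uncovered vertex of a clique of `G \ X`. -/
def IsLeader (G : SimpleGraph V) (X : Finset V) (δ : V → ℕ) (k : ℕ) (u : V) : Prop :=
  IsUncovered G X δ k u ∧ ∀ w < u, IsUncovered G X δ k w → ¬ G.Adj w u

theorem IsLeader.eq_of_sameClique {u u' : V} (hu : IsLeader G X δ k u) (hu' : IsLeader G X δ k u')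
    (h : SameClique G X u u') : u = u' := by
  refine h.eq_or_adj.resolve_right fun hadj => ?_
  obtain hlt | hlt := hadj.ne.lt_or_gt
  · exact hu'.2 u hlt hu.1 hadj
  · exact hu.2 u' hlt hu'.1 hadj.symm

theorem IsUncovered.exists_isLeader [WellFoundedLT V] (hX : HitsP3 G X) {u : V}
    (hu : IsUncovered G X δ k u) : ∃ l, IsLeader G X δ k l ∧ SameClique G X u l := by
  obtain ⟨l, ⟨hl, hul⟩, hmin⟩ := wellFounded_lt.has_min
    {w | IsUncovered G X δ k w ∧ SameClique G X u w} ⟨u, hu, .refl hu.1⟩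
  exact ⟨l, ⟨hl, fun w hwl hw hadj =>
    hmin w ⟨hw, hul.trans hX (.of_adj hl.1 hw.1 hadj.symm)⟩ hwl⟩, hul⟩

theorem covers_of_leaders [WellFoundedLT V] (hG : G.Connected) (hX : HitsP3 G X) (hk : 1 ≤ k)
    {S : Set V} (hδk : ∀ y ∈ X, δ y ≤ k) (hδ : ∀ y ∈ X, ∃ w ∈ S, G.dist y w ≤ δ y)
    (hleader : ∀ l, IsLeader G X δ k l → ∃ w ∈ S, SameClique G X l w) (u : V) :
    ∃ w ∈ S, G.dist u w ≤ k := by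
  by_cases huX : u ∈ X
  · obtain ⟨w, hw, hdist⟩ := hδ u huX
    exact ⟨w, hw, hdist.trans (hδk u huX)⟩
  by_cases hu : IsUncovered G X δ k u
  · obtain ⟨l, hl, hul⟩ := hu.exists_isLeader hX
    obtain ⟨w, hw, hlw⟩ := hleader l hl
    exact ⟨w, hw, (hul.trans hX hlw).dist_le_one.trans hk⟩
  · simp only [IsUncovered, not_and, not_forall, not_lt] at hu
    obtain ⟨y, hy, huy⟩ := hu huX
    obtain ⟨w, hw, hyw⟩ := hδ y hy
    exact ⟨w, hw, hG.dist_triangle.trans ((Nat.add_le_add_left hyw _).trans huy)⟩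

theorem IsUncovered.exists_sameClique (hG : G.Connected) (hX : HitsP3 G X) {S : Set V} {u : V}
    (hS : ∃ w ∈ S, G.dist u w ≤ k) (hδ : ∀ y ∈ X, δ y ≤ minDist G y S)
    (hu : IsUncovered G X δ k u) : ∃ w ∈ S, SameClique G X u w := by
  obtain ⟨w, hw, huw⟩ := hS
  obtain ⟨q, hq⟩ := hG.exists_walk_length_eq_dist u w
  refine ⟨w, hw, .of_walk hX q fun y hy hyX => ?_⟩
  have hlength := congrArg SimpleGraph.Walk.length (q.take_spec hy)
  rw [SimpleGraph.Walk.length_append] at hlength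
  have := SimpleGraph.dist_le (q.takeUntil y hy)
  have := SimpleGraph.dist_le (q.dropUntil y hy)
  have := (hδ y hyX).trans (minDist_le hw)
  have := hu.2 y hyX
  omega

/-- The vertices that certify a solution: the modulator and the leaders. -/
def IsTarget (G : SimpleGraph V) (X : Finset V) (δ : V → ℕ) (k : ℕ) (y : V) : Prop :=
  y ∈ X ∨ IsLeader G X δ k y

/-- What a path has to do for a target `y`, in terms of one of its vertices `w`: it comes as close
to a vertex of the modulator as promised by `δ`, and it visits the clique of a leader. -/
def Meets (G : SimpleGraph V) (X : Finset V) (δ : V → ℕ) (y w : V) : Prop :=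
  if y ∈ X then G.dist y w ≤ δ y else SameClique G X y w

/-- A shortest path that meets all targets, for promised distances of at most `k`. -/
structure IsCertificate (G : SimpleGraph V) (X : Finset V) (δ : V → ℕ) (k : ℕ) {v s : V}
    (q : G.Walk v s) : Prop where
  length_eq : q.length = G.dist v s
  le : ∀ y ∈ X, δ y ≤ k
  meets : ∀ y, IsTarget G X δ k y → ∃ w ∈ q.support, Meets G X δ y w

namespace IsCertificate

variable {v s : V} {q : G.Walk v s}

theorem exists_sameClique (h : IsCertificate G X δ k q) {l : V} (hl : IsLeader G X δ k l) :
    ∃ w ∈ q.support, SameClique G X l w := by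
  obtain ⟨w, hw, hmeets⟩ := h.meets l (.inr hl)
  exact ⟨w, hw, by rwa [Meets, if_neg hl.1.1] at hmeets⟩

theorem isYesInstance [WellFoundedLT V] (hG : G.Connected) (hX : HitsP3 G X) (hk : 1 ≤ k)
    (h : IsCertificate G X δ k q) : IsYesInstance G k := by
  refine (isYesInstance_iff hG).2 ⟨v, s, q, h.length_eq, covers_of_leaders hG hX hk
    (S := {w | w ∈ q.support}) h.le (fun y hy => ?_) fun l hl => h.exists_sameClique hl⟩
  obtain ⟨w, hw, hmeets⟩ := h.meets y (.inl hy)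
  exact ⟨w, hw, by rwa [Meets, if_pos hy] at hmeets⟩

theorem card_le (hX : HitsP3 G X) (h : IsCertificate G X δ k q) {D : Finset V}
    (hD : ∀ y ∈ D, IsTarget G X δ k y) : D.card ≤ 2 * X.card + 1 := by
  have hleader : ∀ l ∈ D \ X, IsLeader G X δ k l := fun l hl =>
    (hD l (Finset.mem_sdiff.1 hl).1).resolve_left (Finset.mem_sdiff.1 hl).2
  have := card_le_card_add_one_of_isPath hX (q.isPath_of_length_eq_dist h.length_eq)
    (fun l hl l' hl' => (hleader l hl).eq_of_sameClique (hleader l' hl'))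
    fun l hl => h.exists_sameClique (hleader l hl)
  have := Finset.card_le_card_sdiff_add_card (s := D) (t := X)
  omega

end IsCertificate

theorem isCertificate_of_eq_minDist (hG : G.Connected) (hX : HitsP3 G X) {v s : V} {q : G.Walk v s}
    (hq : q.length = G.dist v s) (hcovers : ∀ u, ∃ w ∈ q.support, G.dist u w ≤ k)
    (hδ : ∀ y ∈ X, δ y = minDist G y {w | w ∈ q.support}) : IsCertificate G X δ k q := by
  have hne : {w | w ∈ q.support}.Nonempty := ⟨s, q.end_mem_support⟩
  refine ⟨hq, fun y hy => ?_, fun y hy => ?_⟩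
  · rw [hδ y hy, minDist_le_iff hne]
    exact hcovers y
  · unfold Meets
    split_ifs with hyX
    · obtain ⟨w, hw, hyw⟩ := exists_dist_eq_minDist (G := G) (u := y) hne
      exact ⟨w, hw, (hyw.trans (hδ y hyX).symm).le⟩
    · exact (hy.resolve_left hyX).1.exists_sameClique hG hX (hcovers y) fun y hy => (hδ y hy).le

end Modulator

end MESP

namespace MESP

/-! ### Digits -/

/-- The digit of `g` in base `4` that belongs to `4 ^ e`. -/
def digit (g e : ℕ) : ℕ := g / 4 ^ e % 4

theorem exists_digit_eq (p : ℕ) {f : ℕ → ℕ} (hf : ∀ e, f e < 4) :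
    ∃ g < 4 ^ p, ∀ e < p, digit g e = f e := by
  induction p generalizing f with
  | zero => exact ⟨0, by simp, by simp⟩
  | succ p ih =>
    obtain ⟨g, hg, hdigit⟩ := ih (f := fun e => f (e + 1)) fun e => hf (e + 1)
    have hf0 := hf 0
    refine ⟨4 * g + f 0, by rw [pow_succ]; omega, fun e he => ?_⟩
    cases e with
    | zero => simp only [digit, pow_zero, Nat.div_one]; omega
    | succ e =>
      rw [← hdigit e (by omega), digit, digit, pow_succ', ← Nat.div_div_eq_div_mul,
        show (4 * g + f 0) / 4 = g by omega]

theorem IsYesInstance.exists_isCertificate {V : Type*} [LinearOrder V] {G : SimpleGraph V}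
    {l : List V} {k : ℕ} (hG : G.Connected) (hl : HitsP3 G l.toFinset) (h : IsYesInstance G k) :
    ∃ g < 4 ^ l.length, ∃ (v s : V) (q : G.Walk v s), IsCertificate G l.toFinset
      (guess G l.toFinset s fun y => digit g (l.idxOf y)) k q := by
  obtain ⟨v, s, q, hq, hcovers⟩ := (isYesInstance_iff hG).1 h
  obtain ⟨f, hf, hguess⟩ := exists_guess_eq_minDist hG hl hq
  obtain ⟨g, hg, hdigit⟩ := exists_digit_eq l.length (f := fun e => f (l.getD e s)) fun e => hf _
  have hdigit (y : V) (hy : y ∈ l.toFinset) : f y = digit g (l.idxOf y) := by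
    have hlt := List.idxOf_lt_length_of_mem (List.mem_toFinset.1 hy)
    rw [hdigit _ hlt, List.getD_eq_getElem _ _ hlt, List.getElem_idxOf]
  exact ⟨g, hg, v, s, q, isCertificate_of_eq_minDist hG hl hq hcovers fun y hy =>
    (guess_congr hdigit hy).symm.trans (hguess y hy)⟩

/-! ### Greedy modulators -/

section Greedy

variable {V : Type*} {G : SimpleGraph V}

/-- The three vertices form an induced path that avoids `l`. -/
def IsFreeP3 (G : SimpleGraph V) (l : List V) : V × V × V → Prop
  | (a, b, c) => a ∉ l ∧ b ∉ l ∧ c ∉ l ∧ a ≠ c ∧ G.Adj a b ∧ G.Adj b c ∧ ¬ G.Adj a c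

theorem IsFreeP3.mono {l l' : List V} (h : l ⊆ l') {t : V × V × V} (ht : IsFreeP3 G l' t) :
    IsFreeP3 G l t :=
  ⟨fun h' => ht.1 (h h'), fun h' => ht.2.1 (h h'), fun h' => ht.2.2.1 (h h'), ht.2.2.2⟩

/-- The entry of a triple that is selected by the digit `d`. -/
def entry (d : ℕ) : V × V × V → V
  | (a, b, c) => if d = 0 then a else if d = 1 then b else c

open Classical in
/-- One step of the greedy construction of a modulator: if `t` is an induced path that avoids `l`,
then the next unused digit of `f` selects the vertex of `t` that is added to `l`. -/
noncomputable def pick (G : SimpleGraph V) (f : ℕ → ℕ) (l : List V) (t : V × V × V) : List V :=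
  if IsFreeP3 G l t then l ++ [entry (f l.length) t] else l

variable {f f' : ℕ → ℕ} {l : List V} {t : V × V × V} {ts : List (V × V × V)}

theorem IsFreeP3.entry_notMem (h : IsFreeP3 G l t) (d : ℕ) : entry d t ∉ l := by
  unfold entry
  split_ifs
  exacts [h.1, h.2.1, h.2.2.1]

theorem prefix_pick : l <+: pick G f l t := by
  unfold pick
  split_ifs <;> simp

theorem not_isFreeP3_pick : ¬ IsFreeP3 G (pick G f l t) t := by
  by_cases h : IsFreeP3 G l t
  · exact fun h' => h'.entry_notMem (f l.length) (by simp [pick, if_pos h])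
  · rwa [pick, if_neg h]

theorem nodup_pick (hl : l.Nodup) : (pick G f l t).Nodup := by
  by_cases h : IsFreeP3 G l t
  · rw [pick, if_pos h]
    simpa using hl.concat (h.entry_notMem (f l.length))
  · rwa [pick, if_neg h]

theorem prefix_foldl_pick : l <+: ts.foldl (pick G f) l :=
  List.foldlRecOn ts (pick G f) (List.prefix_refl l) fun _ h _ _ => h.trans prefix_pick

theorem not_isFreeP3_foldl_pick (ht : t ∈ ts) : ¬ IsFreeP3 G (ts.foldl (pick G f) l) t := by
  obtain ⟨ts₁, ts₂, rfl⟩ := List.append_of_mem ht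
  rw [List.foldl_append, List.foldl_cons]
  exact fun h => not_isFreeP3_pick (h.mono prefix_foldl_pick.subset)

theorem nodup_foldl_pick : (ts.foldl (pick G f) []).Nodup :=
  List.foldlRecOn ts (pick G f) List.nodup_nil fun _ h _ _ => nodup_pick h

theorem foldl_pick_congr (h : ∀ e < (ts.foldl (pick G f) l).length, f e = f' e) :
    ts.foldl (pick G f) l = ts.foldl (pick G f') l := by
  induction ts generalizing l with
  | nil => rfl
  | cons t ts ih =>
    have hpick : pick G f l t = pick G f' l t := by
      by_cases ht : IsFreeP3 G l t
      · have := (prefix_foldl_pick (G := G) (f := f) (ts := ts) (l := pick G f l t)).length_le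
        rw [pick, pick, if_pos ht, if_pos ht, h l.length]
        simp only [pick, if_pos ht, List.length_append, List.length_singleton] at this
        rw [List.foldl_cons, pick, if_pos ht]
        omega
      · rw [pick, pick, if_neg ht, if_neg ht]
    rw [List.foldl_cons, ih h, hpick, List.foldl_cons]

theorem exists_foldl_pick_subset {X : Finset V} (hX : HitsP3 G X) (ts : List (V × V × V)) :
    ∃ f : ℕ → ℕ, (∀ e, f e < 4) ∧ ∀ a ∈ ts.foldl (pick G f) [], a ∈ X := by
  induction ts using List.reverseRecOn with
  | nil => exact ⟨fun _ => 0, by simp, by simp⟩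
  | append_singleton ts t ih =>
    obtain ⟨f, hf, hsub⟩ := ih
    set l := ts.foldl (pick G f) [] with hl
    by_cases ht : IsFreeP3 G l t
    · obtain ⟨d, hd, hdX⟩ : ∃ d < 4, entry d t ∈ X := by
        by_contra! hnot
        exact ht.2.2.2.2.2.2 (hX (hnot 0 (by simp)) (hnot 1 (by simp)) (hnot 2 (by simp))
          ht.2.2.2.1 ht.2.2.2.2.1 ht.2.2.2.2.2.1)
      have hcongr : ts.foldl (pick G (Function.update f l.length d)) [] = l :=
        (foldl_pick_congr fun e he => by simp [(hl ▸ he).ne]).symm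
      refine ⟨Function.update f l.length d, fun e => ?_, fun a ha => ?_⟩
      · by_cases he : e = l.length <;> simp [he, hd, hf]
      · simp only [List.foldl_append, hcongr, List.foldl_cons, List.foldl_nil, pick, if_pos ht,
          Function.update_self, List.mem_append, List.mem_singleton] at ha
        exact ha.elim (hsub a) (· ▸ hdX)
    · exact ⟨f, hf, by simpa [List.foldl_append, ← hl, pick, if_neg ht] using hsub⟩

theorem exists_length_foldl_pick_le [Finite V] (G : SimpleGraph V) (ts : List (V × V × V)) :
    ∃ g < 4 ^ distToCluster G, (ts.foldl (pick G (digit g)) []).length ≤ distToCluster G := by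
  classical
  obtain ⟨X, hX, hcard⟩ := exists_hitsP3_card_eq_distToCluster G
  obtain ⟨f, hf, hsub⟩ := exists_foldl_pick_subset hX ts
  have hlength : (ts.foldl (pick G f) []).length ≤ distToCluster G := by
    rw [← List.toFinset_card_of_nodup nodup_foldl_pick, ← hcard]
    exact Finset.card_le_card fun a ha => hsub a (List.mem_toFinset.1 ha)
  obtain ⟨g, hg, hdigit⟩ := exists_digit_eq (distToCluster G) hf
  refine ⟨g, hg, ?_⟩
  rwa [← foldl_pick_congr fun e he => (hdigit e (he.trans_le hlength)).symm]

theorem hitsP3_foldl_pick [DecidableEq V] (hts : ∀ t, t ∈ ts) :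
    HitsP3 G (ts.foldl (pick G f) []).toFinset := by
  intro a b c ha hb hc hac hab hbc
  rw [List.mem_toFinset] at ha hb hc
  by_contra hnot
  exact not_isFreeP3_foldl_pick (hts (a, b, c)) ⟨ha, hb, hc, hac, hab, hbc, hnot⟩

theorem distToCluster_le_length_foldl_pick (hts : ∀ t, t ∈ ts) :
    distToCluster G ≤ (ts.foldl (pick G f) []).length := by
  classical
  rw [← List.toFinset_card_of_nodup nodup_foldl_pick]
  exact distToCluster_le_card (hitsP3_foldl_pick hts)

end Greedy

/-! ### Walks that collect a set of elements -/

section Collect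

variable {V : Type*} {G : SimpleGraph V} {H : ℕ → V → Prop} {s v : V} {S : ℕ}

/-- Some walk of length `l` from `v` to `s` meets every element of the set encoded by the binary
digits of `S`, where `H e w` means that `w` meets `e`. -/
def Collects (G : SimpleGraph V) (H : ℕ → V → Prop) (s : V) (l : ℕ) (v : V) (S : ℕ) : Prop :=
  ∃ q : G.Walk v s, q.length = l ∧ ∀ e ∈ S.bitIndices, ∃ w ∈ q.support, H e w

open Classical in
/-- The set that remains of `S` after the elements that `v` meets are removed. -/
noncomputable def rest (H : ℕ → V → Prop) (v : V) (S : ℕ) : ℕ :=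
  ∑ e ∈ S.bitIndices.toFinset with ¬ H e v, 2 ^ e

open Classical in
theorem mem_bitIndices_rest {e : ℕ} : e ∈ (rest H v S).bitIndices ↔ e ∈ S.bitIndices ∧ ¬ H e v := by
  rw [← List.mem_toFinset, rest, Finset.toFinset_bitIndices_sum_two_pow, Finset.mem_filter,
    List.mem_toFinset]

open Classical in
theorem rest_le : rest H v S ≤ S := by
  conv_rhs => rw [← Finset.sum_toFinset_bitIndices_two_pow S]
  exact Finset.sum_le_sum_of_subset (Finset.filter_subset _ _)

open Classical in
theorem rest_eq_sum_range {m : ℕ} (hS : S < 2 ^ m) : rest H v S =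
    ∑ e ∈ Finset.range m, if e ∈ S.bitIndices ∧ ¬ H e v then 2 ^ e else 0 := by
  rw [rest, ← Finset.sum_filter]
  refine Finset.sum_congr (Finset.ext fun e => ?_) fun _ _ => rfl
  simp only [Finset.mem_filter, List.mem_toFinset, Finset.mem_range, iff_and_self, and_imp]
  exact fun he _ => (Nat.pow_lt_pow_iff_right one_lt_two).1
    ((Nat.two_pow_le_of_mem_bitIndices he).trans_lt hS)

theorem collects_zero : Collects G H s 0 v S ↔ v = s ∧ rest H v S = 0 := by
  have hrest : rest H v S = 0 ↔ ∀ e ∈ S.bitIndices, H e v := by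
    simp [rest, Finset.sum_eq_zero_iff]
  rw [hrest]
  constructor
  · rintro ⟨q, hq, h⟩
    obtain rfl := SimpleGraph.Walk.eq_of_length_eq_zero hq
    rw [SimpleGraph.Walk.length_eq_zero_iff] at hq
    simpa [SimpleGraph.Walk.nil_iff_support_eq.1 hq] using h
  · rintro ⟨rfl, h⟩
    exact ⟨.nil, rfl, by simpa using h⟩

theorem collects_succ {l : ℕ} :
    Collects G H s (l + 1) v S ↔ ∃ w, G.Adj v w ∧ Collects G H s l w (rest H v S) := by
  constructor
  · rintro ⟨q, hq, h⟩
    cases q with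
    | nil => simp at hq
    | @cons _ w _ hvw q =>
      refine ⟨w, hvw, q, by simpa using hq, fun e he => ?_⟩
      obtain ⟨he, hev⟩ := mem_bitIndices_rest.1 he
      obtain ⟨y, hy, hey⟩ := h e he
      obtain rfl | hy := List.mem_cons.1 (SimpleGraph.Walk.support_cons hvw q ▸ hy)
      · exact absurd hey hev
      · exact ⟨y, hy, hey⟩
  · rintro ⟨w, hvw, q, hq, h⟩
    refine ⟨.cons hvw q, by simpa using hq, fun e he => ?_⟩
    by_cases hev : H e v
    · exact ⟨v, by simp, hev⟩
    · obtain ⟨y, hy, hey⟩ := h e (mem_bitIndices_rest.2 ⟨he, hev⟩)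
      exact ⟨y, by simp [hy], hey⟩

theorem collects_two_pow_sub_one {l m : ℕ} : Collects G H s l v (2 ^ m - 1) ↔
    ∃ q : G.Walk v s, q.length = l ∧ ∀ e < m, ∃ w ∈ q.support, H e w := by
  simp only [Collects, Nat.mem_bitIndices, Nat.testBit_two_pow_sub_one, decide_eq_true_eq]

end Collect

end MESP

namespace RAM

/-! ### Total correctness with a time bound -/

/-- Total correctness: started with memory `σ`, the program `P` halts within `c` steps in a memory
that satisfies `Q`. -/
def Halts (P : Prog) (σ : State) (c : ℕ) (Q : State → Prop) : Prop :=
  ∃ t τ, Exec P σ t τ ∧ t ≤ c ∧ Q τ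

namespace Halts

variable {P P' : Prog} {σ : State} {a b c : ℕ} {Q R : State → Prop}

theorem mono (h : Halts P σ a R) (hc : a ≤ c) (hQ : ∀ τ, R τ → Q τ) : Halts P σ c Q :=
  let ⟨t, τ, hx, ht, hR⟩ := h
  ⟨t, τ, hx, ht.trans hc, hQ τ hR⟩

theorem skip (h : Q σ) : Halts .skip σ 1 Q :=
  ⟨_, _, .skip σ, le_rfl, h⟩

theorem assign {x : ℕ} {e : Expr} (h : Q (σ.setVar x (e.eval σ))) :
    Halts (.assign x e) σ (e.cost + 1) Q :=
  ⟨_, _, .assign σ x e, le_rfl, h⟩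

theorem store {r : ℕ} {i e : Expr} (h : Q (σ.setArr r (i.eval σ) (e.eval σ))) :
    Halts (.store r i e) σ (i.cost + e.cost + 1) Q :=
  ⟨_, _, .store σ r i e, le_rfl, h⟩

theorem seq (h : Halts P σ a R) (h' : ∀ τ, R τ → Halts P' τ b Q) :
    Halts (.seq P P') σ (a + b + 1) Q := by
  obtain ⟨s, τ, hs, hsa, hR⟩ := h
  obtain ⟨t, ρ, ht, htb, hQ⟩ := h' τ hR
  exact ⟨_, _, .seq hs ht, by omega, hQ⟩

theorem cond {e : Expr} (h : e.eval σ ≠ 0 → Halts P σ c Q) (h' : e.eval σ = 0 → Halts P' σ c Q) :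
    Halts (.cond e P P') σ (e.cost + c + 1) Q := by
  by_cases he : e.eval σ = 0
  · obtain ⟨t, τ, hx, ht, hQ⟩ := h' he
    exact ⟨_, _, .cond_false he hx, by omega, hQ⟩
  · obtain ⟨t, τ, hx, ht, hQ⟩ := h he
    exact ⟨_, _, .cond_true he hx, by omega, hQ⟩

theorem loop_lt {x y N : ℕ} {I : ℕ → State → Prop} {f : ℕ → ℕ}
    (hx : ∀ i τ, I i τ → τ.var x = i) (hy : ∀ i τ, I i τ → τ.var y = N)
    (hP : ∀ i < N, ∀ τ, I i τ → Halts P τ (f i) (I (i + 1))) (h0 : I 0 σ) :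
    Halts (.loop (.lt (.var x) (.var y)) P) σ (4 + ∑ i ∈ Finset.range N, (f i + 4)) (I N) := by
  suffices h : ∀ i ≤ N, ∀ τ, I i τ → Halts (.loop (.lt (.var x) (.var y)) P) τ
      (4 + ∑ j ∈ Finset.Ico i N, (f j + 4)) (I N) by
    simpa only [Finset.range_eq_Ico] using h 0 (Nat.zero_le N) σ h0
  intro i hi
  induction hi using Nat.decreasingInduction with
  | self =>
    intro τ hI
    exact ⟨_, _, .loop_false (by simp [Expr.eval, hx N τ hI, hy N τ hI]), by simp [Expr.cost], hI⟩
  | of_succ i hi ih =>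
    intro τ hI
    obtain ⟨s, τ', hs, hsf, hI'⟩ := hP i hi τ hI
    obtain ⟨t, ρ, ht, htf, hN⟩ := ih τ' hI'
    refine ⟨_, _, .loop_true (by simp [Expr.eval, hx i τ hI, hy i τ hI, hi]) hs ht, ?_, hN⟩
    rw [Finset.sum_eq_sum_Ico_succ_bot hi]
    simp only [Expr.cost]
    omega

end Halts

/-- Two memories agree on all arrays and on the variables below `b`. Variables from `b` on are
the scratch space of compiled code. -/
structure State.EqBelow (b : ℕ) (σ τ : State) : Prop where
  arr : σ.arr = τ.arr
  var : ∀ y < b, σ.var y = τ.var y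

namespace State

variable {a b c v w x y : ℕ} {σ τ ρ : State}

@[simp] theorem var_setVar_self : (σ.setVar x v).var x = v := by simp [setVar]

theorem var_setVar_of_ne (h : y ≠ x) : (σ.setVar x v).var y = σ.var y := by simp [setVar, h]

@[simp] theorem arr_setVar : (σ.setVar x v).arr = σ.arr := rfl

@[simp] theorem var_setArr {i : ℕ} : (σ.setArr a i v).var = σ.var := rfl

theorem setVar_setVar_self : (σ.setVar x v).setVar x w = σ.setVar x w := by
  simp [setVar]

theorem setVar_var_self : σ.setVar x (σ.var x) = σ := by
  simp [setVar]

namespace EqBelow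

@[refl] theorem refl (b : ℕ) (σ : State) : EqBelow b σ σ := ⟨rfl, fun _ _ => rfl⟩

theorem trans (h : EqBelow b σ τ) (h' : EqBelow b τ ρ) : EqBelow b σ ρ :=
  ⟨h.arr.trans h'.arr, fun y hy => (h.var y hy).trans (h'.var y hy)⟩

theorem mono (h : EqBelow c σ τ) (hb : b ≤ c) : EqBelow b σ τ :=
  ⟨h.arr, fun y hy => h.var y (hy.trans_le hb)⟩

theorem setVar (h : EqBelow b σ τ) (x v : ℕ) : EqBelow b (σ.setVar x v) (τ.setVar x v) := by
  refine ⟨h.arr, fun y hy => ?_⟩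
  obtain rfl | hyx := eq_or_ne y x
  · simp
  · simpa [var_setVar_of_ne hyx] using h.var y hy

theorem setVar_left (h : EqBelow b σ τ) (hx : b ≤ x) (v : ℕ) : EqBelow b (σ.setVar x v) τ :=
  ⟨h.arr, fun y hy => (var_setVar_of_ne (by omega)).trans (h.var y hy)⟩

theorem setArr (h : EqBelow b σ τ) (a i v : ℕ) : EqBelow b (σ.setArr a i v) (τ.setArr a i v) :=
  ⟨by simp [State.setArr, h.arr], h.var⟩

end EqBelow
end State

/-! ### Terms with bounded sums -/

/-- The binary operations of the machine. -/
inductive BinOp : Type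
  | add | sub | lt | eq

namespace BinOp

/-- The value of a binary operation; a comparison is worth `1` or `0`. -/
def eval : BinOp → ℕ → ℕ → ℕ
  | add, a, b => a + b
  | sub, a, b => a - b
  | lt, a, b => if a < b then 1 else 0
  | eq, a, b => if a = b then 1 else 0

/-- The machine expression for a binary operation. -/
def toExpr : BinOp → Expr → Expr → Expr
  | add => .add
  | sub => .sub
  | lt => .lt
  | eq => .eq

theorem eval_toExpr (op : BinOp) (e f : Expr) (σ : State) :
    (op.toExpr e f).eval σ = op.eval (e.eval σ) (f.eval σ) := by
  cases op <;> rfl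

theorem cost_toExpr (op : BinOp) (e f : Expr) : (op.toExpr e f).cost = e.cost + f.cost + 1 := by
  cases op <;> rfl

end BinOp

/-- Terms: machine expressions extended by case distinction and bounded sums. -/
inductive Term : Type
  | lit (c : ℕ) : Term
  | var (x : ℕ) : Term
  | get (a : ℕ) (i : Term) : Term
  | bin (op : BinOp) (e f : Term) : Term
  | ite (b e f : Term) : Term
  /-- the sum of `e` over all values of the variable `x` below `N` -/
  | sum (x : ℕ) (N e : Term) : Term

namespace Term

/-- `e + f`. -/
abbrev add (e f : Term) : Term := .bin .add e f

/-- The truncated difference `e - f`. -/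
abbrev sub (e f : Term) : Term := .bin .sub e f

/-- `1` if `e < f`, and `0` otherwise. -/
abbrev lt (e f : Term) : Term := .bin .lt e f

/-- `1` if `e = f`, and `0` otherwise. -/
abbrev eq (e f : Term) : Term := .bin .eq e f

/-- The value of a term. -/
def eval : Term → State → ℕ
  | lit c, _ => c
  | var x, σ => σ.var x
  | get a i, σ => σ.arr a (i.eval σ)
  | bin op e f, σ => op.eval (e.eval σ) (f.eval σ)
  | ite b e f, σ => if b.eval σ = 0 then f.eval σ else e.eval σ
  | sum x N e, σ => ∑ i ∈ Finset.range (N.eval σ), e.eval (σ.setVar x i)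

/-- A bound for the number of steps that the compiled term takes. -/
def cost : Term → State → ℕ
  | lit _, _ => 2
  | var _, _ => 2
  | get _ i, σ => i.cost σ + 4
  | bin _ e f, σ => e.cost σ + f.cost σ + 6
  | ite b e f, σ => b.cost σ + (if b.eval σ = 0 then f.cost σ else e.cost σ) + 3
  | sum x N e, σ => N.cost σ + 17 + ∑ i ∈ Finset.range (N.eval σ), (e.cost (σ.setVar x i) + 14)

/-- A strict upper bound for the variables of a term. -/
def varBound : Term → ℕ
  | lit _ => 0
  | var x => x + 1
  | get _ i => i.varBound
  | bin _ e f => max e.varBound f.varBound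
  | ite b e f => max b.varBound (max e.varBound f.varBound)
  | sum x N e => max (x + 1) (max N.varBound e.varBound)

/-- The machine program that leaves the value of a term in variable `d` and uses the larger
variables as scratch space. -/
def compile : Term → ℕ → Prog
  | lit c, d => .assign d (.lit c)
  | var x, d => .assign d (.var x)
  | get a i, d => .seq (i.compile d) (.assign d (.get a (.var d)))
  | bin op e f, d => .seq (e.compile d) (.seq (f.compile (d + 1))
      (.assign d (op.toExpr (.var d) (.var (d + 1)))))
  | ite b e f, d => .seq (b.compile d) (.cond (.var d) (e.compile d) (f.compile d))
  | sum x N e, d =>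
    .seq (N.compile (d + 1))
      (.seq (.assign (d + 2) (.var x))
      (.seq (.assign d (.lit 0))
      (.seq (.assign x (.lit 0))
      (.seq (.loop (.lt (.var x) (.var (d + 1)))
        (.seq (e.compile (d + 3)) (.seq (.assign d (.add (.var d) (.var (d + 3))))
          (.assign x (.add (.var x) (.lit 1))))))
      (.assign x (.var (d + 2)))))))

theorem eval_congr_and_cost_congr (e : Term) {σ τ : State} (h : σ.EqBelow e.varBound τ) :
    e.eval σ = e.eval τ ∧ e.cost σ = e.cost τ := by
  induction e generalizing σ τ with
  | lit c => exact ⟨rfl, rfl⟩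
  | var x => exact ⟨h.var x (Nat.lt_succ_self x), rfl⟩
  | get a i ih => simp only [eval, cost, ih h, h.arr, and_self]
  | bin op e f ihe ihf =>
    simp only [eval, cost, ihe (h.mono (le_max_left _ _)), ihf (h.mono (le_max_right _ _)),
      and_self]
  | ite b e f ihb ihe ihf =>
    simp only [varBound] at h
    simp only [eval, cost, ihb (h.mono (by omega)), ihe (h.mono (by omega)),
      ihf (h.mono (by omega)), and_self]
  | sum x N e ihN ihe =>
    simp only [varBound] at h
    have he (i : ℕ) := ihe ((h.mono (show e.varBound ≤ _ by omega)).setVar x i)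
    simp only [eval, cost, ihN (h.mono (by omega)), he, and_self]

theorem eval_congr (e : Term) {σ τ : State} (h : σ.EqBelow e.varBound τ) : e.eval σ = e.eval τ :=
  (e.eval_congr_and_cost_congr h).1

theorem cost_congr (e : Term) {σ τ : State} (h : σ.EqBelow e.varBound τ) : e.cost σ = e.cost τ :=
  (e.eval_congr_and_cost_congr h).2

/-- Correctness of the program compiled from a term for one initial memory. -/
def CompilesAt (e : Term) (d : ℕ) (σ : State) : Prop :=
  Halts (e.compile d) σ (e.cost σ) fun τ => τ.var d = e.eval σ ∧ τ.EqBelow d σ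

theorem CompilesAt.of_eqBelow {e : Term} {d b : ℕ} {σ τ : State} (h : e.CompilesAt d σ)
    (hb : e.varBound ≤ b) (hστ : σ.EqBelow b τ) :
    Halts (e.compile d) σ (e.cost τ) fun ρ => ρ.var d = e.eval τ ∧ ρ.EqBelow d σ := by
  rw [← e.eval_congr (hστ.mono hb), ← e.cost_congr (hστ.mono hb)]
  exact h

theorem compilesAt_bin {op : BinOp} {e f : Term} {d : ℕ} {σ : State} (hf : f.varBound ≤ d)
    (ihe : e.CompilesAt d σ) (ihf : ∀ τ, f.CompilesAt (d + 1) τ) :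
    (bin op e f).CompilesAt d σ := by
  refine (ihe.seq fun τ ⟨hτd, hτ⟩ => (((ihf τ).of_eqBelow hf hτ).seq
    fun ρ ⟨hρd, hρ⟩ => .assign (Q := fun ρ => ρ.var d = (bin op e f).eval σ ∧ ρ.EqBelow d σ)
      ⟨?_, ((hρ.mono d.le_succ).trans hτ).setVar_left le_rfl _⟩)).mono ?_ fun _ h => h
  · simp [BinOp.eval_toExpr, Expr.eval, eval, hρd, hρ.var d d.lt_succ_self, hτd]
  · simp only [BinOp.cost_toExpr, Expr.cost, cost]
    omega

theorem compilesAt_ite {b e f : Term} {d : ℕ} {σ : State} (he : e.varBound ≤ d)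
    (hf : f.varBound ≤ d) (ihb : b.CompilesAt d σ) (ihe : ∀ τ, e.CompilesAt d τ)
    (ihf : ∀ τ, f.CompilesAt d τ) : (ite b e f).CompilesAt d σ := by
  refine (ihb.seq fun τ ⟨hτd, hτ⟩ => .cond
    (c := if b.eval σ = 0 then f.cost σ else e.cost σ)
    (Q := fun ρ => ρ.var d = (ite b e f).eval σ ∧ ρ.EqBelow d σ) ?_ ?_).mono ?_ fun _ h => h
  · intro h0
    simp only [Expr.eval, hτd] at h0
    simp only [eval, h0, if_false]
    exact ((ihe τ).of_eqBelow he hτ).mono le_rfl fun ρ hρ => ⟨hρ.1, hρ.2.trans hτ⟩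
  · intro h0
    simp only [Expr.eval, hτd] at h0
    simp only [eval, h0, if_true]
    exact ((ihf τ).of_eqBelow hf hτ).mono le_rfl fun ρ hρ => ⟨hρ.1, hρ.2.trans hτ⟩
  · simp only [Expr.cost, cost]
    omega

/-- The loop invariant of a compiled sum after `i` rounds. -/
structure SumInvariant (x : ℕ) (N e : Term) (d : ℕ) (σ : State) (i : ℕ) (τ : State) : Prop where
  counter : τ.var x = i
  bound : τ.var (d + 1) = N.eval σ
  saved : τ.var (d + 2) = σ.var x
  acc : τ.var d = ∑ j ∈ Finset.range i, e.eval (σ.setVar x j)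
  frame : τ.EqBelow d (σ.setVar x i)

theorem SumInvariant.halts_step {x : ℕ} {N e : Term} {d i : ℕ} {σ τ : State} (hx : x < d)
    (he : e.varBound ≤ d) (ihe : e.CompilesAt (d + 3) τ) (h : SumInvariant x N e d σ i τ) :
    Halts (.seq (e.compile (d + 3)) (.seq (.assign d (.add (.var d) (.var (d + 3))))
      (.assign x (.add (.var x) (.lit 1))))) τ (e.cost (σ.setVar x i) + 10)
      (SumInvariant x N e d σ (i + 1)) := by
  refine ((ihe.of_eqBelow he h.frame).seq fun ρ ⟨hρd, hρ⟩ => .seq (.assign (Q := fun ρ' =>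
    ρ' = ρ.setVar d (ρ.var d + ρ.var (d + 3))) rfl) fun ρ' hρ' => .assign ?_).mono ?_ fun _ h => h
  · subst hρ'
    have hxd : x ≠ d := hx.ne
    have hρx : ρ.var x = i := (hρ.var x (by omega)).trans h.counter
    simp only [Expr.eval, State.var_setVar_of_ne hxd, hρx]
    refine ⟨State.var_setVar_self, ?_, ?_, ?_, h.frame.arr ▸ hρ.arr, fun y hy => ?_⟩
    · simp [State.setVar, show d + 1 ≠ x by omega, hρ.var (d + 1), h.bound]
    · simp [State.setVar, show d + 2 ≠ x by omega, hρ.var (d + 2), h.saved]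
    · simp [State.setVar, hxd.symm, Finset.sum_range_succ, hρ.var d, h.acc, hρd]
    · obtain rfl | hyx := eq_or_ne y x
      · simp
      · have := h.frame.var y hy
        simp_all [State.setVar, hy.ne, hρ.var y (by omega)]
  · simp only [Expr.cost]
    omega

theorem compilesAt_sum {x : ℕ} {N e : Term} {d : ℕ} {σ : State} (hx : x < d)
    (he : e.varBound ≤ d) (ihN : N.CompilesAt (d + 1) σ) (ihe : ∀ τ, e.CompilesAt (d + 3) τ) :
    (sum x N e).CompilesAt d σ := by
  refine (ihN.seq fun τ ⟨hτd, hτ⟩ =>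
    .seq (.assign (Q := (· = τ.setVar (d + 2) (τ.var x))) rfl) fun _ h₁ =>
    .seq (.assign (Q := (· = (τ.setVar (d + 2) (τ.var x)).setVar d 0)) (by rw [h₁]; rfl))
      fun _ h₂ =>
    .seq (.assign (Q := SumInvariant x N e d σ 0) ?_) fun ρ hρ =>
    .seq (.loop_lt (fun _ _ h => h.counter) (fun _ _ h => h.bound)
      (fun i _ ρ h => h.halts_step hx he (ihe ρ)) hρ) fun ρ hρ => .assign
        (Q := fun ρ => ρ.var d = (sum x N e).eval σ ∧ ρ.EqBelow d σ) ?_).mono ?_ fun _ h => h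
  · subst h₂
    refine ⟨State.var_setVar_self, ?_, ?_, ?_, hτ.arr, fun y hy => ?_⟩
    · simp [State.setVar, hτd, show d + 1 ≠ x by omega]
    · simp [State.setVar, show d + 2 ≠ x by omega, hτ.var x (by omega)]
    · simp [State.setVar, hx.ne']
    · obtain rfl | hyx := eq_or_ne y x
      · simp [Expr.eval]
      · simp [State.setVar, hyx, hy.ne, show y ≠ d + 2 by omega, hτ.var y (by omega)]
  · refine ⟨by simp [State.setVar, hx.ne', hρ.acc, eval], ?_⟩
    have := hρ.frame.setVar x (σ.var x)
    rw [State.setVar_setVar_self, State.setVar_var_self] at this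
    simpa only [Expr.eval, hρ.saved] using this
  · simp only [Expr.cost, cost, Finset.sum_add_distrib, Finset.sum_const, smul_eq_mul]
    omega

theorem compilesAt (e : Term) {d : ℕ} (hd : e.varBound ≤ d) (σ : State) : e.CompilesAt d σ := by
  induction e generalizing d σ with
  | lit | var =>
    exact .assign ⟨by simp [Expr.eval, eval], (State.EqBelow.refl d σ).setVar_left le_rfl _⟩
  | get a i ih =>
    refine ((ih hd σ).seq fun τ ⟨hτd, hτ⟩ => .assign
      (Q := fun ρ => ρ.var d = (get a i).eval σ ∧ ρ.EqBelow d σ)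
      ⟨by simp [Expr.eval, eval, hτd, hτ.arr], hτ.setVar_left le_rfl _⟩).mono ?_ fun _ h => h
    simp only [Expr.cost, cost]
    omega
  | bin op e f ihe ihf =>
    simp only [varBound, max_le_iff] at hd
    exact compilesAt_bin hd.2 (ihe hd.1 σ) (ihf (by omega))
  | ite b e f ihb ihe ihf =>
    simp only [varBound, max_le_iff] at hd
    exact compilesAt_ite hd.2.1 hd.2.2 (ihb hd.1 σ) (ihe hd.2.1) (ihf hd.2.2)
  | sum x N e ihN ihe =>
    simp only [varBound, max_le_iff] at hd
    exact compilesAt_sum hd.1 hd.2.2 (ihN (by omega) σ) (ihe (by omega))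

end Term

end RAM

namespace RAM

/-! ### Commands with bounded loops -/

/-- Commands: assignments of terms, conditionals and bounded loops. -/
inductive Cmd : Type
  | set (x : ℕ) (e : Term) : Cmd
  | store (a : ℕ) (i e : Term) : Cmd
  | seq (p q : Cmd) : Cmd
  /-- if `b` is nonzero then `p` -/
  | when (b : Term) (p : Cmd) : Cmd
  /-- for `x = 0, …, N - 1` do `p`, where the value of `N` before the loop counts -/
  | loop (x : ℕ) (N : Term) (p : Cmd) : Cmd

namespace Cmd

/-- The memory after `i` rounds of a loop with counter `x` and body `f`. -/
def iterate (f : State → State) (x : ℕ) (σ : State) : ℕ → State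
  | 0 => σ
  | i + 1 => f ((iterate f x σ i).setVar x i)

/-- The memory after the execution of a command. -/
def run : Cmd → State → State
  | set x e, σ => σ.setVar x (e.eval σ)
  | store a i e, σ => σ.setArr a (i.eval σ) (e.eval σ)
  | seq p q, σ => q.run (p.run σ)
  | when b p, σ => if b.eval σ = 0 then σ else p.run σ
  | loop x N p, σ => iterate p.run x σ (N.eval σ)

/-- A bound for the number of steps that the compiled command takes. -/
def cost : Cmd → State → ℕ
  | set _ e, σ => e.cost σ + 3
  | store _ i e, σ => i.cost σ + e.cost σ + 5
  | seq p q, σ => p.cost σ + q.cost (p.run σ) + 1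
  | when b p, σ => b.cost σ + (if b.eval σ = 0 then 0 else p.cost σ) + 4
  | loop x N p, σ => N.cost σ + 8 + ∑ i ∈ Finset.range (N.eval σ),
      (p.cost ((iterate p.run x σ i).setVar x i) + 12)

/-- A strict upper bound for the variables of a command. -/
def varBound : Cmd → ℕ
  | set x e => max (x + 1) e.varBound
  | store _ i e => max i.varBound e.varBound
  | seq p q => max p.varBound q.varBound
  | when b p => max b.varBound p.varBound
  | loop x N p => max (x + 1) (max N.varBound p.varBound)

/-- The machine program of a command, which uses the variables from `d` on as scratch space. -/
def compile : Cmd → ℕ → Prog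
  | set x e, d => .seq (e.compile d) (.assign x (.var d))
  | store a i e, d =>
    .seq (i.compile d) (.seq (e.compile (d + 1)) (.store a (.var d) (.var (d + 1))))
  | seq p q, d => .seq (p.compile d) (q.compile d)
  | when b p, d => .seq (b.compile d) (.cond (.var d) (p.compile d) .skip)
  | loop x N p, d => .seq (N.compile (d + 1)) (.seq (.assign d (.lit 0))
      (.loop (.lt (.var d) (.var (d + 1))) (.seq (.assign x (.var d))
        (.seq (p.compile (d + 2)) (.assign d (.add (.var d) (.lit 1)))))))

/-- The machine memory `τ` represents `σ` on the variables below `b`, and it agrees with the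
machine memory `σ'` on the scratch variables from `b` to `d`. -/
structure Simulates (b d : ℕ) (σ σ' τ : State) : Prop where
  eqBelow : τ.EqBelow b σ
  scratch : ∀ y < d, b ≤ y → τ.var y = σ'.var y

theorem Simulates.trans {b d : ℕ} {σ ρ σ' τ τ' : State} (h : Simulates b d σ σ' τ)
    (h' : Simulates b d ρ τ τ') : Simulates b d ρ σ' τ' :=
  ⟨h'.eqBelow, fun y hy hby => (h'.scratch y hy hby).trans (h.scratch y hy hby)⟩

theorem Simulates.of_eqBelow {b d : ℕ} {σ σ' τ : State} (hσ : σ'.EqBelow b σ) (hbd : b ≤ d)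
    (h : τ.EqBelow d σ') : Simulates b d σ σ' τ :=
  ⟨(h.mono hbd).trans hσ, fun y hy _ => h.var y hy⟩

/-- Correctness of the program compiled from a command `c` for all machine memories that represent
`σ`. -/
def CompilesAt (c : Cmd) (b d : ℕ) (σ : State) : Prop :=
  ∀ σ' : State, σ'.EqBelow b σ →
    Halts (c.compile d) σ' (c.cost σ) (Simulates b d (c.run σ) σ')

variable {b d : ℕ} {σ : State}

theorem halts_compile_term {e : Term} {σ' : State} (he : e.varBound ≤ b) (hbd : b ≤ d)
    (hσ : σ'.EqBelow b σ) :
    Halts (e.compile d) σ' (e.cost σ) fun τ => τ.var d = e.eval σ ∧ τ.EqBelow d σ' :=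
  (e.compilesAt (he.trans hbd) σ').of_eqBelow he hσ

theorem compilesAt_set {x : ℕ} {e : Term} (hx : x < b) (he : e.varBound ≤ b) (hbd : b ≤ d) :
    (set x e).CompilesAt b d σ := by
  refine fun σ' hσ => ((halts_compile_term he hbd hσ).seq fun τ ⟨hτd, hτ⟩ => .assign
    (Q := Simulates b d ((set x e).run σ) σ') ?_).mono ?_ fun _ h => h
  · simp only [Expr.eval, hτd]
    refine ⟨((hτ.mono hbd).trans hσ).setVar x _, fun y hy hby => ?_⟩
    rw [State.var_setVar_of_ne (by omega), hτ.var y hy]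
  · simp only [Expr.cost, cost]
    omega

theorem compilesAt_store {a : ℕ} {i e : Term} (hi : i.varBound ≤ b) (he : e.varBound ≤ b)
    (hbd : b ≤ d) : (store a i e).CompilesAt b d σ := by
  refine fun σ' hσ => ((halts_compile_term hi hbd hσ).seq fun τ ⟨hτd, hτ⟩ =>
    (halts_compile_term he (hbd.trans d.le_succ) ((hτ.mono hbd).trans hσ)).seq fun ρ ⟨hρd, hρ⟩ =>
      .store (Q := Simulates b d ((store a i e).run σ) σ') ?_).mono ?_ fun _ h => h
  · simp only [Expr.eval, hρd, hρ.var d d.lt_succ_self, hτd]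
    have hρσ := (hρ.mono d.le_succ).trans hτ
    exact ⟨((hρσ.mono hbd).trans hσ).setArr a _ _, fun y hy _ => hρσ.var y hy⟩
  · simp only [Expr.cost, cost]
    omega

theorem compilesAt_seq {p q : Cmd} (hp : p.CompilesAt b d σ) (hq : q.CompilesAt b d (p.run σ)) :
    (seq p q).CompilesAt b d σ := fun σ' hσ =>
  (hp σ' hσ).seq fun τ hτ => (hq τ hτ.eqBelow).mono le_rfl fun _ hρ => hτ.trans hρ

theorem compilesAt_when {e : Term} {p : Cmd} (he : e.varBound ≤ b) (hbd : b ≤ d)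
    (ihp : p.CompilesAt b d σ) : (when e p).CompilesAt b d σ := by
  refine fun σ' hσ => ((halts_compile_term he hbd hσ).seq fun τ ⟨hτd, hτ⟩ => .cond
    (c := (if e.eval σ = 0 then 0 else p.cost σ) + 1)
    (Q := Simulates b d ((when e p).run σ) σ') ?_ ?_).mono ?_ fun _ h => h
  · intro h0
    simp only [Expr.eval, hτd] at h0
    simp only [run, h0, if_false]
    exact (ihp τ ((hτ.mono hbd).trans hσ)).mono (by omega)
      fun ρ hρ => (Simulates.of_eqBelow hσ hbd hτ).trans hρ
  · intro h0
    simp only [Expr.eval, hτd] at h0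
    simp only [run, h0, if_true]
    exact .skip (.of_eqBelow hσ hbd hτ)
  · simp only [Expr.cost, cost]
    omega

/-- The loop invariant of a compiled loop after `i` rounds. -/
structure LoopInvariant (x : ℕ) (N : ℕ) (p : Cmd) (b d : ℕ) (σ σ' : State) (i : ℕ)
    (τ : State) : Prop where
  counter : τ.var d = i
  bound : τ.var (d + 1) = N
  simulates : Simulates b d (iterate p.run x σ i) σ' τ

theorem LoopInvariant.halts_step {x N i : ℕ} {p : Cmd} {σ' τ : State} (hx : x < b) (hbd : b ≤ d)
    (ihp : p.CompilesAt b (d + 2) ((iterate p.run x σ i).setVar x i))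
    (h : LoopInvariant x N p b d σ σ' i τ) :
    Halts (.seq (.assign x (.var d)) (.seq (p.compile (d + 2))
      (.assign d (.add (.var d) (.lit 1))))) τ (p.cost ((iterate p.run x σ i).setVar x i) + 8)
      (LoopInvariant x N p b d σ σ' (i + 1)) := by
  refine (Halts.seq (.assign (Q := (· = τ.setVar x i)) (by simp [Expr.eval, h.counter]))
    fun _ hρ => (ihp _ (hρ ▸ h.simulates.eqBelow.setVar x i)).seq fun ρ' hρ' =>
      .assign ?_).mono ?_ fun _ h => h
  · subst hρ
    have hρd : ρ'.var d = i := by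
      rw [hρ'.scratch d (by omega) hbd, State.var_setVar_of_ne (by omega), h.counter]
    simp only [Expr.eval, hρd]
    refine ⟨State.var_setVar_self, ?_, hρ'.eqBelow.setVar_left hbd _, fun y hy hby => ?_⟩
    · rw [State.var_setVar_of_ne (by omega), hρ'.scratch (d + 1) (by omega) (by omega),
        State.var_setVar_of_ne (by omega), h.bound]
    · rw [State.var_setVar_of_ne (by omega), hρ'.scratch y (by omega) hby,
        State.var_setVar_of_ne (by omega), h.simulates.scratch y hy hby]
  · simp only [Expr.cost]
    omega

theorem compilesAt_loop {x : ℕ} {N : Term} {p : Cmd} (hx : x < b) (hN : N.varBound ≤ b)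
    (hbd : b ≤ d) (ihp : ∀ σ, p.CompilesAt b (d + 2) σ) : (loop x N p).CompilesAt b d σ := by
  refine fun σ' hσ => ((halts_compile_term hN (hbd.trans d.le_succ) hσ).seq fun τ ⟨hτd, hτ⟩ =>
    .seq (.assign (Q := LoopInvariant x (N.eval σ) p b d σ σ' 0) ?_) fun ρ hρ =>
      .loop_lt (fun _ _ h => h.counter) (fun _ _ h => h.bound)
        (fun i _ ρ h => h.halts_step hx hbd (ihp _)) hρ).mono ?_ fun _ h => h.simulates
  · have hτσ := hτ.mono d.le_succ
    refine ⟨State.var_setVar_self, ?_, ((hτσ.mono hbd).trans hσ).setVar_left hbd _, ?_⟩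
    · rw [State.var_setVar_of_ne (by omega), hτd]
    · intro y hy _
      rw [State.var_setVar_of_ne hy.ne, hτσ.var y hy]
  · simp only [Expr.cost, cost, Finset.sum_add_distrib, Finset.sum_const, smul_eq_mul]
    omega

theorem compilesAt (c : Cmd) (hb : c.varBound ≤ b) (hbd : b ≤ d) (σ : State) :
    c.CompilesAt b d σ := by
  induction c generalizing d σ <;> simp only [varBound, max_le_iff] at hb
  case set => exact compilesAt_set hb.1 hb.2 hbd
  case store => exact compilesAt_store hb.1 hb.2 hbd
  case seq ihp ihq => exact compilesAt_seq (ihp hb.1 hbd σ) (ihq hb.2 hbd _)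
  case when ihp => exact compilesAt_when hb.1 hbd (ihp hb.2 hbd σ)
  case loop ihp => exact compilesAt_loop hb.1 hb.2.1 hbd (ihp hb.2.2 (by omega))

theorem exists_exec (c : Cmd) (σ : State) :
    ∃ t τ, Exec (c.compile c.varBound) σ t τ ∧ t ≤ c.cost σ ∧ τ.EqBelow c.varBound (c.run σ) :=
  let ⟨t, τ, hx, ht, hτ⟩ := c.compilesAt le_rfl le_rfl σ σ (.refl _ σ)
  ⟨t, τ, hx, ht, hτ.eqBelow⟩

end Cmd
end RAM

namespace RAM

/-! ### Boolean terms -/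

namespace Term

/-- A term read as a condition: it is true if its value is nonzero. -/
def Holds (b : Term) (σ : State) : Prop := b.eval σ ≠ 0

/-- The negation of a condition. -/
abbrev not (b : Term) : Term := ite b (lit 0) (lit 1)

/-- The conjunction of two conditions. -/
abbrev and (b c : Term) : Term := ite b c (lit 0)

/-- The disjunction of two conditions. -/
abbrev or (b c : Term) : Term := add b c

/-- The condition `e ≤ f`. -/
abbrev le (e f : Term) : Term := not (lt f e)

variable {b c e f N : Term} {σ : State}

theorem holds_not : (not b).Holds σ ↔ ¬ b.Holds σ := by
  simp only [Holds, eval]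
  split <;> simp_all

theorem holds_and : (and b c).Holds σ ↔ b.Holds σ ∧ c.Holds σ := by
  simp only [Holds, eval]
  split <;> simp_all

theorem holds_or : (or b c).Holds σ ↔ b.Holds σ ∨ c.Holds σ := by
  simp only [Holds, eval, BinOp.eval]
  omega

theorem holds_lt : (lt e f).Holds σ ↔ e.eval σ < f.eval σ := by
  simp [Holds, eval, BinOp.eval]

theorem holds_eq : (eq e f).Holds σ ↔ e.eval σ = f.eval σ := by
  simp [Holds, eval, BinOp.eval]

theorem holds_le : (le e f).Holds σ ↔ e.eval σ ≤ f.eval σ := by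
  rw [holds_not, holds_lt, not_lt]

theorem holds_sum {x : ℕ} :
    (sum x N e).Holds σ ↔ ∃ i < N.eval σ, e.Holds (σ.setVar x i) := by
  simp [Holds, eval, Finset.sum_eq_zero_iff]

open Classical in
theorem eval_ite : (ite b e f).eval σ = if b.Holds σ then e.eval σ else f.eval σ := by
  simp only [Holds, eval]
  split <;> simp_all

theorem holds_var {x : ℕ} : (var x).Holds σ ↔ σ.var x ≠ 0 := Iff.rfl

theorem eval_var {x : ℕ} : (var x).eval σ = σ.var x := rfl

theorem eval_lit {v : ℕ} : (lit v).eval σ = v := rfl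

theorem eval_get {a : ℕ} : (get a e).eval σ = σ.arr a (e.eval σ) := rfl

theorem eval_add : (add e f).eval σ = e.eval σ + f.eval σ := rfl

theorem eval_sub : (sub e f).eval σ = e.eval σ - f.eval σ := rfl

/-! ### Running times up to a factor that depends only on the program text -/

/-- The factor by which the running time of a term may exceed the number of its innermost
evaluations. -/
def size : Term → ℕ
  | lit _ => 2
  | var _ => 2
  | get _ i => i.size + 4
  | bin _ e f => e.size + f.size + 6
  | ite b e f => b.size + e.size + f.size + 3
  | sum _ N e => N.size + e.size + 31

/-- The nesting depth of sums. -/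
def depth : Term → ℕ
  | lit _ => 0
  | var _ => 0
  | get _ i => i.depth
  | bin _ e f => max e.depth f.depth
  | ite b e f => max b.depth (max e.depth f.depth)
  | sum _ _ e => e.depth + 1

/-- Every sum of the term is bounded by one of the variables `ys`, and none of these variables is
a summation variable. -/
def SumsOver (ys : List ℕ) : Term → Bool
  | lit _ => true
  | var _ => true
  | get _ i => i.SumsOver ys
  | bin _ e f => e.SumsOver ys && f.SumsOver ys
  | ite b e f => b.SumsOver ys && (e.SumsOver ys && f.SumsOver ys)
  | sum x (var y) e => ys.contains y && (!ys.contains x && e.SumsOver ys)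
  | sum _ _ _ => false

variable {ys : List ℕ} {A K : ℕ}

theorem cost_sum_le {x y : ℕ} (hK : 1 ≤ K) (hy : σ.var y ≤ K)
    (he : ∀ i, e.cost (σ.setVar x i) ≤ e.size * K ^ e.depth) :
    (sum x (var y) e).cost σ ≤ (sum x (var y) e).size * K ^ (e.depth + 1) := by
  have hsum : ∑ i ∈ Finset.range (σ.var y), (e.cost (σ.setVar x i) + 14) ≤
      K * ((e.size + 14) * K ^ e.depth) := by
    refine (Finset.sum_le_card_nsmul _ _ ((e.size + 14) * K ^ e.depth) fun i _ => ?_).trans ?_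
    · linarith [he i, Nat.one_le_pow e.depth K hK]
    · rw [Finset.card_range, smul_eq_mul]
      gcongr
  have hpow := Nat.one_le_pow (e.depth + 1) K hK
  calc (sum x (var y) e).cost σ
      ≤ 19 * K ^ (e.depth + 1) + K * ((e.size + 14) * K ^ e.depth) := by
        simp only [cost, eval]
        omega
    _ ≤ (sum x (var y) e).size * K ^ (e.depth + 1) := by
        simp only [size, pow_succ]
        linarith

theorem cost_le_size_mul_pow (he : e.SumsOver ys) (hK : 1 ≤ K) (hys : ∀ y ∈ ys, σ.var y ≤ K) :
    e.cost σ ≤ e.size * K ^ e.depth := by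
  have hmono (d d' : ℕ) (h : d ≤ d') : K ^ d ≤ K ^ d' := Nat.pow_le_pow_right hK h
  fun_induction SumsOver generalizing σ with
  | case1 | case2 => simp [cost, size, depth]
  | case3 a i ih =>
    have := Nat.one_le_pow i.depth K hK
    simp only [cost, size, depth]
    linarith [ih he hys]
  | case4 op e f ihe ihf =>
    rw [Bool.and_eq_true] at he
    have := Nat.one_le_pow (max e.depth f.depth) K hK
    have := (ihe he.1 hys).trans (Nat.mul_le_mul_left _ (hmono _ _ (le_max_left _ f.depth)))
    have := (ihf he.2 hys).trans (Nat.mul_le_mul_left _ (hmono _ _ (le_max_right e.depth _)))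
    simp only [cost, size, depth]
    linarith
  | case5 b e f ihb ihe ihf =>
    simp only [Bool.and_eq_true] at he
    have h1 := Nat.one_le_pow (max b.depth (max e.depth f.depth)) K hK
    have hb := (ihb he.1 hys).trans (Nat.mul_le_mul_left _
      (hmono _ (max b.depth (max e.depth f.depth)) (by omega)))
    have he' := (ihe he.2.1 hys).trans (Nat.mul_le_mul_left _
      (hmono _ (max b.depth (max e.depth f.depth)) (by omega)))
    have hf := (ihf he.2.2 hys).trans (Nat.mul_le_mul_left _
      (hmono _ (max b.depth (max e.depth f.depth)) (by omega)))
    simp only [cost, size, depth, add_mul]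
    split <;> omega
  | case6 x y e ih =>
    simp only [Bool.and_eq_true, Bool.not_eq_true', List.contains_eq_mem, decide_eq_true_eq,
      decide_eq_false_iff_not] at he
    refine cost_sum_le hK (hys y he.1) fun i => ih he.2.2 fun z hz => ?_
    rw [State.var_setVar_of_ne (ne_of_mem_of_not_mem hz he.2.1)]
    exact hys z hz
  | case7 => simp at he

/-- The term is evaluated within `A` steps, up to its size. -/
def Fits (e : Term) (σ : State) (A : ℕ) : Prop := 1 ≤ A ∧ e.cost σ ≤ e.size * A

theorem Fits.of_sumsOver (ys : List ℕ) (he : e.SumsOver ys) (hK : 1 ≤ K)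
    (hys : ∀ y ∈ ys, σ.var y ≤ K) (hA : K ^ e.depth ≤ A) : e.Fits σ A :=
  ⟨(Nat.one_le_pow _ _ hK).trans hA,
    (cost_le_size_mul_pow he hK hys).trans (Nat.mul_le_mul_left _ hA)⟩

theorem Fits.of_sumsOver_nil (he : e.SumsOver []) (hA : 1 ≤ A) : e.Fits σ A :=
  .of_sumsOver [] he le_rfl (by simp) (by simpa using hA)

end Term

namespace Cmd

/-- The factor by which the running time of a command may exceed the number of its innermost
rounds. -/
def size : Cmd → ℕ
  | set _ e => e.size + 3
  | store _ i e => i.size + e.size + 5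
  | seq p q => p.size + q.size + 1
  | when b p => b.size + p.size + 4
  | loop _ N p => N.size + p.size + 20

/-- The variables that a command may change. -/
def vars : Cmd → List ℕ
  | set x _ => [x]
  | store _ _ _ => []
  | seq p q => p.vars ++ q.vars
  | when _ p => p.vars
  | loop x _ p => x :: p.vars

/-- The arrays that a command may change. -/
def arrs : Cmd → List ℕ
  | set _ _ => []
  | store a _ _ => [a]
  | seq p q => p.arrs ++ q.arrs
  | when _ p => p.arrs
  | loop _ _ p => p.arrs

/-- The memories `σ` and `τ` differ only where the command `c` may change something. -/
structure Frame (c : Cmd) (σ τ : State) : Prop where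
  var : ∀ y ∉ c.vars, τ.var y = σ.var y
  arr : ∀ a ∉ c.arrs, τ.arr a = σ.arr a

variable {c p q : Cmd} {σ τ ρ : State} {x : ℕ} {N : Term}

theorem Frame.refl (c : Cmd) (σ : State) : c.Frame σ σ := ⟨fun _ _ => rfl, fun _ _ => rfl⟩

theorem Frame.trans (h : c.Frame σ τ) (h' : c.Frame τ ρ) : c.Frame σ ρ :=
  ⟨fun y hy => (h'.var y hy).trans (h.var y hy), fun a ha => (h'.arr a ha).trans (h.arr a ha)⟩

theorem Frame.mono (h : p.Frame σ τ) (hv : p.vars ⊆ q.vars) (ha : p.arrs ⊆ q.arrs) :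
    q.Frame σ τ :=
  ⟨fun y hy => h.var y fun hp => hy (hv hp), fun a hq => h.arr a fun hp => hq (ha hp)⟩

theorem Frame.setVar (h : c.Frame σ τ) (hx : x ∈ c.vars) (v : ℕ) : c.Frame σ (τ.setVar x v) :=
  ⟨fun y hy => (State.var_setVar_of_ne (ne_of_mem_of_not_mem hx hy).symm).trans (h.var y hy), h.arr⟩

theorem Frame.loop (h : (Cmd.loop x N p).Frame σ τ) (h' : p.Frame τ ρ) :
    (Cmd.loop x N p).Frame σ ρ :=
  h.trans (h'.mono (List.subset_cons_self _ _) (List.Subset.refl _))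

theorem frame_run (c : Cmd) (σ : State) : c.Frame σ (c.run σ) := by
  induction c generalizing σ with
  | set x e => exact (Frame.refl _ σ).setVar (List.mem_singleton_self x) _
  | store a i e =>
    refine ⟨fun _ _ => rfl, fun a' ha => ?_⟩
    simp [run, State.setArr, List.ne_of_not_mem_cons ha]
  | seq p q ihp ihq =>
    exact ((ihp σ).mono (List.subset_append_left _ _) (List.subset_append_left _ _)).trans
      ((ihq _).mono (List.subset_append_right _ _) (List.subset_append_right _ _))
  | when b p ih =>
    simp only [run]
    split
    · exact Frame.refl _ σ
    · exact (ih σ).mono (List.Subset.refl _) (List.Subset.refl _)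
  | loop x N p ih =>
    simp only [run]
    generalize N.eval σ = m
    induction m with
    | zero => exact Frame.refl _ σ
    | succ m ihm => exact (ihm.setVar List.mem_cons_self m).loop (ih _)

/-- The command changes none of the variables `xs` and of the arrays `as`. -/
def Keeps (c : Cmd) (xs as : List ℕ) : Bool :=
  xs.all (fun x => !c.vars.contains x) && as.all (fun a => !c.arrs.contains a)

theorem Frame.var_eq {xs as : List ℕ} (h : c.Frame σ τ) (hc : c.Keeps xs as) (hx : x ∈ xs) :
    τ.var x = σ.var x := by
  simp only [Keeps, Bool.and_eq_true, List.all_eq_true, Bool.not_eq_true', List.contains_eq_mem,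
    decide_eq_false_iff_not] at hc
  exact h.var x (hc.1 x hx)

theorem Frame.arr_eq {xs as : List ℕ} {a : ℕ} (h : c.Frame σ τ) (hc : c.Keeps xs as)
    (ha : a ∈ as) : τ.arr a = σ.arr a := by
  simp only [Keeps, Bool.and_eq_true, List.all_eq_true, Bool.not_eq_true', List.contains_eq_mem,
    decide_eq_false_iff_not] at hc
  exact h.arr a (hc.2 a ha)

/-- The command runs within `A` steps, up to its size, and leaves a memory with the property
`Q`. -/
structure Spec (c : Cmd) (σ : State) (A : ℕ) (Q : State → Prop) : Prop where
  one_le : 1 ≤ A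
  cost_le : c.cost σ ≤ c.size * A
  run : Q (c.run σ)

variable {e i b : Term} {a A B K : ℕ} {Q R : State → Prop}

theorem Spec.mono (h : p.Spec σ A R) (hAB : A ≤ B) (hQ : ∀ τ, p.Frame σ τ → R τ → Q τ) :
    p.Spec σ B Q :=
  ⟨h.one_le.trans hAB, h.cost_le.trans (Nat.mul_le_mul_left _ hAB), hQ _ (p.frame_run σ) h.run⟩

theorem Spec.mono_cost (h : p.Spec σ A Q) (hAB : A ≤ B) : p.Spec σ B Q :=
  h.mono hAB fun _ _ h => h

theorem Spec.set (he : e.Fits σ A) (hQ : Q (σ.setVar x (e.eval σ))) : (set x e).Spec σ A Q :=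
  ⟨he.1, by simp only [cost, size]; linarith [he.1, he.2], hQ⟩

theorem Spec.store (hi : i.Fits σ A) (he : e.Fits σ A)
    (hQ : Q (σ.setArr a (i.eval σ) (e.eval σ))) : (store a i e).Spec σ A Q :=
  ⟨he.1, by simp only [cost, size]; linarith [he.1, he.2, hi.2], hQ⟩

theorem Spec.seq (hp : p.Spec σ A R) (hq : ∀ τ, p.Frame σ τ → R τ → q.Spec τ A Q) :
    (seq p q).Spec σ A Q := by
  have hq := hq _ (p.frame_run σ) hp.run
  exact ⟨hp.1, by simp only [cost, size]; linarith [hp.1, hp.2, hq.2], hq.run⟩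

theorem Spec.when (hb : b.Fits σ A) (hp : b.Holds σ → p.Spec σ A Q) (h0 : ¬ b.Holds σ → Q σ) :
    (when b p).Spec σ A Q := by
  have := hb.1
  have := hb.2
  by_cases h : b.eval σ = 0
  · refine ⟨hb.1, ?_, by simpa [Cmd.run, h] using h0 (by simp [Term.Holds, h])⟩
    simp only [cost, size, add_mul, h, if_true]
    omega
  · have hp := hp h
    refine ⟨hb.1, ?_, by simpa [Cmd.run, h] using hp.run⟩
    simp only [cost, size, h, if_false]
    linarith [hp.cost_le]

theorem Spec.loop (I : ℕ → State → Prop) (hN : N.SumsOver []) (hNK : N.eval σ ≤ K)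
    (hK : 1 ≤ K) (hA : 1 ≤ A) (h0 : I 0 σ) (hI : ∀ i τ v, I i τ → I i (τ.setVar x v))
    (hp : ∀ i < N.eval σ, ∀ τ, (loop x N p).Frame σ τ → τ.var x = i → I i τ →
      p.Spec τ A (I (i + 1))) :
    (loop x N p).Spec σ (K * A) (I (N.eval σ)) := by
  have hbody (m : ℕ) (hm : m < N.eval σ) (h : (Cmd.loop x N p).Frame σ (iterate p.run x σ m))
      (hIm : I m (iterate p.run x σ m)) :=
    hp m hm _ (h.setVar List.mem_cons_self m) State.var_setVar_self (hI m _ m hIm)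
  have hinv (m : ℕ) (hm : m ≤ N.eval σ) :
      (Cmd.loop x N p).Frame σ (iterate p.run x σ m) ∧ I m (iterate p.run x σ m) := by
    induction m with
    | zero => exact ⟨Frame.refl _ σ, h0⟩
    | succ m ih =>
      obtain ⟨hF, hIm⟩ := ih (by omega)
      exact ⟨(hF.setVar List.mem_cons_self m).loop (p.frame_run _), (hbody m hm hF hIm).run⟩
  have hKA : 1 ≤ K * A := Nat.mul_pos hK hA
  refine ⟨hKA, ?_, (hinv _ le_rfl).2⟩
  have hsum : ∑ m ∈ Finset.range (N.eval σ),
      (p.cost ((iterate p.run x σ m).setVar x m) + 12) ≤ K * ((p.size + 12) * A) := by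
    refine (Finset.sum_le_card_nsmul _ _ ((p.size + 12) * A) fun m hm => ?_).trans ?_
    · have hm := Finset.mem_range.1 hm
      linarith [(hbody m hm (hinv m hm.le).1 (hinv m hm.le).2).cost_le]
    · rw [Finset.card_range, smul_eq_mul]
      gcongr
  have hNA := (Term.Fits.of_sumsOver_nil (σ := σ) hN hKA).2
  simp only [cost, size]
  linarith

end Cmd
end RAM

namespace RAM.Cmd

/-! ### Filling tables -/

/-- The first `b` cells of the array `a` have the properties prescribed by `Φ`. -/
def Filled (Φ : ℕ → ℕ → Prop) (a b : ℕ) (σ : State) : Prop := ∀ c < b, Φ c (σ.arr a c)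

variable {x y z a b A K L M m n p : ℕ} {N N' N'' e i : Term} {σ : State} {Φ : ℕ → ℕ → Prop}

theorem Filled.zero : Filled Φ a 0 σ := fun _ h => absurd h (Nat.not_lt_zero _)

theorem Filled.store (h : Filled Φ a b σ) {v : ℕ} (hv : Φ b v) :
    Filled Φ a (b + 1) (σ.setArr a b v) := by
  intro c hc
  obtain rfl | hcb := eq_or_ne c b
  · simpa [State.setArr] using hv
  · simpa [State.setArr, hcb] using h c (by omega)

/-- What has to be checked for the next assignment `a[i] := e` of a loop that fills a table, where
`i` points to the cell `c`. -/
structure FillsCell (Φ : ℕ → ℕ → Prop) (i e : Term) (A c : ℕ) (σ : State) : Prop where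
  index : i.eval σ = c
  fits : e.Fits σ A
  value : Φ c (e.eval σ)

theorem FillsCell.spec (h : FillsCell Φ i e A b σ) (hi : i.SumsOver []) (hσ : Filled Φ a b σ) :
    (store a i e).Spec σ A (Filled Φ a (b + 1)) :=
  .store (.of_sumsOver_nil hi h.fits.1) h.fits (h.index ▸ hσ.store h.value)

theorem Spec.fill (hi : i.SumsOver []) (hN : N.SumsOver []) (hNp : N.eval σ = p) (hpK : p ≤ K)
    (hK : 1 ≤ K) (hA : 1 ≤ A) (hσ : Filled Φ a b σ)
    (h : ∀ j < p, ∀ τ, (Cmd.loop x N (.store a i e)).Frame σ τ → τ.var x = j →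
      Filled Φ a (b + j) τ → FillsCell Φ i e A (b + j) τ) :
    (Cmd.loop x N (.store a i e)).Spec σ (K * A) (Filled Φ a (b + p)) := by
  subst hNp
  exact .loop (fun j => Filled Φ a (b + j)) hN hpK hK hA hσ (fun _ _ _ h => h)
    fun j hj τ hτ hx hF => (h j hj τ hτ hx hF).spec hi hF

theorem Spec.fill₂ (hxy : x ≠ y) (hi : i.SumsOver []) (hN : N.SumsOver []) (hN' : N'.SumsOver [])
    (hNp : N.eval σ = p) (hpK : p ≤ K) (hmL : m ≤ L) (hK : 1 ≤ K) (hL : 1 ≤ L) (hA : 1 ≤ A)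
    (hσ : Filled Φ a b σ)
    (hm : ∀ τ, (Cmd.loop x N (.loop y N' (.store a i e))).Frame σ τ → N'.eval τ = m)
    (h : ∀ j < p, ∀ l < m, ∀ τ, (Cmd.loop x N (.loop y N' (.store a i e))).Frame σ τ →
      τ.var x = j → τ.var y = l → Filled Φ a (b + j * m + l) τ →
      FillsCell Φ i e A (b + j * m + l) τ) :
    (Cmd.loop x N (.loop y N' (.store a i e))).Spec σ (K * (L * A))
      (Filled Φ a (b + p * m)) := by
  subst hNp
  refine .loop (fun j => Filled Φ a (b + j * m)) hN hpK hK (Nat.mul_pos hL hA)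
    (by simpa using hσ) (fun _ _ _ h => h) fun j hj τ hτ hx hF => ?_
  rw [Nat.succ_mul, ← add_assoc]
  exact .fill hi hN' (hm τ hτ) hmL hL hA hF fun l hl ρ hρ hy => h j hj l hl ρ (hτ.loop hρ)
    ((hρ.var x (by simpa [vars] using hxy)).trans hx) hy

theorem Spec.fill₃ (hxy : x ≠ y) (hxz : x ≠ z) (hyz : y ≠ z) (hi : i.SumsOver [])
    (hN : N.SumsOver []) (hN' : N'.SumsOver []) (hN'' : N''.SumsOver []) (hNp : N.eval σ = p)
    (hpK : p ≤ K) (hnL : n ≤ L) (hmM : m ≤ M) (hK : 1 ≤ K) (hL : 1 ≤ L) (hM : 1 ≤ M) (hA : 1 ≤ A)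
    (hn : ∀ τ, (Cmd.loop x N (.loop y N' (.loop z N'' (.store a i e)))).Frame σ τ → N'.eval τ = n)
    (hm : ∀ τ, (Cmd.loop x N (.loop y N' (.loop z N'' (.store a i e)))).Frame σ τ → N''.eval τ = m)
    (h : ∀ j < p, ∀ l < n, ∀ r < m, ∀ τ,
      (Cmd.loop x N (.loop y N' (.loop z N'' (.store a i e)))).Frame σ τ →
      τ.var x = j → τ.var y = l → τ.var z = r → Filled Φ a ((j * n + l) * m + r) τ →
      FillsCell Φ i e A ((j * n + l) * m + r) τ) :
    (Cmd.loop x N (.loop y N' (.loop z N'' (.store a i e)))).Spec σ (K * (L * (M * A)))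
      (Filled Φ a (p * n * m)) := by
  subst hNp
  refine .loop (fun j => Filled Φ a (j * n * m)) hN hpK hK (Nat.mul_pos hL (Nat.mul_pos hM hA))
    (by simpa using Filled.zero) (fun _ _ _ h => h) fun j hj τ hτ hx hF => ?_
  rw [Nat.succ_mul, add_mul]
  refine .fill₂ hyz hi hN' hN'' (hn τ hτ) hnL hmM hL hM hA hF (fun ρ hρ => hm ρ (hτ.loop hρ))
    fun l hl r hr ρ hρ hy hz => ?_
  rw [← add_mul]
  exact h j hj l hl r hr ρ (hτ.loop hρ) ((hρ.var x (by simp [vars, hxy, hxz])).trans hx) hy hz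

/-- The property of the cell `c` of a table with rows of length `m`, in terms of the row and the
column of the cell. -/
def OnRows (m : ℕ) (Φ : ℕ → ℕ → ℕ → Prop) (c : ℕ) : ℕ → Prop := Φ (c / m) (c % m)

theorem onRows_cell {Φ : ℕ → ℕ → ℕ → Prop} {j r v : ℕ} (hr : r < m) :
    OnRows m Φ (j * m + r) v ↔ Φ j r v := by
  rw [OnRows, Nat.mul_add_mod_of_lt hr, mul_comm, Nat.mul_add_div (by omega),
    Nat.div_eq_of_lt hr, add_zero]

theorem cell_lt {N j r : ℕ} (hj : j < N) (hr : r < m) : j * m + r < N * m :=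
  calc j * m + r < (j + 1) * m := by rw [Nat.succ_mul]; omega
    _ ≤ N * m := Nat.mul_le_mul_right m hj

theorem Filled.cell {Φ : ℕ → ℕ → ℕ → Prop} (h : Filled (OnRows m Φ) a b σ) {j r : ℕ} (hr : r < m)
    (hb : j * m + r < b) : Φ j r (σ.arr a (j * m + r)) :=
  (onRows_cell hr).1 (h _ hb)

theorem Filled.cell₃ {Φ : ℕ → ℕ → ℕ → ℕ → Prop}
    (h : Filled (OnRows m fun c r => OnRows n (fun j l => Φ j l r) c) a b σ) {j l r : ℕ}
    (hl : l < n) (hr : r < m) (hb : (j * n + l) * m + r < b) :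
    Φ j l r (σ.arr a ((j * n + l) * m + r)) :=
  (onRows_cell hl).1 (h.cell hr hb)

theorem Spec.recurrence {step base : Term} {f : ℕ → ℕ} (hN : N.SumsOver [])
    (hstep : step.SumsOver []) (hbase : base.SumsOver []) (hNp : N.eval σ = p) (hpK : p ≤ K)
    (hK : 1 ≤ K) (hzero : ∀ τ, base.eval τ = f 0)
    (hsucc : ∀ j τ, (Cmd.loop x N (.store a (.var x) (.ite (.var x) step base))).Frame σ τ →
      τ.var x = j + 1 → τ.arr a j = f j → step.eval τ = f (j + 1)) :
    (Cmd.loop x N (.store a (.var x) (.ite (.var x) step base))).Spec σ K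
      (fun τ => ∀ j < p, τ.arr a j = f j) := by
  have h := Spec.fill (A := 1) (x := x) (a := a) (i := .var x) (e := .ite (.var x) step base) rfl
    hN hNp hpK hK le_rfl (Filled.zero (Φ := fun j v => v = f j)) fun j _ τ hτ hx hF =>
      ⟨by rw [zero_add]; exact hx,
        .of_sumsOver_nil (by simp [Term.SumsOver, hstep, hbase]) le_rfl, ?_⟩
  · rw [zero_add, mul_one] at h
    exact h
  · rw [zero_add] at hF ⊢
    change (if τ.var x = 0 then _ else _) = _
    obtain _ | j := j
    · rw [if_pos hx, hzero]
    · rw [if_neg (by omega)]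
      exact hsucc j τ hτ hx (hF j (Nat.lt_succ_self j))

/-! ### Loops over the elements of a finite type -/

theorem Spec.loop_foldl {α : Type*} {n : ℕ} {p : Cmd} {f : α → Fin n → α} {R : α → State → Prop}
    {s : α} (hN : N.SumsOver []) (hNn : N.eval σ = n) (hn : 1 ≤ n) (hA : 1 ≤ A) (hs : R s σ)
    (hR : ∀ s τ v, R s τ → R s (τ.setVar x v))
    (hp : ∀ (s : α) (j : Fin n) (τ : State), (Cmd.loop x N p).Frame σ τ → τ.var x = j → R s τ →
      p.Spec τ A (R (f s j))) :
    (Cmd.loop x N p).Spec σ (n * A) (R ((List.finRange n).foldl f s)) := by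
  have hloop := Spec.loop (K := n) (fun j τ => R (((List.finRange n).take j).foldl f s) τ) hN
    hNn.le hn hA (by simpa using hs) (fun _ _ _ h => hR _ _ _ h) fun j hj τ hτ hx hRτ => by
      have hj : j < (List.finRange n).length := by simpa [hNn] using hj
      rw [List.take_add_one, List.getElem?_eq_getElem hj, List.foldl_append]
      simpa using hp _ ⟨j, by simpa using hj⟩ τ hτ hx hRτ
  simpa [hNn, List.take_of_length_le] using hloop

theorem Spec.loop_exists {p : Cmd} {P : ℕ → Prop} (hxy : x ≠ y) (hN : N.SumsOver [])
    (hNm : N.eval σ = m) (hmK : m ≤ K) (hK : 1 ≤ K) (hA : 1 ≤ A)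
    (hp : ∀ i < m, ∀ τ, (Cmd.loop x N p).Frame σ τ → τ.var x = i →
      p.Spec τ A (fun ρ => ρ.var y ≠ 0 ↔ τ.var y ≠ 0 ∨ P i)) :
    (Cmd.loop x N p).Spec σ (K * A) (fun τ => τ.var y ≠ 0 ↔ σ.var y ≠ 0 ∨ ∃ i < m, P i) := by
  subst hNm
  refine .loop (fun i τ => τ.var y ≠ 0 ↔ σ.var y ≠ 0 ∨ ∃ j < i, P j) hN hmK hK hA (by simp)
    (fun i τ v h => by rwa [State.var_setVar_of_ne hxy.symm]) fun i hi τ hτ hx h => ?_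
  refine (hp i hi τ hτ hx).mono le_rfl fun ρ _ hρ => ?_
  rw [hρ, h, or_assoc, Nat.exists_lt_succ_right]

end RAM.Cmd

namespace RAM

/-- The property `I` of memories involves only the variables `xs` and the arrays `as`. -/
def DependsOn (I : State → Prop) (xs as : List ℕ) : Prop :=
  ∀ ⦃σ τ : State⦄, (∀ x ∈ xs, τ.var x = σ.var x) → (∀ a ∈ as, τ.arr a = σ.arr a) → I σ → I τ

variable {I : State → Prop} {xs as : List ℕ} {c : Cmd} {σ τ : State}

theorem DependsOn.frame (hI : DependsOn I xs as) (h : c.Frame σ τ) (hc : c.Keeps xs as)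
    (hσ : I σ) : I τ :=
  hI (fun _ hx => h.var_eq hc hx) (fun _ ha => h.arr_eq hc ha) hσ

theorem DependsOn.setVar (hI : DependsOn I xs as) {x v : ℕ} (hx : x ∉ xs) (hσ : I σ) :
    I (σ.setVar x v) :=
  hI (fun _ hy => State.var_setVar_of_ne (ne_of_mem_of_not_mem hy hx)) (fun _ _ => rfl) hσ

theorem Term.holds_sum_fin {n x : ℕ} {N e : Term} (hN : N.eval σ = n) :
    (sum x N e).Holds σ ↔ ∃ i : Fin n, e.Holds (σ.setVar x i) := by
  rw [holds_sum, hN, Fin.exists_iff]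
  simp only [exists_prop]

/-- A number `m ≤ n` is the number of those `i < n` with `¬ m ≤ i`. -/
theorem Term.eval_sum_not {m n x : ℕ} {N e : Term} (hN : N.eval σ = n) (hm : m ≤ n)
    (he : ∀ i < n, e.Holds (σ.setVar x i) ↔ m ≤ i) : (sum x N (not e)).eval σ = m := by
  have hcount : ∑ i ∈ Finset.range n, (not e).eval (σ.setVar x i) =
      ∑ i ∈ Finset.range n, if i < m then 1 else 0 :=
    Finset.sum_congr rfl fun i hi => by
      rw [not, eval_ite]
      simp only [he i (Finset.mem_range.1 hi), ← not_lt, eval, ite_not]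
  rw [eval, hN, hcount, Finset.sum_boole, Nat.cast_id,
    show {i ∈ Finset.range n | i < m} = Finset.range m by ext i; simp; omega, Finset.card_range]

end RAM

namespace MESP.Solver

open RAM

/-! ### Memory layout -/

/-! The variables of the machine. Sums and loops bind them globally, so nested ones need different
variables. The numbers of `n`, `k` and `Arr.adj` are prescribed by `inputState`. -/

namespace Reg

abbrev n : ℕ := 0
abbrev k : ℕ := 1
abbrev size : ℕ := 2
abbrev found : ℕ := 3
abbrev d : ℕ := 4
abbrev M : ℕ := 5
abbrev g : ℕ := 6
abbrev len : ℕ := 7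
abbrev s : ℕ := 8
abbrev m : ℕ := 9
abbrev ans : ℕ := 10
abbrev picked : ℕ := 11
abbrev round : ℕ := 12
abbrev i : ℕ := 13
abbrev u : ℕ := 14
abbrev v : ℕ := 15
abbrev w : ℕ := 16
abbrev y : ℕ := 17
abbrev z : ℕ := 18
abbrev e : ℕ := 19
abbrev S : ℕ := 20

end Reg

namespace Arr

abbrev adj : ℕ := 0
abbrev mul : ℕ := 1
abbrev pow : ℕ := 2
abbrev near : ℕ := 3
abbrev dist : ℕ := 4
abbrev mulM : ℕ := 5
abbrev quo : ℕ := 6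
abbrev inX : ℕ := 7
abbrev rank : ℕ := 8
abbrev delta : ℕ := 9
abbrev uncovered : ℕ := 10
abbrev target : ℕ := 11
abbrev visits : ℕ := 12

end Arr

/-- The index of the entry in row `i` and column `j` of a matrix with `n` columns. -/
abbrev cell (i j : Term) : Term := .add (.get Arr.mul i) j

abbrev adj (u v : Term) : Term := .get Arr.adj (cell u v)

abbrev dist (u v : Term) : Term := .get Arr.dist (cell u v)

/-- The length of the tables of products and powers. -/
def tableSize (n : ℕ) : ℕ := n * n + 2 * n + 4

variable {n k : ℕ} {G : SimpleGraph (Fin n)} {σ τ : State}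

/-- The memory contains the instance `(G, k)`. -/
structure IsInput (G : SimpleGraph (Fin n)) (k : ℕ) (σ : State) : Prop where
  var_n : σ.var Reg.n = n
  var_k : σ.var Reg.k = k
  adj_iff (u v : Fin n) : σ.arr Arr.adj (u * n + v) ≠ 0 ↔ G.Adj u v

theorem IsInput.eval_n (h : IsInput G k σ) : (Term.var Reg.n).eval σ = n := h.var_n

theorem isInput_inputState : IsInput G k (inputState G k) where
  var_n := rfl
  var_k := rfl
  adj_iff u v := by
    have hcell (i j : Fin n) (h : (u : ℕ) * n + v = i * n + j) : u = i ∧ v = j := by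
      simpa [finProdFinEquiv, mul_comm, add_comm, Fin.ext_iff] using
        finProdFinEquiv.injective (a₁ := (u, v)) (a₂ := (i, j))
          (by simp [finProdFinEquiv, Fin.ext_iff]; linarith)
    simp only [inputState, true_and, ne_eq, ite_eq_right_iff, one_ne_zero, imp_false, not_not]
    refine ⟨fun ⟨i, j, hadj, h⟩ => ?_, fun h => ⟨u, v, h, rfl⟩⟩
    obtain ⟨rfl, rfl⟩ := hcell i j h
    exact hadj

theorem IsInput.dependsOn : DependsOn (IsInput G k) [Reg.n, Reg.k] [Arr.adj] := by
  intro σ τ hv ha h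
  simp only [List.forall_mem_cons] at hv ha
  exact ⟨hv.1.trans h.var_n, hv.2.1.trans h.var_k, ha.1 ▸ h.adj_iff⟩

/-- The memory also contains the multiples of `n` and the powers of `2`. -/
structure HasTables (G : SimpleGraph (Fin n)) (k : ℕ) (σ : State) : Prop extends
    IsInput G k σ where
  var_size : σ.var Reg.size = tableSize n
  mul_eq : ∀ q < tableSize n, σ.arr Arr.mul q = q * n
  pow_eq : ∀ e < tableSize n, σ.arr Arr.pow e = 2 ^ e

theorem HasTables.dependsOn : DependsOn (HasTables G k)
    [Reg.n, Reg.k, Reg.size] [Arr.adj, Arr.mul, Arr.pow] := by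
  intro σ τ hv ha h
  simp only [List.forall_mem_cons] at hv ha
  exact ⟨IsInput.dependsOn (by simp [hv]) (by simp [ha]) h.toIsInput, hv.2.2.1.trans h.var_size,
    ha.2.1 ▸ h.mul_eq, ha.2.2.1 ▸ h.pow_eq⟩

theorem tableSize_le (hn : 1 ≤ n) : tableSize n ≤ 7 * n ^ 2 := by
  unfold tableSize
  nlinarith

theorem HasTables.eval_cell (h : HasTables G k σ) {i j : Term} (hi : i.eval σ < tableSize n) :
    (cell i j).eval σ = i.eval σ * n + j.eval σ := by
  rw [Term.eval_add, Term.eval, h.mul_eq _ hi]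

theorem lt_tableSize {i : ℕ} (hi : i ≤ 2 * n + 3) : i < tableSize n := by
  unfold tableSize
  omega

theorem cell_lt_tableSize {i j : ℕ} (hi : i < n) (hj : j < n) : i * n + j < tableSize n := by
  have := Cmd.cell_lt hi hj
  unfold tableSize
  omega

theorem HasTables.holds_adj (h : HasTables G k σ) {a b : Term} {u v : Fin n} (ha : a.eval σ = u)
    (hb : b.eval σ = v) : (adj a b).Holds σ ↔ G.Adj u v := by
  rw [← h.adj_iff, Term.Holds, Term.eval, h.eval_cell (lt_tableSize (by omega)), ha, hb]

/-! ### Multiples and powers -/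

abbrev setSize : Cmd :=
  .set Reg.size (.add (.sum Reg.i (.var Reg.n) (.var Reg.n))
    (.add (.add (.var Reg.n) (.var Reg.n)) (.lit 4)))

abbrev makeMul : Cmd :=
  .loop Reg.i (.var Reg.size) (.store Arr.mul (.var Reg.i) (.ite (.var Reg.i)
    (.add (.get Arr.mul (.sub (.var Reg.i) (.lit 1))) (.var Reg.n)) (.lit 0)))

abbrev makePow : Cmd :=
  .loop Reg.i (.var Reg.size) (.store Arr.pow (.var Reg.i) (.ite (.var Reg.i)
    (.add (.get Arr.pow (.sub (.var Reg.i) (.lit 1)))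
      (.get Arr.pow (.sub (.var Reg.i) (.lit 1)))) (.lit 1)))

theorem spec_setSize (hn : 1 ≤ n) (hσ : IsInput G k σ) :
    setSize.Spec σ n (fun τ => τ.var Reg.size = tableSize n) := by
  have hvar := hσ.var_n
  refine .set (.of_sumsOver [Reg.n] rfl hn (by simp [hvar]) (by simp [Term.depth])) ?_
  have hsum : (Term.sum Reg.i (.var Reg.n) (.var Reg.n)).eval σ = n * n := by
    simp [Term.eval, hvar, State.var_setVar_of_ne]
  rw [State.var_setVar_self, Term.eval_add, hsum]
  simp only [Term.eval, BinOp.eval, hvar, tableSize]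
  ring

theorem spec_makeMul (hn : 1 ≤ n) (hσ : IsInput G k σ) (hsize : σ.var Reg.size = tableSize n) :
    makeMul.Spec σ (7 * n ^ 2) (fun τ => ∀ q < tableSize n, τ.arr Arr.mul q = q * n) :=
  .recurrence rfl rfl rfl hsize (tableSize_le hn) (by nlinarith) (by simp [Term.eval])
    fun j τ hτ hi hj => by
      have hτ := IsInput.dependsOn.frame hτ rfl hσ
      simp [Term.eval, BinOp.eval, hi, hj, hτ.var_n, Nat.succ_mul]

theorem spec_makePow (hn : 1 ≤ n) (hsize : σ.var Reg.size = tableSize n) :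
    makePow.Spec σ (7 * n ^ 2) (fun τ => ∀ e < tableSize n, τ.arr Arr.pow e = 2 ^ e) :=
  .recurrence rfl rfl rfl hsize (tableSize_le hn) (by nlinarith) (by simp [Term.eval])
    fun j τ _ hi hj => by simp [Term.eval, BinOp.eval, hi, hj, pow_succ, mul_two]

/-- The machine cannot multiply: `mul` serves for indices of matrices, `pow` for digits. -/
abbrev makeTables : Cmd := .seq setSize (.seq makeMul makePow)

theorem spec_makeTables (hn : 1 ≤ n) (hσ : IsInput G k σ) :
    makeTables.Spec σ (7 * n ^ 2) (HasTables G k) := by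
  refine ((spec_setSize hn hσ).mono_cost (by nlinarith)).seq fun τ hτ hsize => ?_
  have hτin := IsInput.dependsOn.frame hτ rfl hσ
  refine (spec_makeMul hn hτin hsize).seq fun ρ hρ hmul => ?_
  have hρsize := (hρ.var Reg.size (by decide)).trans hsize
  refine (spec_makePow hn hρsize).mono le_rfl fun υ hυ hpow => ?_
  exact ⟨IsInput.dependsOn.frame hυ rfl (IsInput.dependsOn.frame hρ rfl hτin),
    (hυ.var Reg.size (by decide)).trans hρsize,
    hυ.arr Arr.mul (by decide) ▸ hmul, hpow⟩

/-! ### Distances -/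

/-- The condition that `u` and `v` have distance at most `r`, looked up in a table. -/
abbrev near (r u v : Term) : Term := .get Arr.near (cell (cell r u) v)

/-- The table is filled by increasing radius `r`: a walk of length at most `r + 1` between distinct
vertices starts with an edge, followed by a walk of length at most `r`. -/
abbrev makeNear : Cmd :=
  .loop Reg.i (.var Reg.n) (.loop Reg.u (.var Reg.n) (.loop Reg.v (.var Reg.n)
    (.store Arr.near (cell (cell (.var Reg.i) (.var Reg.u)) (.var Reg.v))
      (.or (.eq (.var Reg.u) (.var Reg.v)) (.and (.var Reg.i) (.sum Reg.w (.var Reg.n)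
        (.and (adj (.var Reg.u) (.var Reg.w))
          (near (.sub (.var Reg.i) (.lit 1)) (.var Reg.w) (.var Reg.v)))))))))

theorem dist_lt_of_fin (hG : G.Connected) (u v : Fin n) : G.dist u v < n := by
  simpa using dist_lt_card hG u v

/-- `near` records which vertices are within a given distance of each other. -/
def IsNear (G : SimpleGraph (Fin n)) (r u v val : ℕ) : Prop :=
  ∀ a b : Fin n, u = a → v = b → (val ≠ 0 ↔ G.dist a b ≤ r)

/-- The table `near` is filled below the cell `b`. -/
abbrev FilledNear (G : SimpleGraph (Fin n)) (b : ℕ) : State → Prop :=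
  Cmd.Filled (Cmd.OnRows n fun c v => Cmd.OnRows n (fun r u => IsNear G r u v) c) Arr.near b

theorem HasTables.holds_near (h : HasTables G k σ) {b : ℕ} (hF : FilledNear G b σ)
    {r u v : Term} {a c : Fin n} (hr : r.eval σ < n) (hu : u.eval σ = a) (hv : v.eval σ = c)
    (hb : (r.eval σ * n + a) * n + c < b) : (near r u v).Holds σ ↔ G.dist a c ≤ r.eval σ := by
  have hcell : (cell r u).eval σ = r.eval σ * n + a := by
    rw [h.eval_cell (lt_tableSize (by omega)), hu]
  rw [Term.Holds, Term.eval, h.eval_cell (hcell ▸ cell_lt_tableSize hr a.2), hcell, hv]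
  exact hF.cell₃ a.2 c.2 hb a c rfl rfl

theorem spec_makeNear (hn : 1 ≤ n) (hG : G.Connected) (hσ : HasTables G k σ) :
    makeNear.Spec σ (n * (n * (n * n))) (FilledNear G (n * n * n)) := by
  have hvar τ (hτ : makeNear.Frame σ τ) := (HasTables.dependsOn.frame hτ rfl hσ).var_n
  refine .fill₃ (by decide) (by decide) (by decide) rfl rfl rfl rfl hσ.var_n le_rfl le_rfl le_rfl
    hn hn hn hn hvar hvar fun r hr u hu v hv τ hτ hi hju hjv hF => ?_
  have hτ := HasTables.dependsOn.frame hτ rfl hσ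
  have hcell : (cell (.var Reg.i) (.var Reg.u)).eval τ = r * n + u := by
    rw [hτ.eval_cell (lt_tableSize (by simp [Term.eval, hi]; omega))]
    simp [Term.eval, hi, hju]
  refine ⟨?_, .of_sumsOver [Reg.n] rfl hn (by simp [hτ.var_n]) (by simp [Term.depth]), ?_⟩
  · rw [hτ.eval_cell (hcell ▸ cell_lt_tableSize hr hu), hcell, Term.eval, hjv]
  rw [Cmd.onRows_cell hv, Cmd.onRows_cell hu]
  rintro a b rfl rfl
  change Term.Holds _ τ ↔ _
  simp only [Term.holds_or, Term.holds_eq, Term.holds_and, Term.holds_sum_fin hτ.eval_n,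
    Term.holds_var, Term.eval_var, hi, hju, hjv, Fin.val_inj]
  obtain _ | r := r
  · simp [hG.dist_eq_zero_iff]
  rw [dist_le_succ_iff hG]
  refine or_congr_right ((and_iff_right r.succ_ne_zero).trans (exists_congr fun w => ?_))
  have hw := HasTables.dependsOn.setVar (x := Reg.w) (v := w) (by decide) hτ
  have hadj := hw.holds_adj (a := .var Reg.u) (b := .var Reg.w) hju rfl
  have hr : (Term.sub (.var Reg.i) (.lit 1)).eval (τ.setVar Reg.w w) = r := by
    rw [Term.eval_sub]
    change τ.var Reg.i - 1 = r
    omega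
  have hnear := hw.holds_near (r := .sub (.var Reg.i) (.lit 1)) (u := .var Reg.w) (v := .var Reg.v)
    hF (by omega) rfl hjv (by rw [hr]; nlinarith [Cmd.cell_lt (Nat.lt_succ_self r) w.2])
  rw [hr] at hnear
  exact and_congr hadj hnear

/-- The distance of `u` and `v` is the number of radii `r` for which they are not within distance
`r`. -/
abbrev makeDist : Cmd :=
  .loop Reg.u (.var Reg.n) (.loop Reg.v (.var Reg.n)
    (.store Arr.dist (cell (.var Reg.u) (.var Reg.v))
      (.sum Reg.i (.var Reg.n) (.not (near (.var Reg.i) (.var Reg.u) (.var Reg.v))))))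

/-- The memory also contains the distances of the graph. -/
structure HasDist (G : SimpleGraph (Fin n)) (k : ℕ) (σ : State) : Prop extends
    HasTables G k σ where
  dist_eq (u v : Fin n) : σ.arr Arr.dist (u * n + v) = G.dist u v

theorem HasDist.dependsOn : DependsOn (HasDist G k)
    [Reg.n, Reg.k, Reg.size] [Arr.adj, Arr.mul, Arr.pow, Arr.dist] := by
  intro σ τ hv ha h
  refine ⟨HasTables.dependsOn hv (fun a h => ha a (by simp_all; tauto)) h.toHasTables, ?_⟩
  rw [ha Arr.dist (by simp)]
  exact h.dist_eq

theorem HasDist.eval_dist (h : HasDist G k σ) {a b : Term} {u v : Fin n} (ha : a.eval σ = u)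
    (hb : b.eval σ = v) : (dist a b).eval σ = G.dist u v := by
  rw [← h.dist_eq, Term.eval, h.eval_cell (lt_tableSize (by omega)), ha, hb]

theorem spec_makeDist (hn : 1 ≤ n) (hG : G.Connected) (hσ : HasTables G k σ)
    (hF : FilledNear G (n * n * n) σ) : makeDist.Spec σ (n * (n * n)) (HasDist G k) := by
  have hframe τ (hτ : makeDist.Frame σ τ) : HasTables G k τ := HasTables.dependsOn.frame hτ rfl hσ
  have h : makeDist.Spec σ (n * (n * n)) (Cmd.Filled (Cmd.OnRows n fun u v val =>
      ∀ a b : Fin n, u = a → v = b → val = G.dist a b) Arr.dist (0 + n * n)) := by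
    refine .fill₂ (by decide) rfl rfl rfl hσ.var_n le_rfl le_rfl hn hn hn Cmd.Filled.zero
      (fun τ hτ => (hframe τ hτ).var_n) fun u hu v hv τ hτ hju hjv _ => ?_
    have hFτ : FilledNear G (n * n * n) τ := by rwa [FilledNear, Cmd.Filled, hτ.arr _ (by decide)]
    have hτ := hframe τ hτ
    refine ⟨?_, .of_sumsOver [Reg.n] rfl hn (by simp [hτ.var_n]) (by simp [Term.depth]), ?_⟩
    · rw [hτ.eval_cell (lt_tableSize (by rw [Term.eval, hju]; omega))]
      simp [Term.eval, hju, hjv]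
    rw [zero_add, Cmd.onRows_cell hv]
    rintro a b rfl rfl
    refine Term.eval_sum_not hτ.eval_n (dist_lt_of_fin hG a b).le fun i hi => ?_
    exact (HasTables.dependsOn.setVar (by decide) hτ).holds_near (r := .var Reg.i) hFτ hi hju hjv
      (Cmd.cell_lt (Cmd.cell_lt hi a.2) b.2)
  exact h.mono le_rfl fun τ hτ h => ⟨hframe τ hτ, fun u v =>
    h.cell v.2 (by simpa using Cmd.cell_lt u.2 v.2) u v rfl rfl⟩

abbrev prepare : Cmd := .seq makeTables (.seq makeNear makeDist)

theorem spec_prepare (hn : 1 ≤ n) (hG : G.Connected) (hσ : IsInput G k σ) :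
    prepare.Spec σ (7 * n ^ 4) (HasDist G k) := by
  have h₃ : n ^ 3 ≤ n ^ 4 := Nat.pow_le_pow_right hn (by norm_num)
  have h₄ := Nat.zero_le (n ^ 4)
  refine ((spec_makeTables hn hσ).mono_cost (by gcongr; omega)).seq fun τ _ hτ => ?_
  refine ((spec_makeNear hn hG hτ).mono_cost (by linarith)).seq fun ρ hρ hF => ?_
  exact (spec_makeDist hn hG (HasTables.dependsOn.frame hρ rfl hτ) hF).mono_cost
    (by linarith)

end MESP.Solver

namespace MESP.Solver

open RAM

variable {n k d : ℕ} {G : SimpleGraph (Fin n)} {σ τ : State}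

/-! ### Tables that depend on the size of the modulator -/

/-- The rows of the tables for numbers below `4 ^ d` or `2 ^ (2 * d + 1)`. -/
abbrev rowLength (d : ℕ) : ℕ := 2 ^ (2 * d + 1)

abbrev double (e : Term) : Term := .add e e

/-- The index of the entry in row `i` and column `j` of a matrix with `rowLength d` columns. -/
abbrev wideCell (i j : Term) : Term := .add (.get Arr.mulM i) j

/-- The quotient of `S` and `2 ^ e`. -/
abbrev quo (e S : Term) : Term := .get Arr.quo (wideCell e S)

/-- The binary digit of `S` that belongs to `2 ^ e`. -/
abbrev bit (S e : Term) : Term := .sub (quo e S) (double (quo (.add e (.lit 1)) S))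

/-- The digit of `g` in base `4` that belongs to `4 ^ e`; see `digit`. -/
abbrev digitTerm (g e : Term) : Term :=
  .sub (quo (double e) g) (double (double (quo (.add (double e) (.lit 2)) g)))

/-- The memory also contains the multiples of `rowLength d` and the quotients by powers of `2`. -/
structure IsScaled (G : SimpleGraph (Fin n)) (k d : ℕ) (σ : State) : Prop extends
    HasDist G k σ where
  var_d : σ.var Reg.d = d
  var_M : σ.var Reg.M = rowLength d
  mulM_eq : ∀ q < tableSize n, σ.arr Arr.mulM q = q * rowLength d
  quo_eq : ∀ e < 2 * n + 4, ∀ S < rowLength d, σ.arr Arr.quo (e * rowLength d + S) = S / 2 ^ e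

theorem IsScaled.dependsOn : DependsOn (IsScaled G k d)
    [Reg.n, Reg.k, Reg.size, Reg.d, Reg.M]
    [Arr.adj, Arr.mul, Arr.pow, Arr.dist, Arr.mulM, Arr.quo] := by
  intro σ τ hv ha h
  refine ⟨HasDist.dependsOn (fun x hx => hv x (by simp_all; tauto))
    (fun a h => ha a (by simp_all; tauto)) h.toHasDist, (hv _ (by simp)).trans h.var_d,
    (hv _ (by simp)).trans h.var_M, ?_, ?_⟩
  · exact ha Arr.mulM (by simp) ▸ h.mulM_eq
  · exact ha Arr.quo (by simp) ▸ h.quo_eq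

theorem IsScaled.eval_wideCell (h : IsScaled G k d σ) {i j : Term} (hi : i.eval σ < tableSize n) :
    (wideCell i j).eval σ = i.eval σ * rowLength d + j.eval σ := by
  rw [Term.eval_add, Term.eval, h.mulM_eq _ hi]

theorem IsScaled.eval_quo (h : IsScaled G k d σ) {e S : Term} (he : e.eval σ < 2 * n + 4)
    (hS : S.eval σ < rowLength d) : (quo e S).eval σ = S.eval σ / 2 ^ e.eval σ := by
  rw [Term.eval, h.eval_wideCell (lt_tableSize (by omega)), h.quo_eq _ he _ hS]

theorem IsScaled.holds_bit (h : IsScaled G k d σ) {e S : Term} (he : e.eval σ < 2 * n + 3)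
    (hS : S.eval σ < rowLength d) :
    (bit S e).Holds σ ↔ e.eval σ ∈ (S.eval σ).bitIndices := by
  have he' : (Term.add e (.lit 1)).eval σ = e.eval σ + 1 := rfl
  rw [Term.Holds, Term.eval_sub, Term.eval_add, h.eval_quo (by omega) hS,
    h.eval_quo (by omega) hS, he', Nat.mem_bitIndices, Nat.testBit_eq_decide_div_mod_eq, pow_succ,
    ← Nat.div_div_eq_div_mul, decide_eq_true_eq]
  omega

theorem IsScaled.eval_digitTerm (h : IsScaled G k d σ) {g e : Term} (he : e.eval σ ≤ n)
    (hg : g.eval σ < 4 ^ d) : (digitTerm g e).eval σ = digit (g.eval σ) (e.eval σ) := by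
  have hg : g.eval σ < rowLength d := hg.trans_le (by rw [rowLength, pow_succ, pow_mul]; norm_num)
  have hdouble (t : Term) : (double t).eval σ = 2 * t.eval σ := (two_mul _).symm
  have he' : (Term.add (double e) (.lit 2)).eval σ = 2 * e.eval σ + 2 := by
    rw [Term.eval_add, hdouble, Term.eval]
  rw [Term.eval_sub, hdouble, hdouble, h.eval_quo (by rw [hdouble]; omega) hg,
    h.eval_quo (by omega) hg, he', hdouble, digit, pow_add, ← Nat.div_div_eq_div_mul, pow_mul]
  norm_num only
  omega

abbrev makeMulM : Cmd :=
  .loop Reg.i (.var Reg.size) (.store Arr.mulM (.var Reg.i) (.ite (.var Reg.i)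
    (.add (.get Arr.mulM (.sub (.var Reg.i) (.lit 1))) (.var Reg.M)) (.lit 0)))

/-- Since row `e` is filled from left to right, `S / 2 ^ e` may use `(S - 2 ^ e) / 2 ^ e`. -/
abbrev makeQuo : Cmd :=
  .loop Reg.e (.add (double (.var Reg.n)) (.lit 4)) (.loop Reg.S (.var Reg.M)
    (.store Arr.quo (wideCell (.var Reg.e) (.var Reg.S))
      (.ite (.lt (.var Reg.S) (.get Arr.pow (.var Reg.e))) (.lit 0)
        (.add (quo (.var Reg.e) (.sub (.var Reg.S) (.get Arr.pow (.var Reg.e)))) (.lit 1)))))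

abbrev scale : Cmd :=
  .seq (.set Reg.M (double (.get Arr.pow (double (.var Reg.d))))) (.seq makeMulM makeQuo)

theorem spec_makeMulM (hn : 1 ≤ n) (hσ : HasDist G k σ) (hM : σ.var Reg.M = rowLength d) :
    makeMulM.Spec σ (7 * n ^ 2) (fun τ => ∀ q < tableSize n, τ.arr Arr.mulM q = q * rowLength d) :=
  .recurrence rfl rfl rfl hσ.var_size (tableSize_le hn) (by nlinarith) (by simp [Term.eval])
    fun j τ hτ hi hj => by
      have hM := (hτ.var Reg.M (by decide)).trans hM
      simp [Term.eval, BinOp.eval, hi, hj, hM, Nat.succ_mul]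

theorem spec_makeQuo (hn : 1 ≤ n) (hσ : HasDist G k σ) (hM : σ.var Reg.M = rowLength d)
    (hmulM : ∀ q < tableSize n, σ.arr Arr.mulM q = q * rowLength d) :
    makeQuo.Spec σ (6 * n * (rowLength d * 1)) (fun τ => ∀ e < 2 * n + 4, ∀ S < rowLength d,
      τ.arr Arr.quo (e * rowLength d + S) = S / 2 ^ e) := by
  have h : makeQuo.Spec σ (6 * n * (rowLength d * 1)) (Cmd.Filled (Cmd.OnRows (rowLength d)
      fun e S v => v = S / 2 ^ e) Arr.quo (0 + (2 * n + 4) * rowLength d)) := by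
    refine .fill₂ (by decide) rfl rfl rfl ?_ (by omega) le_rfl (by omega) Nat.one_le_two_pow
      le_rfl Cmd.Filled.zero (fun τ hτ => (hτ.var Reg.M (by decide)).trans hM)
      fun e he S hS τ hτ hje hjS hF => ?_
    · rw [Term.eval_add, Term.eval_add, Term.eval_var, hσ.var_n, Term.eval_lit]
      omega
    have hpow : (Term.get Arr.pow (.var Reg.e)).eval τ = 2 ^ e := by
      rw [Term.eval, Term.eval, hje]
      exact (HasDist.dependsOn.frame hτ rfl hσ).pow_eq e (lt_tableSize (by omega))
    have hcell (t : Term) : (wideCell (.var Reg.e) t).eval τ = e * rowLength d + t.eval τ := by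
      rw [Term.eval_add, Term.eval, Term.eval, hje, hτ.arr Arr.mulM (by decide),
        hmulM _ (lt_tableSize (by omega))]
    refine ⟨by rw [hcell, zero_add, Term.eval, hjS], .of_sumsOver_nil rfl le_rfl, ?_⟩
    rw [zero_add, Cmd.onRows_cell hS, Term.eval_ite, Term.holds_lt, hpow, Term.eval_var, hjS]
    split_ifs with hSe
    · exact (Nat.div_eq_of_lt hSe).symm
    have hlt : S - 2 ^ e < S := Nat.sub_lt_self (Nat.two_pow_pos e) (not_lt.1 hSe)
    rw [Term.eval_add, Term.eval_get, hcell, Term.eval_sub, hpow, Term.eval_var, hjS, Term.eval_lit,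
      hF.cell (by omega) (by omega), Nat.div_eq_sub_div (Nat.two_pow_pos e) (not_lt.1 hSe)]
  exact h.mono le_rfl fun τ _ h e he S hS => h.cell hS (by simpa using Cmd.cell_lt he hS)

theorem spec_scale (hn : 1 ≤ n) (hd : d ≤ n) (hσ : HasDist G k σ) (hσd : σ.var Reg.d = d) :
    scale.Spec σ (12 * 4 ^ d * n ^ 2) (IsScaled G k d) := by
  have h4 : 1 ≤ 4 ^ d := Nat.one_le_pow _ _ (by norm_num)
  have hn2 : n ≤ n ^ 2 := Nat.le_self_pow two_ne_zero n
  have hrow : rowLength d = 2 * 4 ^ d := by rw [rowLength, pow_succ, pow_mul, mul_comm]; rfl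
  have hA : 1 ≤ 12 * 4 ^ d * n ^ 2 := by nlinarith [Nat.mul_le_mul h4 hn2]
  refine (Cmd.Spec.set (Q := fun τ => τ.var Reg.M = rowLength d) (.of_sumsOver_nil rfl hA) ?_).seq
    fun τ hτ hτM => ?_
  · rw [State.var_setVar_self, Term.eval_add, Term.eval, Term.eval_add, Term.eval_var, hσd,
      hσ.pow_eq _ (lt_tableSize (by omega)), rowLength, pow_succ, mul_two, two_mul]
  have hτd := HasDist.dependsOn.frame hτ rfl hσ
  refine ((spec_makeMulM hn hτd hτM).mono_cost (by nlinarith)).seq fun ρ hρ hmulM => ?_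
  have hρM := (hρ.var Reg.M (by decide)).trans hτM
  have hρd := HasDist.dependsOn.frame hρ rfl hτd
  refine (spec_makeQuo hn hρd hρM hmulM).mono ?_ fun υ hυ hquo =>
    ⟨HasDist.dependsOn.frame hυ rfl hρd, ?_,
      (hυ.var Reg.M (by decide)).trans hρM, hυ.arr Arr.mulM (by decide) ▸ hmulM, hquo⟩
  · rw [hrow]
    nlinarith
  · exact ((hυ.var Reg.d (by decide)).trans (hρ.var Reg.d (by decide))).trans
      ((hτ.var Reg.d (by decide)).trans hσd)

end MESP.Solver

namespace MESP.Solver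

open RAM

variable {n k d : ℕ} {G : SimpleGraph (Fin n)} {σ τ : State} {l : List (Fin n)}

/-! ### The search for a smallest modulator -/

/-- The memory represents the list `l` by its length, its characteristic function and the positions
of its entries. -/
structure Represents (l : List (Fin n)) (σ : State) : Prop where
  nodup : l.Nodup
  var_len : σ.var Reg.len = l.length
  inX_iff (v : Fin n) : σ.arr Arr.inX v ≠ 0 ↔ v ∈ l
  rank_eq (v : Fin n) (hv : v ∈ l) : σ.arr Arr.rank v = l.idxOf v

theorem Represents.dependsOn : DependsOn (Represents l) [Reg.len] [Arr.inX, Arr.rank] := by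
  intro σ τ hv ha h
  simp only [List.forall_mem_cons] at hv ha
  exact ⟨h.nodup, hv.1.trans h.var_len, ha.1 ▸ h.inX_iff, ha.2.1 ▸ h.rank_eq⟩

theorem Represents.holds_inX (h : Represents l σ) {t : Term} {v : Fin n} (ht : t.eval σ = v) :
    (Term.get Arr.inX t).Holds σ ↔ v ∈ l := by
  rw [← h.inX_iff, Term.Holds, Term.eval_get, ht]

theorem Represents.length_le (h : Represents l σ) : l.length ≤ n := by
  simpa using h.nodup.length_le_card

theorem Represents.append (h : Represents l σ) {v : Fin n} (hv : v ∉ l) :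
    Represents (l ++ [v])
      (((σ.setArr Arr.inX v 1).setArr Arr.rank v l.length).setVar Reg.len (l.length + 1)) where
  nodup := List.nodup_append.2 ⟨h.nodup, by simp,
    by simpa using fun a ha => ne_of_mem_of_not_mem ha hv⟩
  var_len := by simp
  inX_iff w := by
    obtain rfl | hwv := eq_or_ne w v
    · simp [State.setArr, State.setVar]
    · simpa [State.setArr, State.setVar, Fin.val_inj, hwv] using h.inX_iff w
  rank_eq w hw := by
    obtain rfl | hwv := eq_or_ne w v
    · simp [State.setArr, State.setVar, List.idxOf_append_of_notMem hv]
    · have hw : w ∈ l := by simpa [hwv] using hw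
      simpa [State.setArr, State.setVar, Fin.val_inj, hwv, List.idxOf_append_of_mem hw]
        using h.rank_eq w hw

abbrev clear : Cmd :=
  .seq (.loop Reg.v (.var Reg.n) (.store Arr.inX (.var Reg.v) (.lit 0))) (.set Reg.len (.lit 0))

theorem spec_clear (hn : 1 ≤ n) (hσ : IsInput G k σ) :
    clear.Spec σ n (Represents ([] : List (Fin n))) := by
  have h : (Cmd.loop Reg.v (.var Reg.n) (.store Arr.inX (.var Reg.v) (.lit 0))).Spec σ (n * 1)
      (Cmd.Filled (fun _ v => v = 0) Arr.inX (0 + n)) :=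
    .fill rfl rfl hσ.var_n le_rfl hn le_rfl Cmd.Filled.zero fun j _ τ _ hv _ =>
      ⟨by rw [zero_add]; exact hv, .of_sumsOver_nil rfl le_rfl, rfl⟩
  refine (h.mono_cost (by omega)).seq fun τ _ hF => .set (.of_sumsOver_nil rfl hn) ?_
  exact ⟨List.nodup_nil, rfl, fun v => by simpa using hF v (by omega), by simp⟩

abbrev append : Cmd :=
  .seq (.store Arr.inX (.var Reg.picked) (.lit 1))
    (.seq (.store Arr.rank (.var Reg.picked) (.var Reg.len))
      (.set Reg.len (.add (.var Reg.len) (.lit 1))))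

theorem spec_append {x : Fin n} (hl : Represents l σ) (hx : x ∉ l) (hσ : σ.var Reg.picked = x) :
    append.Spec σ 1 (Represents (l ++ [x])) := by
  refine (Cmd.Spec.store (Q := (· = σ.setArr Arr.inX x 1)) (.of_sumsOver_nil rfl le_rfl)
    (.of_sumsOver_nil rfl le_rfl) (by rw [Term.eval_var, hσ, Term.eval_lit])).seq ?_
  rintro _ - rfl
  refine (Cmd.Spec.store (Q := (· = (σ.setArr Arr.inX x 1).setArr Arr.rank x l.length))
    (.of_sumsOver_nil rfl le_rfl) (.of_sumsOver_nil rfl le_rfl) ?_).seq ?_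
  · rw [Term.eval_var, Term.eval_var, State.var_setArr, hσ, hl.var_len]
  rintro _ - rfl
  refine .set (.of_sumsOver_nil rfl le_rfl) ?_
  rw [Term.eval_add, Term.eval_var, Term.eval_lit, State.var_setArr, State.var_setArr, hl.var_len]
  exact hl.append hx

abbrev isFree (a b c : Term) : Term :=
  .and (.not (.get Arr.inX a)) (.and (.not (.get Arr.inX b)) (.and (.not (.get Arr.inX c))
    (.and (.not (.eq a c)) (.and (adj a b) (.and (adj b c) (.not (adj a c)))))))

theorem holds_isFree (hσ : HasTables G k σ) (hl : Represents l σ) {a b c : Term} {u v w : Fin n}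
    (ha : a.eval σ = u) (hb : b.eval σ = v) (hc : c.eval σ = w) :
    (isFree a b c).Holds σ ↔ IsFreeP3 G l (u, v, w) := by
  simp only [Term.holds_and, Term.holds_not, Term.holds_eq, hl.holds_inX ha, hl.holds_inX hb,
    hl.holds_inX hc, hσ.holds_adj ha hb, hσ.holds_adj hb hc, hσ.holds_adj ha hc, ha, hc,
    Fin.val_inj]
  rfl

/-- The step `pick` of the greedy construction, with the digits of `g` in base `4`. -/
abbrev pickCmd : Cmd :=
  .when (isFree (.var Reg.u) (.var Reg.v) (.var Reg.w))
    (.seq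
      (.set Reg.picked (.ite (digitTerm (.var Reg.g) (.var Reg.len))
        (.ite (.eq (digitTerm (.var Reg.g) (.var Reg.len)) (.lit 1)) (.var Reg.v) (.var Reg.w))
        (.var Reg.u)))
      append)

theorem spec_pickCmd {g : ℕ} {u v w : Fin n} (hσ : IsScaled G k d σ) (hg : g < 4 ^ d)
    (hσg : σ.var Reg.g = g) (hl : Represents l σ) (hu : σ.var Reg.u = u) (hv : σ.var Reg.v = v)
    (hw : σ.var Reg.w = w) : pickCmd.Spec σ 1 (Represents (pick G (digit g) l (u, v, w))) := by
  have hfree := holds_isFree hσ.toHasTables hl (a := .var Reg.u) (b := .var Reg.v)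
    (c := .var Reg.w) hu hv hw
  refine .when (.of_sumsOver_nil rfl le_rfl) (fun h => ?_) fun h => ?_
  · have h := hfree.1 h
    have hlen : (Term.var Reg.len).eval σ = l.length := hl.var_len
    have hgσ : (Term.var Reg.g).eval σ = g := hσg
    have hdigit : (digitTerm (.var Reg.g) (.var Reg.len)).eval σ = digit g l.length := by
      rw [hσ.eval_digitTerm (hlen.trans_le hl.length_le) (hgσ.trans_lt hg), hgσ, hlen]
    rw [pick, if_pos h]
    refine (Cmd.Spec.set (Q := fun τ => τ.var Reg.picked = entry (digit g l.length) (u, v, w))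
      (.of_sumsOver_nil rfl le_rfl) ?_).seq fun τ hτ => spec_append
        (Represents.dependsOn.frame hτ rfl hl) (h.entry_notMem _)
    rw [State.var_setVar_self, Term.eval_ite, Term.eval_ite, Term.holds_eq, Term.Holds, hdigit,
      Term.eval_lit, Term.eval_var, Term.eval_var, Term.eval_var, hu, hv, hw, entry]
    split_ifs <;> simp_all
  · rwa [pick, if_neg (fun h' => h (hfree.2 h'))]

/-- The list of all triples of vertices, in the order in which the program considers them. -/
def triples (n : ℕ) : List (Fin n × Fin n × Fin n) :=
  List.finRange n ×ˢ List.finRange n ×ˢ List.finRange n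

theorem mem_triples (t : Fin n × Fin n × Fin n) : t ∈ triples n :=
  List.mem_product.2 ⟨List.mem_finRange _, List.mem_product.2
    ⟨List.mem_finRange _, List.mem_finRange _⟩⟩

theorem foldl_triples {α : Type*} (f : α → Fin n × Fin n × Fin n → α) (s : α) :
    (triples n).foldl f s = (List.finRange n).foldl (fun s a => (List.finRange n).foldl
      (fun s b => (List.finRange n).foldl (fun s c => f s (a, b, c)) s) s) s := by
  simp [triples, List.product, SProd.sprod, List.foldl_flatMap, List.foldl_map]

/-- The modulator that the program builds when the digits of `g` guide its choices. -/
noncomputable def greedy (G : SimpleGraph (Fin n)) (g : ℕ) : List (Fin n) :=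
  (triples n).foldl (pick G (digit g)) []

abbrev makeGreedy : Cmd :=
  .seq clear (.loop Reg.u (.var Reg.n) (.loop Reg.v (.var Reg.n)
    (.loop Reg.w (.var Reg.n) pickCmd)))

theorem spec_makeGreedy (hn : 1 ≤ n) {g : ℕ} (hσ : IsScaled G k d σ) (hg : g < 4 ^ d)
    (hσg : σ.var Reg.g = g) :
    makeGreedy.Spec σ (n * (n * (n * 1))) (Represents (greedy G g)) := by
  have hnn : 1 ≤ n * (n * 1) := Nat.mul_pos hn (Nat.mul_pos hn one_pos)
  refine ((spec_clear hn hσ.toIsInput).mono_cost (Nat.le_mul_of_pos_right n hnn)).seq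
    fun τ hτ hl => ?_
  have hτn : τ.var Reg.n = n := (hτ.var Reg.n (by decide)).trans hσ.var_n
  rw [greedy, foldl_triples]
  refine .loop_foldl rfl hτn hn hnn hl (fun _ _ _ => Represents.dependsOn.setVar (by decide))
    fun l u ρ hρ hu hl => ?_
  have hρn : ρ.var Reg.n = n := (hρ.var Reg.n (by decide)).trans hτn
  refine .loop_foldl rfl hρn hn (Nat.mul_pos hn one_pos) hl
    (fun _ _ _ => Represents.dependsOn.setVar (by decide)) fun l v υ hυ hv hl => ?_
  have hυn : υ.var Reg.n = n := (hυ.var Reg.n (by decide)).trans hρn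
  refine .loop_foldl rfl hυn hn le_rfl hl
    (fun _ _ _ => Represents.dependsOn.setVar (by decide)) fun l w ω hω hw hl => ?_
  have hτω := hρ.loop (hυ.loop hω)
  refine spec_pickCmd (IsScaled.dependsOn.frame hτω rfl (IsScaled.dependsOn.frame hτ rfl hσ)) hg
    (((hτω.var Reg.g (by decide)).trans (hτ.var Reg.g (by decide))).trans hσg) hl ?_
    ((hω.var Reg.v (by decide)).trans hv) hw
  exact ((hω.var Reg.u (by decide)).trans (hυ.var Reg.u (by decide))).trans hu

/-- Once a modulator is found, the variable `found` prevents further attempts from overwriting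
it. -/
abbrev tryGuess : Cmd :=
  .when (.not (.var Reg.found))
    (.seq makeGreedy (.set Reg.found (.le (.var Reg.len) (.var Reg.d))))

abbrev tryGuesses : Cmd := .loop Reg.g (.get Arr.pow (double (.var Reg.d))) tryGuess

/-- The memory after the first `j` guesses for modulators of size at most `d`. -/
def Tried (G : SimpleGraph (Fin n)) (d j : ℕ) (σ : State) : Prop :=
  (σ.var Reg.found = 0 ∧ ∀ g < j, d < (greedy G g).length) ∨
    (σ.var Reg.found ≠ 0 ∧ ∃ g, Represents (greedy G g) σ ∧ (greedy G g).length ≤ d)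

theorem Tried.dependsOn {j : ℕ} : DependsOn (Tried G d j) [Reg.found, Reg.len]
    [Arr.inX, Arr.rank] := by
  intro σ τ hv ha h
  have hfound : τ.var Reg.found = σ.var Reg.found := hv _ (by simp)
  rw [Tried, hfound]
  exact h.imp_right fun ⟨hne, g, hg, hlen⟩ =>
    ⟨hne, g, Represents.dependsOn (fun x hx => hv x (List.mem_cons_of_mem _ hx)) ha hg, hlen⟩

theorem spec_tryGuess (hn : 1 ≤ n) {g : ℕ} (hσ : IsScaled G k d σ) (hg : g < 4 ^ d)
    (hσg : σ.var Reg.g = g) (hI : Tried G d g σ) :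
    tryGuess.Spec σ (n * (n * (n * 1))) (Tried G d (g + 1)) := by
  have hA : 1 ≤ n * (n * (n * 1)) := Nat.mul_pos hn (Nat.mul_pos hn (Nat.mul_pos hn one_pos))
  refine .when (.of_sumsOver_nil rfl hA) (fun h => ?_) fun h => ?_
  · have hfound : σ.var Reg.found = 0 := by simpa [Term.holds_not, Term.holds_var] using h
    have hI := (hI.resolve_right fun h => h.1 hfound).2
    refine (spec_makeGreedy hn hσ hg hσg).seq fun τ hτ hl => .set (.of_sumsOver_nil rfl hA) ?_
    have hle : (Term.le (.var Reg.len) (.var Reg.d)).Holds τ ↔ (greedy G g).length ≤ d := by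
      rw [Term.holds_le, Term.eval_var, Term.eval_var, hl.var_len,
        (IsScaled.dependsOn.frame hτ rfl hσ).var_d]
    rw [Term.Holds] at hle
    by_cases hlen : (greedy G g).length ≤ d
    · exact .inr ⟨hle.2 hlen, g, Represents.dependsOn.setVar (by decide) hl, hlen⟩
    · refine .inl ⟨by simpa using hle.not.2 hlen, fun g' hg' => ?_⟩
      obtain hlt | rfl := Nat.lt_succ_iff_lt_or_eq.1 hg'
      exacts [hI g' hlt, not_le.1 hlen]
  · exact .inr (hI.resolve_left fun h' => h (by simpa [Term.holds_not, Term.holds_var] using h'.1))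

theorem spec_tryGuesses (hn : 1 ≤ n) (hd : d ≤ n) (hσ : IsScaled G k d σ)
    (hfound : σ.var Reg.found = 0) :
    tryGuesses.Spec σ (4 ^ d * (n * (n * (n * 1)))) (Tried G d (4 ^ d)) := by
  have hN : (Term.get Arr.pow (double (.var Reg.d))).eval σ = 4 ^ d := by
    rw [Term.eval, Term.eval_add, Term.eval_var, hσ.var_d, hσ.pow_eq _ (lt_tableSize (by omega)),
      ← two_mul, pow_mul]
    rfl
  have hA : 1 ≤ n * (n * (n * 1)) := Nat.mul_pos hn (Nat.mul_pos hn (Nat.mul_pos hn one_pos))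
  refine hN ▸ Cmd.Spec.loop (fun j => Tried G d j) rfl le_rfl ?_ hA (.inl ⟨hfound, by simp⟩)
    (fun _ _ _ => Tried.dependsOn.setVar (by decide)) fun g hg τ hτ hτg hI => ?_
  · exact hN ▸ Nat.one_le_pow _ _ (by norm_num)
  · exact spec_tryGuess hn (IsScaled.dependsOn.frame hτ rfl hσ) (hN ▸ hg) hτg hI

/-- The memory contains the tables and a smallest modulator, represented by `l`. -/
structure IsReady (G : SimpleGraph (Fin n)) (k : ℕ) (l : List (Fin n)) (σ : State) : Prop extends
    IsScaled G k l.length σ, Represents l σ where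
  hitsP3 : HitsP3 G l.toFinset

theorem IsReady.dependsOn : DependsOn (IsReady G k l)
    [Reg.n, Reg.k, Reg.size, Reg.d, Reg.M, Reg.len]
    [Arr.adj, Arr.mul, Arr.pow, Arr.dist, Arr.mulM, Arr.quo, Arr.inX, Arr.rank] := by
  intro σ τ hv ha h
  exact ⟨IsScaled.dependsOn (fun x hx => hv x (by simp_all; tauto))
    (fun a h => ha a (by simp_all; tauto)) h.toIsScaled, Represents.dependsOn
    (fun x hx => hv x (by simp_all)) (fun a h => ha a (by simp_all)) h.toRepresents,
    h.hitsP3⟩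

theorem Tried.found_eq_zero (h : Tried G d (4 ^ d) σ) (hd : d < distToCluster G) :
    σ.var Reg.found = 0 := by
  obtain h | ⟨-, g, -, hlen⟩ := h
  · exact h.1
  · exact absurd (distToCluster_le_length_foldl_pick mem_triples) (hlen.trans_lt hd).not_ge

theorem Tried.exists_isReady (h : Tried G (distToCluster G) (4 ^ distToCluster G) σ)
    (hσ : IsScaled G k (distToCluster G) σ) : σ.var Reg.found ≠ 0 ∧
      ∃ l : List (Fin n), l.length = distToCluster G ∧ IsReady G k l σ := by
  obtain ⟨-, hlt⟩ | ⟨hne, g, hrep, hlen⟩ := h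
  · obtain ⟨g, hg, hle⟩ := exists_length_foldl_pick_le G (triples n)
    exact absurd hle (hlt g hg).not_ge
  · have hlen := hlen.antisymm (distToCluster_le_length_foldl_pick mem_triples)
    exact ⟨hne, _, hlen, hlen ▸ hσ, hrep, hitsP3_foldl_pick mem_triples⟩

abbrev searchRound : Cmd :=
  .when (.not (.var Reg.found)) (.seq (.set Reg.d (.var Reg.round)) (.seq scale tryGuesses))

abbrev search : Cmd :=
  .seq (.set Reg.found (.lit 0)) (.loop Reg.round (.add (.var Reg.n) (.lit 1)) searchRound)

/-- The memory after the modulators of sizes less than `i` have been searched for. -/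
def Searched (G : SimpleGraph (Fin n)) (k i : ℕ) (σ : State) : Prop :=
  (σ.var Reg.found = 0 ∧ i ≤ distToCluster G) ∨ (σ.var Reg.found ≠ 0 ∧
    ∃ l : List (Fin n), l.length = distToCluster G ∧ IsReady G k l σ)

theorem Searched.setVar {i x v : ℕ} (h : Searched G k i σ) (hfound : Reg.found ≠ x)
    (hx : x ∉ [Reg.n, Reg.k, Reg.size, Reg.d, Reg.M, Reg.len]) : Searched G k i (σ.setVar x v) := by
  rw [Searched, State.var_setVar_of_ne hfound]
  exact h.imp_right fun ⟨hne, l, hl, hready⟩ => ⟨hne, l, hl, IsReady.dependsOn.setVar hx hready⟩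

theorem distToCluster_le (G : SimpleGraph (Fin n)) : distToCluster G ≤ n := by
  refine (distToCluster_le_length_foldl_pick (f := digit 0) mem_triples).trans ?_
  simpa using (nodup_foldl_pick (G := G) (f := digit 0)).length_le_card

theorem spec_searchRound (hn : 1 ≤ n) {i : ℕ} (hσ : HasDist G k σ) (hi : σ.var Reg.round = i)
    (hI : Searched G k i σ) : searchRound.Spec σ (12 * 4 ^ distToCluster G * n ^ 3)
      (Searched G k (i + 1)) := by
  have hA : 1 ≤ 12 * 4 ^ distToCluster G * n ^ 3 := Nat.one_le_iff_ne_zero.2 (by positivity)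
  refine .when (.of_sumsOver_nil rfl hA) (fun h => ?_) fun h => ?_
  · have hfound : σ.var Reg.found = 0 := by simpa [Term.holds_not, Term.holds_var] using h
    have hip := (hI.resolve_right fun h => h.1 hfound).2
    have hin := hip.trans (distToCluster_le G)
    have hpow : 4 ^ i ≤ 4 ^ distToCluster G := Nat.pow_le_pow_right (by norm_num) hip
    refine (Cmd.Spec.set (Q := fun τ => τ.var Reg.d = i) (.of_sumsOver_nil rfl hA)
      (by exact hi)).seq fun τ hτ hd => ?_
    have hτd := HasDist.dependsOn.frame hτ rfl hσ
    refine ((spec_scale hn hin hτd hd).mono_cost ?_).seq fun ρ hρ hscaled => ?_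
    · gcongr
      omega
    have hρfound : ρ.var Reg.found = 0 :=
      ((hρ.var Reg.found (by decide)).trans (hτ.var Reg.found (by decide))).trans hfound
    refine (spec_tryGuesses hn hin hscaled hρfound).mono ?_ fun υ hυ htried => ?_
    · calc _ = 4 ^ i * n ^ 3 := by ring
        _ ≤ _ := by gcongr; omega
    obtain hlt | rfl := hip.lt_or_eq
    · exact .inl ⟨htried.found_eq_zero hlt, hlt⟩
    · exact .inr (htried.exists_isReady (IsScaled.dependsOn.frame hυ rfl hscaled))
  · exact .inr (hI.resolve_left fun h' => h (by simpa [Term.holds_not, Term.holds_var] using h'.1))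

theorem spec_search (hn : 1 ≤ n) (hσ : HasDist G k σ) :
    search.Spec σ (24 * 4 ^ distToCluster G * n ^ 4)
      (fun τ => ∃ l : List (Fin n), l.length = distToCluster G ∧ IsReady G k l τ) := by
  have hA : 1 ≤ 12 * 4 ^ distToCluster G * n ^ 3 := Nat.one_le_iff_ne_zero.2 (by positivity)
  have hA' : 1 ≤ 24 * 4 ^ distToCluster G * n ^ 4 := Nat.one_le_iff_ne_zero.2 (by positivity)
  refine (Cmd.Spec.set (Q := fun τ => τ.var Reg.found = 0) (.of_sumsOver_nil rfl hA')
    rfl).seq fun τ hτ hfound => ?_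
  have hτd := HasDist.dependsOn.frame hτ rfl hσ
  have hN : (Term.add (.var Reg.n) (.lit 1)).eval τ = n + 1 := by
    rw [Term.eval_add, hτd.eval_n, Term.eval_lit]
  have hloop := Cmd.Spec.loop (K := 2 * n) (x := Reg.round) (p := searchRound)
    (N := .add (.var Reg.n) (.lit 1)) (A := 12 * 4 ^ distToCluster G * n ^ 3)
    (fun i => Searched G k i) rfl (by omega) (by omega) hA
    (.inl ⟨hfound, Nat.zero_le _⟩) (fun _ _ _ h => h.setVar (by decide) (by decide))
    fun i _ ρ hρ hi hI => spec_searchRound hn (HasDist.dependsOn.frame hρ rfl hτd) hi hI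
  refine hloop.mono (le_of_eq (by ring)) fun υ _ h => ?_
  exact (h.resolve_left fun h => by have := h.2.trans (distToCluster_le G); omega).2

end MESP.Solver

namespace MESP.Solver

open RAM

variable {n k g : ℕ} {G : SimpleGraph (Fin n)} {σ τ : State} {l D : List (Fin n)}
  {δ : Fin n → ℕ} {s : Fin n}

/-! ### The search for a certificate -/

/-- The digit of the guess `g` that belongs to the vertex `v` of the modulator. -/
abbrev digitOf (v : Term) : Term := digitTerm (.var Reg.g) (.get Arr.rank v)

/-- The condition that the guess `g` puts `z` on the path; only these vertices and the endpoint `s`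
enter the estimate of the other distances. -/
abbrev isAnchor (z : Term) : Term :=
  .or (.eq z (.var Reg.s)) (.and (.get Arr.inX z) (.not (digitOf z)))

/-- The distances described by `guess`: the distance of `v` to the anchors is the number of radii
`i` within which there is no anchor. -/
abbrev makeDelta : Cmd :=
  .loop Reg.v (.var Reg.n) (.store Arr.delta (.var Reg.v)
    (.sub (.sum Reg.i (.var Reg.n) (.not (.sum Reg.z (.var Reg.n)
      (.and (isAnchor (.var Reg.z)) (.le (dist (.var Reg.v) (.var Reg.z)) (.var Reg.i))))))
      (.sub (digitOf (.var Reg.v)) (.lit 1))))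

theorem IsReady.eval_digitOf (h : IsReady G k l σ) (hg : g < 4 ^ l.length)
    (hσg : σ.var Reg.g = g) {t : Term} {y : Fin n} (ht : t.eval σ = y) (hy : y ∈ l) :
    (digitOf t).eval σ = digit g (l.idxOf y) := by
  have hrank : (Term.get Arr.rank t).eval σ = l.idxOf y := by
    rw [Term.eval_get, ht, h.rank_eq y hy]
  have hgσ : (Term.var Reg.g).eval σ = g := hσg
  rw [h.eval_digitTerm (hrank.trans_le (List.idxOf_le_length.trans h.length_le))
    (hgσ.trans_lt hg), hrank, hgσ]

theorem IsReady.holds_isAnchor (h : IsReady G k l σ) (hg : g < 4 ^ l.length)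
    (hσg : σ.var Reg.g = g) (hσs : σ.var Reg.s = s) {t : Term} {z : Fin n} (ht : t.eval σ = z) :
    (isAnchor t).Holds σ ↔ z ∈ insert s {z | z ∈ l.toFinset ∧ digit g (l.idxOf z) = 0} := by
  rw [Term.holds_or, Term.holds_eq, ht, Term.eval_var, hσs, Fin.val_inj, Term.holds_and,
    h.holds_inX ht, Set.mem_insert_iff, Set.mem_ofPred_eq, List.mem_toFinset]
  refine or_congr_right (and_congr_right fun hz => ?_)
  rw [Term.holds_not, Term.Holds, h.eval_digitOf hg hσg ht hz, not_not]

/-- The memory also contains the distances that `δ` promises for the modulator. -/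
structure HasDelta (G : SimpleGraph (Fin n)) (k : ℕ) (l : List (Fin n)) (δ : Fin n → ℕ)
    (σ : State) : Prop extends IsReady G k l σ where
  delta_eq : ∀ y ∈ l, σ.arr Arr.delta y = δ y

theorem HasDelta.dependsOn : DependsOn (HasDelta G k l δ)
    [Reg.n, Reg.k, Reg.size, Reg.d, Reg.M, Reg.len]
    [Arr.adj, Arr.mul, Arr.pow, Arr.dist, Arr.mulM, Arr.quo, Arr.inX, Arr.rank, Arr.delta] := by
  intro σ τ hv ha h
  refine ⟨IsReady.dependsOn hv (fun a h => ha a (by simp_all; tauto)) h.toIsReady, ?_⟩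
  exact ha Arr.delta (by simp) ▸ h.delta_eq

theorem spec_makeDelta (hG : G.Connected) (hσ : IsReady G k l σ) (hg : g < 4 ^ l.length)
    (hσg : σ.var Reg.g = g) (hσs : σ.var Reg.s = s) : makeDelta.Spec σ (n * n ^ 2)
      (HasDelta G k l (guess G l.toFinset s fun y => digit g (l.idxOf y))) := by
  set δ := guess G l.toFinset s fun y => digit g (l.idxOf y) with hδ
  have hn : 1 ≤ n := s.pos
  have h : makeDelta.Spec σ (n * n ^ 2) (Cmd.Filled (fun v val =>
      ∀ y : Fin n, v = y → y ∈ l → val = δ y) Arr.delta (0 + n)) := by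
    refine .fill rfl rfl hσ.var_n le_rfl hn (Nat.one_le_pow _ _ hn) Cmd.Filled.zero
      fun v _ τ hτ hv _ => ?_
    have hτg := (hτ.var Reg.g (by decide)).trans hσg
    have hτs := (hτ.var Reg.s (by decide)).trans hσs
    have hτ := IsReady.dependsOn.frame hτ rfl hσ
    refine ⟨by rw [zero_add]; exact hv,
      .of_sumsOver [Reg.n] rfl hn (by simp [hτ.var_n]) (by simp [Term.depth]), ?_⟩
    rw [zero_add]
    rintro y rfl hy
    have hdigit := hτ.eval_digitOf (t := .var Reg.v) hg hτg hv hy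
    rw [Term.eval_sub, Term.eval_sub, hdigit, Term.eval_lit, hδ, guess]
    congr 1
    refine Term.eval_sum_not hτ.eval_n ((minDist_le (Set.mem_insert _ _)).trans
      (dist_lt_of_fin hG y s).le) fun i _ => ?_
    have hi := IsReady.dependsOn.setVar (x := Reg.i) (v := i) (by decide) hτ
    rw [minDist_le_iff ⟨s, Set.mem_insert _ _⟩, Term.holds_sum_fin hi.eval_n]
    refine exists_congr fun z => ?_
    have hz := IsReady.dependsOn.setVar (x := Reg.z) (v := z) (by decide) hi
    rw [Term.holds_and, hz.holds_isAnchor hg hτg hτs rfl, Term.holds_le,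
      hz.eval_dist (a := .var Reg.v) (b := .var Reg.z) hv rfl]
    rfl
  exact h.mono le_rfl fun τ hτ h => ⟨IsReady.dependsOn.frame hτ rfl hσ, fun y hy =>
    h y (by omega) y rfl hy⟩

abbrev makeUncovered : Cmd :=
  .loop Reg.v (.var Reg.n) (.store Arr.uncovered (.var Reg.v)
    (.and (.not (.get Arr.inX (.var Reg.v))) (.not (.sum Reg.y (.var Reg.n)
      (.and (.get Arr.inX (.var Reg.y)) (.le (.add (dist (.var Reg.v) (.var Reg.y))
        (.get Arr.delta (.var Reg.y))) (.var Reg.k)))))))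

theorem HasDelta.eval_delta (h : HasDelta G k l δ σ) {t : Term} {y : Fin n} (ht : t.eval σ = y)
    (hy : y ∈ l) : (Term.get Arr.delta t).eval σ = δ y := by
  rw [Term.eval_get, ht, h.delta_eq y hy]

/-- `uncovered` records which vertices are not covered by the promised distances. -/
abbrev HasUncovered (G : SimpleGraph (Fin n)) (k : ℕ) (l : List (Fin n)) (δ : Fin n → ℕ)
    (σ : State) : Prop :=
  ∀ v : Fin n, σ.arr Arr.uncovered v ≠ 0 ↔ IsUncovered G l.toFinset δ k v

theorem spec_makeUncovered (hn : 1 ≤ n) (hσ : HasDelta G k l δ σ) :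
    makeUncovered.Spec σ (n * n) (HasUncovered G k l δ) := by
  have h : makeUncovered.Spec σ (n * n) (Cmd.Filled (fun v val =>
      ∀ u : Fin n, v = u → (val ≠ 0 ↔ IsUncovered G l.toFinset δ k u)) Arr.uncovered (0 + n)) := by
    refine .fill rfl rfl hσ.var_n le_rfl hn hn Cmd.Filled.zero fun v _ τ hτ hv _ => ?_
    have hτ := HasDelta.dependsOn.frame hτ rfl hσ
    refine ⟨by rw [zero_add]; exact hv,
      .of_sumsOver [Reg.n] rfl hn (by simp [hτ.var_n]) (by simp [Term.depth]), ?_⟩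
    rw [zero_add]
    rintro u rfl
    change Term.Holds _ τ ↔ _
    rw [Term.holds_and, Term.holds_not, hτ.holds_inX (t := .var Reg.v) hv, Term.holds_not,
      Term.holds_sum_fin hτ.eval_n, not_exists, IsUncovered, List.mem_toFinset]
    refine and_congr_right fun _ => forall_congr' fun y => ?_
    have hy := HasDelta.dependsOn.setVar (x := Reg.y) (v := y) (by decide) hτ
    rw [Term.holds_and, hy.holds_inX (t := .var Reg.y) rfl, List.mem_toFinset, not_and]
    refine imp_congr_right fun hyl => ?_
    rw [Term.holds_le, Term.eval_add, hy.eval_dist (a := .var Reg.v) (b := .var Reg.y) hv rfl,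
      hy.eval_delta (t := .var Reg.y) rfl hyl, Term.eval_var, hy.var_k, not_le]
  exact h.mono le_rfl fun τ _ h u => h u (by omega) u rfl

end MESP.Solver

namespace MESP.Solver

open RAM

variable {n k : ℕ} {G : SimpleGraph (Fin n)} {σ τ : State} {l D : List (Fin n)} {δ : Fin n → ℕ}
  {s : Fin n}

/-! ### The targets -/

/-- The memory represents the list `D`. -/
structure ListsTargets (D : List (Fin n)) (σ : State) : Prop where
  nodup_targets : D.Nodup
  var_m : σ.var Reg.m = D.length
  target_eq (e : ℕ) (he : e < D.length) : σ.arr Arr.target e = D[e]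

theorem ListsTargets.dependsOn : DependsOn (ListsTargets D) [Reg.m] [Arr.target] := by
  intro σ τ hv ha h
  simp only [List.forall_mem_cons] at hv ha
  exact ⟨h.nodup_targets, hv.1.trans h.var_m, ha.1 ▸ h.target_eq⟩

theorem ListsTargets.length_targets_le (h : ListsTargets D σ) : D.length ≤ n := by
  simpa using h.nodup_targets.length_le_card

theorem ListsTargets.append (h : ListsTargets D σ) {v : Fin n} (hv : v ∉ D) :
    ListsTargets (D ++ [v]) ((σ.setArr Arr.target D.length v).setVar Reg.m (D.length + 1)) where
  nodup_targets := List.nodup_append.2 ⟨h.nodup_targets, by simp,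
    by simpa using fun a ha => ne_of_mem_of_not_mem ha hv⟩
  var_m := by simp
  target_eq e he := by
    obtain hlt | rfl := Nat.lt_succ_iff_lt_or_eq.1 (by simpa using he)
    · simpa [State.setArr, State.setVar, hlt.ne, List.getElem_append_left hlt]
        using h.target_eq e hlt
    · simp [State.setArr, State.setVar]

abbrev addTarget : Cmd :=
  .seq (.store Arr.target (.var Reg.m) (.var Reg.v)) (.set Reg.m (.add (.var Reg.m) (.lit 1)))

theorem spec_addTarget {A : ℕ} (hA : 1 ≤ A) {v : Fin n} (hD : ListsTargets D σ) (hv : v ∉ D)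
    (hσ : σ.var Reg.v = v) : addTarget.Spec σ A (ListsTargets (D ++ [v])) := by
  refine (Cmd.Spec.store (Q := (· = σ.setArr Arr.target D.length v)) (.of_sumsOver_nil rfl hA)
    (.of_sumsOver_nil rfl hA) (by rw [Term.eval_var, Term.eval_var, hσ, hD.var_m])).seq ?_
  rintro _ - rfl
  refine .set (.of_sumsOver_nil rfl hA) ?_
  rw [Term.eval_add, Term.eval_var, Term.eval_lit, State.var_setArr, hD.var_m]
  exact hD.append hv

abbrev isTarget : Term :=
  .or (.get Arr.inX (.var Reg.v)) (.and (.get Arr.uncovered (.var Reg.v))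
    (.not (.sum Reg.w (.var Reg.n) (.and (.lt (.var Reg.w) (.var Reg.v))
      (.and (.get Arr.uncovered (.var Reg.w)) (adj (.var Reg.w) (.var Reg.v)))))))

abbrev makeTargets : Cmd :=
  .seq (.set Reg.m (.lit 0)) (.loop Reg.v (.var Reg.n) (.when isTarget addTarget))

theorem HasUncovered.dependsOn : DependsOn (HasUncovered G k l δ) [] [Arr.uncovered] := by
  intro σ τ _ ha h
  rw [HasUncovered, ha Arr.uncovered (by simp)]
  exact h

theorem holds_isTarget (hσ : IsReady G k l σ) (huncovered : HasUncovered G k l δ σ) {v : Fin n}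
    (hv : σ.var Reg.v = v) : isTarget.Holds σ ↔ IsTarget G l.toFinset δ k v := by
  have huv : (Term.get Arr.uncovered (.var Reg.v)).Holds σ ↔ IsUncovered G l.toFinset δ k v := by
    rw [← huncovered v, ← hv]
    rfl
  rw [Term.holds_or, hσ.holds_inX (t := .var Reg.v) hv, Term.holds_and, huv, Term.holds_not,
    Term.holds_sum_fin hσ.eval_n, not_exists, IsTarget, List.mem_toFinset, IsLeader]
  refine or_congr_right (and_congr_right fun _ => forall_congr' fun w => ?_)
  have hw := IsReady.dependsOn.setVar (x := Reg.w) (v := w) (by decide) hσ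
  have huw : (Term.get Arr.uncovered (.var Reg.w)).Holds (σ.setVar Reg.w w) ↔
      IsUncovered G l.toFinset δ k w := huncovered w
  have hlt : (Term.lt (.var Reg.w) (.var Reg.v)).Holds (σ.setVar Reg.w w) ↔ w < v := by
    rw [Term.holds_lt, Fin.lt_def, ← hv]
    rfl
  rw [Term.holds_and, hlt, Term.holds_and, huw,
    hw.holds_adj (a := .var Reg.w) (b := .var Reg.v) rfl hv, not_and, not_and]

/-- The memory also contains a list `D` of all targets. -/
structure HasTargets (G : SimpleGraph (Fin n)) (k : ℕ) (l : List (Fin n)) (δ : Fin n → ℕ)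
    (D : List (Fin n)) (σ : State) : Prop extends HasDelta G k l δ σ, ListsTargets D σ where
  mem_iff (y : Fin n) : y ∈ D ↔ IsTarget G l.toFinset δ k y

theorem HasTargets.dependsOn : DependsOn (HasTargets G k l δ D)
    [Reg.n, Reg.k, Reg.size, Reg.d, Reg.M, Reg.len, Reg.m]
    [Arr.adj, Arr.mul, Arr.pow, Arr.dist, Arr.mulM, Arr.quo, Arr.inX, Arr.rank, Arr.delta,
      Arr.target] := by
  intro σ τ hv ha h
  exact ⟨HasDelta.dependsOn (fun x hx => hv x (by simp_all; tauto))
    (fun a h => ha a (by simp_all; tauto)) h.toHasDelta, ListsTargets.dependsOn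
    (fun x hx => hv x (by simp_all)) (fun a h => ha a (by simp_all)) h.toListsTargets, h.mem_iff⟩

/-- The memory after the first `j` vertices have been inspected. -/
def Inspected (G : SimpleGraph (Fin n)) (k : ℕ) (l : List (Fin n)) (δ : Fin n → ℕ) (j : ℕ)
    (σ : State) : Prop :=
  ∃ D, ListsTargets D σ ∧ ∀ y : Fin n, y ∈ D ↔ (y : ℕ) < j ∧ IsTarget G l.toFinset δ k y

theorem spec_inspect {v : Fin n} (hσ : IsReady G k l σ) (huncovered : HasUncovered G k l δ σ)
    (hv : σ.var Reg.v = v) (hI : Inspected G k l δ v σ) :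
    (Cmd.when isTarget addTarget).Spec σ n (Inspected G k l δ (v + 1)) := by
  obtain ⟨D, hD, hmem⟩ := hI
  have hvD : v ∉ D := fun h => lt_irrefl _ ((hmem v).1 h).1
  have hlt (y : Fin n) : (y : ℕ) < v + 1 ↔ (y : ℕ) < v ∨ y = v := by
    rw [Nat.lt_succ_iff_lt_or_eq, Fin.val_inj]
  have htarget := holds_isTarget hσ huncovered hv
  refine .when (.of_sumsOver [Reg.n] rfl v.pos (by simp [hσ.var_n]) (by simp [Term.depth]))
    (fun h => (spec_addTarget v.pos hD hvD hv).mono le_rfl fun τ _ hD => ⟨_, hD, fun y => ?_⟩)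
    fun h => ⟨D, hD, fun y => ?_⟩
  · rw [List.mem_append, List.mem_singleton, hmem, hlt, or_and_right]
    exact or_congr_right ⟨fun hy => ⟨hy, hy ▸ htarget.1 h⟩, And.left⟩
  · rw [hmem, hlt, or_and_right, or_iff_left]
    rintro ⟨rfl, hy⟩
    exact h (htarget.2 hy)

theorem spec_makeTargets (hn : 1 ≤ n) (hσ : HasDelta G k l δ σ)
    (huncovered : HasUncovered G k l δ σ) :
    makeTargets.Spec σ (n * n) (fun τ => ∃ D, HasTargets G k l δ D τ) := by
  have hnn : 1 ≤ n * n := Nat.mul_pos hn hn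
  have hnil : Inspected G k l δ 0 (σ.setVar Reg.m 0) :=
    ⟨[], ⟨List.nodup_nil, rfl, by simp⟩, by simp⟩
  refine (Cmd.Spec.set (.of_sumsOver_nil rfl hnn) hnil).seq fun τ hτ hI => ?_
  have hτσ := HasDelta.dependsOn.frame hτ rfl hσ
  have hloop := Cmd.Spec.loop (x := Reg.v) (A := n) (fun j => Inspected G k l δ j)
    (N := .var Reg.n) (p := .when isTarget addTarget) rfl hτσ.var_n.le hn hn hI
    (fun _ _ _ ⟨D, hD, hmem⟩ => ⟨D, ListsTargets.dependsOn.setVar (by decide) hD, hmem⟩)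
    fun j hj ρ hρ hv hI => spec_inspect (v := ⟨j, hj.trans_eq hτσ.var_n⟩)
      (HasDelta.dependsOn.frame hρ rfl hτσ).toIsReady (HasUncovered.dependsOn.frame hρ rfl
        (HasUncovered.dependsOn.frame hτ rfl huncovered)) hv hI
  refine hloop.mono le_rfl fun ρ hρ ⟨D, hD, hmem⟩ =>
    ⟨D, HasDelta.dependsOn.frame hρ rfl hτσ, hD, fun y => ?_⟩
  rw [hmem, and_iff_right]
  exact y.isLt.trans_eq hτσ.var_n.symm

/-- A condition that every guess with a certificate satisfies. It bounds the number of targets, and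
thereby the number of columns of the table `visits`. -/
abbrev isPlausible : Term :=
  .and (.le (.var Reg.m) (.add (double (.var Reg.d)) (.lit 1)))
    (.not (.sum Reg.y (.var Reg.n) (.and (.get Arr.inX (.var Reg.y))
      (.lt (.var Reg.k) (.get Arr.delta (.var Reg.y))))))

theorem holds_isPlausible (hσ : HasTargets G k l δ D σ) :
    isPlausible.Holds σ ↔ D.length ≤ 2 * l.length + 1 ∧ ∀ y ∈ l.toFinset, δ y ≤ k := by
  have hbound : (Term.add (double (.var Reg.d)) (.lit 1)).eval σ = 2 * l.length + 1 := by
    rw [Term.eval_add, Term.eval_add, Term.eval_var, hσ.var_d, ← two_mul, Term.eval_lit]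
  rw [Term.holds_and, Term.holds_le, hbound, Term.eval_var, hσ.var_m, Term.holds_not,
    Term.holds_sum_fin hσ.eval_n, not_exists]
  refine and_congr_right fun _ => forall_congr' fun y => ?_
  have hy := HasTargets.dependsOn.setVar (x := Reg.y) (v := y) (by decide) hσ
  rw [Term.holds_and, hy.holds_inX (t := .var Reg.y) rfl, List.mem_toFinset, not_and]
  refine imp_congr_right fun hyl => ?_
  rw [Term.holds_lt, hy.eval_delta (t := .var Reg.y) rfl hyl, Term.eval_var, hy.var_k, not_lt]

end MESP.Solver

namespace MESP.Solver

open RAM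

variable {n k : ℕ} {G : SimpleGraph (Fin n)} {σ τ : State} {l D : List (Fin n)} {δ : Fin n → ℕ}
  {s : Fin n}

/-! ### Shortest paths that meet all targets -/

/-- The vertex `v` meets the entry of `D` with the index `e`. -/
def MeetsEntry (G : SimpleGraph (Fin n)) (l : List (Fin n)) (δ : Fin n → ℕ) (D : List (Fin n))
    (e : ℕ) (v : Fin n) : Prop :=
  ∃ h : e < D.length, Meets G l.toFinset δ D[e] v

abbrev targetEntry : Term := .get Arr.target (.var Reg.e)

abbrev meetsEntry : Term :=
  .ite (.get Arr.inX targetEntry) (.le (dist targetEntry (.var Reg.v)) (.get Arr.delta targetEntry))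
    (.and (.not (.get Arr.inX (.var Reg.v))) (.or (.eq targetEntry (.var Reg.v))
      (adj targetEntry (.var Reg.v))))

theorem holds_meetsEntry (hσ : HasTargets G k l δ D σ) {e : ℕ} (he : e < D.length)
    (hσe : σ.var Reg.e = e) {v : Fin n} (hv : σ.var Reg.v = v) :
    meetsEntry.Holds σ ↔ MeetsEntry G l δ D e v := by
  have hentry : targetEntry.eval σ = D[e] := by
    rw [Term.eval_get, Term.eval_var, hσe, hσ.target_eq e he]
  have hvσ : (Term.var Reg.v).eval σ = v := hv
  rw [MeetsEntry, exists_prop_of_true he, Meets, Term.Holds, Term.eval_ite, hσ.holds_inX hentry]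
  simp only [List.mem_toFinset]
  split_ifs with hl
  · change Term.Holds _ σ ↔ _
    rw [Term.holds_le, hσ.eval_dist hentry hvσ, hσ.eval_delta hentry hl]
  · change Term.Holds _ σ ↔ _
    rw [Term.holds_and, Term.holds_not, hσ.holds_inX hvσ, Term.holds_or, Term.holds_eq, hentry,
      hvσ, Fin.val_inj, hσ.holds_adj hentry hvσ]
    exact ⟨fun h => ⟨by simpa using hl, by simpa using h.1, h.2⟩,
      fun h => ⟨by simpa using h.right, h.eq_or_adj⟩⟩

/-- The set `rest` of the targets in `S` that the vertex in variable `v` does not meet. -/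
abbrev restTerm : Term :=
  .sum Reg.e (.var Reg.m) (.ite (.and (bit (.var Reg.S) (.var Reg.e)) (.not meetsEntry))
    (.get Arr.pow (.var Reg.e)) (.lit 0))

theorem eval_restTerm (hσ : HasTargets G k l δ D σ) (hD : D.length ≤ 2 * l.length + 1) {S : ℕ}
    (hS : S < 2 ^ D.length) (hσS : σ.var Reg.S = S) {v : Fin n} (hv : σ.var Reg.v = v) :
    restTerm.eval σ = rest (MeetsEntry G l δ D) v S := by
  rw [rest_eq_sum_range hS, Term.eval, Term.eval_var, hσ.var_m]
  refine Finset.sum_congr rfl fun e he => ?_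
  rw [Finset.mem_range] at he
  have hen := he.trans_le hσ.length_targets_le
  have hτ := HasTargets.dependsOn.setVar (x := Reg.e) (v := e) (by decide) hσ
  have hSM : S < rowLength l.length := hS.trans_le (Nat.pow_le_pow_right two_pos hD)
  have hτS : (Term.var Reg.S).eval (σ.setVar Reg.e e) = S := hσS
  have hτe : (Term.var Reg.e).eval (σ.setVar Reg.e e) = e := State.var_setVar_self
  rw [Term.eval_ite, Term.holds_and, hτ.holds_bit (by rw [hτe]; omega) (hτS.trans_lt hSM),
    Term.holds_not, holds_meetsEntry hτ he hτe hv, hτe, hτS, Term.eval_get, hτe,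
    hτ.pow_eq e (lt_tableSize (by omega)), Term.eval_lit]
  congr

/-- The entry of the table `visits` for walks of length `i` from `v` and the set `S` of targets. -/
abbrev visit (i v S : Term) : Term := .get Arr.visits (wideCell (cell i v) S)

/-- The table is filled by increasing length of the walks, according to the recursion for
`Collects`. -/
abbrev makeVisits : Cmd :=
  .loop Reg.i (.var Reg.n) (.loop Reg.v (.var Reg.n) (.loop Reg.S (.var Reg.M)
    (.store Arr.visits (wideCell (cell (.var Reg.i) (.var Reg.v)) (.var Reg.S))
      (.ite (.var Reg.i)
        (.sum Reg.w (.var Reg.n) (.and (adj (.var Reg.v) (.var Reg.w))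
          (visit (.sub (.var Reg.i) (.lit 1)) (.var Reg.w) restTerm)))
        (.and (.eq (.var Reg.v) (.var Reg.s)) (.not restTerm))))))

theorem eval_visit (hσ : HasTargets G k l δ D σ) {i v S : Term} (hi : i.eval σ < n)
    (hv : v.eval σ < n) : (visit i v S).eval σ =
      σ.arr Arr.visits ((i.eval σ * n + v.eval σ) * rowLength l.length + S.eval σ) := by
  have hcell := hσ.eval_cell (i := i) (j := v) (lt_tableSize (by omega))
  rw [Term.eval_get, hσ.eval_wideCell (hcell.trans_lt (cell_lt_tableSize hi hv)), hcell]

/-- What the cell of `visits` for walks of length `i`, the vertex `v` and the set `S` of targets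
has to contain. -/
def IsVisits (G : SimpleGraph (Fin n)) (l : List (Fin n)) (δ : Fin n → ℕ) (D : List (Fin n))
    (s : Fin n) (i v S val : ℕ) : Prop :=
  S < 2 ^ D.length → ∀ u : Fin n, v = u → (val ≠ 0 ↔ Collects G (MeetsEntry G l δ D) s i u S)

/-- The table `visits` is filled below the cell `b`. -/
abbrev FilledVisits (G : SimpleGraph (Fin n)) (l : List (Fin n)) (δ : Fin n → ℕ)
    (D : List (Fin n)) (s : Fin n) (b : ℕ) : State → Prop :=
  Cmd.Filled (Cmd.OnRows (rowLength l.length) fun c S => Cmd.OnRows n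
    (fun i v => IsVisits G l δ D s i v S) c) Arr.visits b

theorem isVisits_succ (hσ : HasTargets G k l δ D σ) (hD : D.length ≤ 2 * l.length + 1)
    {i v S : ℕ} (hi : i + 1 < n) (hσi : σ.var Reg.i = i + 1) (hσv : σ.var Reg.v = v)
    (hσS : σ.var Reg.S = S)
    (hF : FilledVisits G l δ D s (((i + 1) * n + v) * rowLength l.length + S) σ) :
    IsVisits G l δ D s (i + 1) v S ((Term.sum Reg.w (.var Reg.n)
      (.and (adj (.var Reg.v) (.var Reg.w))
        (visit (.sub (.var Reg.i) (.lit 1)) (.var Reg.w) restTerm))).eval σ) := by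
  rintro hS u rfl
  change Term.Holds _ σ ↔ _
  rw [Term.holds_sum_fin hσ.eval_n, collects_succ]
  refine exists_congr fun w => ?_
  have hτ := HasTargets.dependsOn.setVar (x := Reg.w) (v := w) (by decide) hσ
  have hτi : (Term.sub (.var Reg.i) (.lit 1)).eval (σ.setVar Reg.w w) = i :=
    Nat.sub_eq_of_eq_add hσi
  have hτw : (Term.var Reg.w).eval (σ.setVar Reg.w w) = w := State.var_setVar_self
  have hτu : (Term.var Reg.v).eval (σ.setVar Reg.w w) = u := hσv
  have hrest := eval_restTerm hτ hD hS hσS hσv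
  have hrestS : rest (MeetsEntry G l δ D) u S ≤ S := rest_le
  have hSM : S < rowLength l.length := hS.trans_le (Nat.pow_le_pow_right two_pos hD)
  rw [Term.holds_and, hτ.holds_adj hτu hτw, Term.Holds,
    eval_visit hτ (by omega) (by omega), hτi, hτw, hrest]
  refine and_congr_right fun _ => hF.cell₃ w.isLt (hrestS.trans_lt hSM) ?_
    (hrestS.trans_lt hS) w rfl
  have hrow : i * n + w < (i + 1) * n + u := by rw [Nat.succ_mul]; omega
  exact (Cmd.cell_lt hrow (hrestS.trans_lt hSM)).trans_le (Nat.le_add_right _ _)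

theorem isVisits_zero (hσ : HasTargets G k l δ D σ) (hD : D.length ≤ 2 * l.length + 1)
    (hσs : σ.var Reg.s = s) {v S : ℕ} (hσv : σ.var Reg.v = v) (hσS : σ.var Reg.S = S) :
    IsVisits G l δ D s 0 v S
      ((Term.and (.eq (.var Reg.v) (.var Reg.s)) (.not restTerm)).eval σ) := by
  rintro hS u rfl
  change Term.Holds _ σ ↔ _
  rw [Term.holds_and, Term.holds_eq, Term.eval_var, Term.eval_var, hσv, hσs, Fin.val_inj,
    Term.holds_not, Term.Holds, eval_restTerm hσ hD hS hσS hσv, not_not, collects_zero]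

theorem spec_makeVisits (hσ : HasTargets G k l δ D σ) (hD : D.length ≤ 2 * l.length + 1)
    (hσs : σ.var Reg.s = s) : makeVisits.Spec σ (n * (n * (rowLength l.length * n ^ 2)))
      (FilledVisits G l δ D s (n * n * rowLength l.length)) := by
  have hn := s.pos
  have hframe τ (hτ : makeVisits.Frame σ τ) : HasTargets G k l δ D τ :=
    HasTargets.dependsOn.frame hτ rfl hσ
  refine .fill₃ (by decide) (by decide) (by decide) rfl rfl rfl rfl hσ.var_n le_rfl le_rfl le_rfl
    hn hn Nat.one_le_two_pow (Nat.one_le_pow _ _ hn) (fun τ hτ => (hframe τ hτ).var_n)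
    (fun τ hτ => (hframe τ hτ).var_M) fun i hi v hv S hS τ hF hτi hτv hτS hvisits => ?_
  have hτ := hframe τ hF
  refine ⟨?_, .of_sumsOver [Reg.n, Reg.m] rfl hn ?_ (by simp [Term.depth]), ?_⟩
  · have hcell : (cell (.var Reg.i) (.var Reg.v)).eval τ = i * n + v := by
      have hi' : (Term.var Reg.i).eval τ = i := hτi
      rw [hτ.eval_cell (lt_tableSize (by omega)), hi', Term.eval_var, hτv]
    rw [hτ.eval_wideCell (hcell.trans_lt (cell_lt_tableSize hi hv)), hcell, Term.eval_var, hτS]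
  · simp [hτ.var_n, hτ.var_m, hτ.length_targets_le]
  · rw [Cmd.onRows_cell hS, Cmd.onRows_cell hv, Term.eval_ite, Term.holds_var, hτi]
    obtain _ | i := i
    · rw [if_neg (not_not.2 rfl)]
      exact isVisits_zero hτ hD ((hF.var Reg.s (by decide)).trans hσs) hτv hτS
    · rw [if_pos i.succ_ne_zero]
      exact isVisits_succ hτ hD hi hτi hτv hτS hvisits

/-- Walks from `v` to `s` are shortest paths if their length is the distance of `v` and `s`. -/
abbrev updateAns : Cmd :=
  .set Reg.ans (.add (.var Reg.ans) (.sum Reg.v (.var Reg.n)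
    (visit (dist (.var Reg.v) (.var Reg.s)) (.var Reg.v)
      (.sub (.get Arr.pow (.var Reg.m)) (.lit 1)))))

theorem exists_isCertificate_iff (hσ : HasTargets G k l δ D σ) (hδ : ∀ y ∈ l.toFinset, δ y ≤ k) :
    (∃ v, ∃ q : G.Walk v s, IsCertificate G l.toFinset δ k q) ↔
      ∃ v, Collects G (MeetsEntry G l δ D) s (G.dist v s) v (2 ^ D.length - 1) := by
  simp only [collects_two_pow_sub_one]
  refine exists_congr fun v => exists_congr fun q => ⟨fun h => ⟨h.length_eq, fun e he => ?_⟩,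
    fun ⟨hq, h⟩ => ⟨hq, hδ, fun y hy => ?_⟩⟩
  · obtain ⟨w, hw, hmeets⟩ := h.meets D[e] ((hσ.mem_iff _).1 (List.getElem_mem he))
    exact ⟨w, hw, he, hmeets⟩
  · obtain ⟨e, he, rfl⟩ := List.mem_iff_getElem.1 ((hσ.mem_iff y).2 hy)
    obtain ⟨w, hw, _, hmeets⟩ := h e he
    exact ⟨w, hw, hmeets⟩

theorem spec_updateAns (hG : G.Connected) (hσ : HasTargets G k l δ D σ)
    (hD : D.length ≤ 2 * l.length + 1) (hδ : ∀ y ∈ l.toFinset, δ y ≤ k) (hσs : σ.var Reg.s = s)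
    (hvisits : FilledVisits G l δ D s (n * n * rowLength l.length) σ) :
    updateAns.Spec σ n (fun τ => τ.var Reg.ans ≠ 0 ↔ σ.var Reg.ans ≠ 0 ∨
      ∃ v, ∃ q : G.Walk v s, IsCertificate G l.toFinset δ k q) := by
  refine .set (.of_sumsOver [Reg.n] rfl s.pos (by simp [hσ.var_n]) (by simp [Term.depth])) ?_
  rw [State.var_setVar_self]
  change Term.Holds _ σ ↔ _
  rw [Term.holds_or, Term.holds_var, exists_isCertificate_iff hσ hδ, Term.holds_sum_fin hσ.eval_n]
  refine or_congr_right (exists_congr fun v => ?_)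
  have hτ := HasTargets.dependsOn.setVar (x := Reg.v) (v := v) (by decide) hσ
  have hτv : (Term.var Reg.v).eval (σ.setVar Reg.v v) = v := State.var_setVar_self
  have hτs : (Term.var Reg.s).eval (σ.setVar Reg.v v) = s := hσs
  have hdist := hτ.eval_dist hτv hτs
  have hfull : (Term.sub (.get Arr.pow (.var Reg.m)) (.lit 1)).eval (σ.setVar Reg.v v) =
      2 ^ D.length - 1 := by
    rw [Term.eval_sub, Term.eval_get, Term.eval_var, hτ.var_m,
      hτ.pow_eq _ (lt_tableSize (hσ.length_targets_le.trans (by omega))), Term.eval_lit]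
  have hlt : 2 ^ D.length - 1 < 2 ^ D.length := Nat.sub_lt (by positivity) one_pos
  have hSM : 2 ^ D.length - 1 < rowLength l.length :=
    hlt.trans_le (Nat.pow_le_pow_right two_pos hD)
  have hdn : G.dist v s < n := dist_lt_of_fin hG v s
  rw [Term.Holds, eval_visit hτ (hdist.trans_lt hdn) (hτv.trans_lt v.isLt), hdist, hτv, hfull]
  exact hvisits.cell₃ v.isLt hSM (Cmd.cell_lt (Cmd.cell_lt hdn v.isLt) hSM) hlt v rfl

end MESP.Solver

namespace MESP.Solver

open RAM

variable {n k g : ℕ} {G : SimpleGraph (Fin n)} {σ τ : State} {l D : List (Fin n)}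
  {δ : Fin n → ℕ} {s : Fin n}

/-! ### The program -/

theorem HasTargets.length_le_of_isCertificate (hσ : HasTargets G k l δ D σ) {v : Fin n}
    {q : G.Walk v s} (h : IsCertificate G l.toFinset δ k q) : D.length ≤ 2 * l.length + 1 := by
  rw [← List.toFinset_card_of_nodup hσ.nodup_targets, ← List.toFinset_card_of_nodup hσ.nodup]
  exact h.card_le hσ.hitsP3 fun y hy => (hσ.mem_iff y).1 (List.mem_toFinset.1 hy)

/-- Sets `ans` if some certificate for the guess `g` ends in `s`. -/
abbrev tryEnd : Cmd :=
  .seq makeDelta (.seq makeUncovered (.seq makeTargets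
    (.when isPlausible (.seq makeVisits updateAns))))

/-- Some certificate ends in `s`, for the promised distances that the digits of `g` describe. -/
def HasCertificate (G : SimpleGraph (Fin n)) (k : ℕ) (l : List (Fin n)) (g : ℕ) (s : Fin n) :
    Prop :=
  ∃ v, ∃ q : G.Walk v s, IsCertificate G l.toFinset
    (guess G l.toFinset s fun y => digit g (l.idxOf y)) k q

theorem spec_visitTargets (hG : G.Connected) (hσ : HasTargets G k l δ D σ)
    (hσs : σ.var Reg.s = s) :
    (Cmd.when isPlausible (.seq makeVisits updateAns)).Spec σ (2 * 4 ^ l.length * n ^ 4)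
      (fun τ => τ.var Reg.ans ≠ 0 ↔ σ.var Reg.ans ≠ 0 ∨
        ∃ v, ∃ q : G.Walk v s, IsCertificate G l.toFinset δ k q) := by
  have hn := s.pos
  have hA : n ≤ 2 * 4 ^ l.length * n ^ 4 :=
    (Nat.le_self_pow four_ne_zero n).trans (Nat.le_mul_of_pos_left _ (by positivity))
  refine .when (.of_sumsOver [Reg.n] rfl hn (by simp [hσ.var_n]) (by simpa [Term.depth] using hA))
    (fun h => ?_) fun h => ?_
  · obtain ⟨hD, hδ⟩ := (holds_isPlausible hσ).1 h
    refine ((spec_makeVisits hσ hD hσs).mono_cost ?_).seq fun τ hτ hvisits => ?_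
    · rw [rowLength, pow_succ, pow_mul]
      exact le_of_eq (by ring)
    rw [← hτ.var Reg.ans (by decide)]
    exact (spec_updateAns hG (HasTargets.dependsOn.frame hτ rfl hσ) hD hδ
      ((hτ.var Reg.s (by decide)).trans hσs) hvisits).mono_cost hA
  · rw [or_iff_left]
    rintro ⟨v, q, hq⟩
    exact h ((holds_isPlausible hσ).2 ⟨hσ.length_le_of_isCertificate hq, hq.le⟩)

theorem spec_tryEnd (hG : G.Connected) (hσ : IsReady G k l σ) (hg : g < 4 ^ l.length)
    (hσg : σ.var Reg.g = g) (hσs : σ.var Reg.s = s) :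
    tryEnd.Spec σ (2 * 4 ^ l.length * n ^ 4)
      (fun τ => τ.var Reg.ans ≠ 0 ↔ σ.var Reg.ans ≠ 0 ∨ HasCertificate G k l g s) := by
  have hn := s.pos
  have hA {e : ℕ} (he : e ≤ 4) : n ^ e ≤ 2 * 4 ^ l.length * n ^ 4 :=
    (Nat.pow_le_pow_right hn he).trans (Nat.le_mul_of_pos_left _ (by positivity))
  refine ((spec_makeDelta hG hσ hg hσg hσs).mono_cost ?_).seq fun τ hτ hdelta => ?_
  · exact (le_of_eq (by ring)).trans (hA (e := 3) (by norm_num))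
  refine ((spec_makeUncovered hn hdelta).mono_cost ?_).seq fun ρ hρ huncovered => ?_
  · exact (le_of_eq (by ring)).trans (hA (e := 2) (by norm_num))
  have hρdelta := HasDelta.dependsOn.frame hρ rfl hdelta
  refine ((spec_makeTargets hn hρdelta huncovered).mono_cost ?_).seq
    fun υ hυ ⟨D, htargets⟩ => ?_
  · exact (le_of_eq (by ring)).trans (hA (e := 2) (by norm_num))
  have hυ₀ : υ.var Reg.ans = σ.var Reg.ans := ((hυ.var Reg.ans (by decide)).trans
    (hρ.var Reg.ans (by decide))).trans (hτ.var Reg.ans (by decide))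
  have hυs : υ.var Reg.s = s := (((hυ.var Reg.s (by decide)).trans
    (hρ.var Reg.s (by decide))).trans (hτ.var Reg.s (by decide))).trans hσs
  rw [← hυ₀]
  exact spec_visitTargets hG htargets hυs

abbrev tryEnds : Cmd :=
  .loop Reg.g (.get Arr.pow (double (.var Reg.d))) (.loop Reg.s (.var Reg.n) tryEnd)

theorem spec_tryEnds (hn : 1 ≤ n) (hG : G.Connected) (hσ : IsReady G k l σ) :
    tryEnds.Spec σ (4 ^ l.length * (n * (2 * 4 ^ l.length * n ^ 4)))
      (fun τ => τ.var Reg.ans ≠ 0 ↔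
        σ.var Reg.ans ≠ 0 ∨ ∃ g < 4 ^ l.length, ∃ s, HasCertificate G k l g s) := by
  have hN : (Term.get Arr.pow (double (.var Reg.d))).eval σ = 4 ^ l.length := by
    have := hσ.length_le
    rw [Term.eval_get, Term.eval_add, Term.eval_var, hσ.var_d,
      hσ.pow_eq _ (lt_tableSize (by omega)), ← two_mul, pow_mul]
    rfl
  have hA : 1 ≤ 2 * 4 ^ l.length * n ^ 4 := Nat.one_le_iff_ne_zero.2 (by positivity)
  refine .loop_exists (by decide) rfl hN le_rfl (Nat.one_le_pow _ _ four_pos) (Nat.mul_pos hn hA)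
    fun g hg τ hτ hτg => ?_
  have hτσ := IsReady.dependsOn.frame hτ rfl hσ
  have hends := Cmd.Spec.loop_exists (x := Reg.s) (y := Reg.ans) (N := .var Reg.n) (p := tryEnd)
    (P := fun i => ∃ s : Fin n, i = s ∧ HasCertificate G k l g s) (by decide) rfl hτσ.var_n le_rfl
    hn hA fun i hi ρ hρ hρs => by
      refine (spec_tryEnd (s := ⟨i, hi⟩) hG (IsReady.dependsOn.frame hρ rfl hτσ) hg
        ((hρ.var Reg.g (by decide)).trans hτg) hρs).mono le_rfl fun υ _ h => h.trans ?_
      refine or_congr_right ⟨fun h => ⟨_, rfl, h⟩, fun ⟨s, hs, hcert⟩ => ?_⟩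
      rwa [show (⟨i, hi⟩ : Fin n) = s from Fin.ext hs]
  refine hends.mono le_rfl fun υ _ h => h.trans (or_congr_right ?_)
  exact ⟨fun ⟨_, _, s, _, h⟩ => ⟨s, h⟩, fun ⟨s, h⟩ => ⟨s, s.isLt, s, rfl, h⟩⟩

theorem isYesInstance_iff_exists_hasCertificate (hG : G.Connected) (hl : HitsP3 G l.toFinset)
    (hk : 1 ≤ k) : IsYesInstance G k ↔ ∃ g < 4 ^ l.length, ∃ s, HasCertificate G k l g s := by
  refine ⟨fun h => ?_, fun ⟨_, _, _, _, _, h⟩ => h.isYesInstance hG hl hk⟩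
  obtain ⟨g, hg, v, s, q, h⟩ := h.exists_isCertificate hG hl
  exact ⟨g, hg, s, v, q, h⟩

/-- For `k = 0` the path has to contain all vertices, that is, to have length `n - 1`. -/
abbrev hasShortestSpanningPath : Term :=
  .sum Reg.v (.var Reg.n) (.sum Reg.w (.var Reg.n)
    (.eq (.add (dist (.var Reg.v) (.var Reg.w)) (.lit 1)) (.var Reg.n)))

theorem holds_hasShortestSpanningPath (hG : G.Connected) (hσ : HasDist G k σ) :
    hasShortestSpanningPath.Holds σ ↔ IsYesInstance G 0 := by
  rw [isYesInstance_zero_iff hG, Term.holds_sum_fin hσ.eval_n, Fintype.card_fin]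
  refine exists_congr fun v => ?_
  have hv := HasDist.dependsOn.setVar (x := Reg.v) (v := v) (by decide) hσ
  rw [Term.holds_sum_fin hv.eval_n]
  refine exists_congr fun w => ?_
  have hw := HasDist.dependsOn.setVar (x := Reg.w) (v := w) (by decide) hv
  rw [Term.holds_eq, Term.eval_add, hw.eval_dist (a := .var Reg.v) (b := .var Reg.w) rfl rfl,
    Term.eval_lit, hw.eval_n]

abbrev report : Cmd :=
  .set 0 (.lt (.lit 0) (.ite (.var Reg.k) (.var Reg.ans) hasShortestSpanningPath))

open Classical in
theorem spec_report (hG : G.Connected) (hn : 1 ≤ n) (hσ : HasDist G k σ)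
    (hans : 1 ≤ k → (σ.var Reg.ans ≠ 0 ↔ IsYesInstance G k)) :
    report.Spec σ (n ^ 2) (fun τ => τ.var 0 = if IsYesInstance G k then 1 else 0) := by
  have hanswer : (Term.ite (.var Reg.k) (.var Reg.ans) hasShortestSpanningPath).Holds σ ↔
      IsYesInstance G k := by
    rw [Term.Holds, Term.eval_ite, Term.holds_var, hσ.var_k]
    obtain rfl | hk := Nat.eq_zero_or_pos k
    · rw [if_neg (not_not.2 rfl)]
      exact holds_hasShortestSpanningPath hG hσ
    · rw [if_pos hk.ne']
      exact hans hk
  refine .set (.of_sumsOver [Reg.n] rfl hn (by simp [hσ.var_n]) (by simp [Term.depth])) ?_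
  rw [State.var_setVar_self, ← hanswer, Term.Holds, ← Nat.pos_iff_ne_zero]
  simp only [Term.eval, BinOp.eval]
  congr

abbrev solve : Cmd :=
  .seq prepare (.seq search (.seq (.set Reg.ans (.lit 0)) (.seq tryEnds report)))

open Classical in
theorem spec_solve (hG : G.Connected) (hp : 1 ≤ distToCluster G) (hσ : IsInput G k σ) :
    solve.Spec σ (24 * (2 ^ (4 * distToCluster G) * distToCluster G * n ^ 6))
      (fun τ => τ.var 0 = if IsYesInstance G k then 1 else 0) := by
  have hn : 1 ≤ n := hp.trans (distToCluster_le G)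
  set p := distToCluster G
  have hA {A : ℕ} (c d e : ℕ) (h : A = c * ((4 ^ p) ^ d * n ^ e))
      (hcde : c ≤ 24 ∧ d ≤ 2 ∧ e ≤ 6) : A ≤ 24 * (2 ^ (4 * p) * p * n ^ 6) := by
    have hpow : 2 ^ (4 * p) = (4 ^ p) ^ 2 := by rw [pow_mul, pow_right_comm 4]; norm_num
    obtain ⟨hc, hd, he⟩ := hcde
    rw [h, hpow]
    gcongr
    exact (Nat.pow_le_pow_right (by positivity) hd).trans (Nat.le_mul_of_pos_right _ hp)
  refine ((spec_prepare hn hG hσ).mono_cost ?_).seq fun τ _ hdist => ?_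
  · exact hA 7 0 4 (by ring) (by decide)
  refine ((spec_search hn hdist).mono_cost ?_).seq fun ρ _ ⟨l, hl, hready⟩ => ?_
  · exact hA 24 1 4 (by ring) (by decide)
  refine (Cmd.Spec.set (Q := fun τ => τ.var Reg.ans = 0) (.of_sumsOver_nil rfl ?_) rfl).seq
    fun υ hυ hans => ?_
  · exact hA 1 0 0 (by ring) (by decide)
  have hready' := IsReady.dependsOn.frame hυ rfl hready
  refine ((spec_tryEnds hn hG hready').mono_cost ?_).seq fun ω hω hends => ?_
  · rw [hl]
    exact hA 2 2 5 (by ring) (by decide)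
  refine (spec_report hG hn
    (IsReady.dependsOn.frame hω rfl hready').toHasDist fun hk => ?_).mono_cost ?_
  · rw [hends, isYesInstance_iff_exists_hasCertificate hG hready.hitsP3 hk, or_iff_right]
    exact not_not.2 hans
  · exact hA 1 0 2 (by ring) (by decide)

end MESP.Solver

/-- One fixed program decides the Minimum Eccentricity Shortest Path Problem: on every connected
graph with distance to cluster graph `p ≥ 1` and every `k`, it halts within `c * 2^(4p) * p * n^6`
steps, with the answer (`1` for yes, `0` for no) in variable `0`. -/
theorem mainTheorem3 :
    ∃ (P : RAM.Prog) (c : ℕ), ∀ (n : ℕ) (G : SimpleGraph (Fin n)) (k p : ℕ),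
      G.Connected → MESP.distToCluster G = p → 1 ≤ p →
        ∃ (t : ℕ) (τ : RAM.State),
          RAM.Exec P (RAM.inputState G k) t τ ∧
          t ≤ c * (2 ^ (4 * p) * p * n ^ 6) ∧
          (MESP.IsYesInstance G k → τ.var 0 = 1) ∧
          (¬ MESP.IsYesInstance G k → τ.var 0 = 0) := by
  open MESP.Solver in
  refine ⟨solve.compile solve.varBound, solve.size * 24, fun n G k p hG hp hp1 => ?_⟩
  subst hp
  obtain ⟨-, hcost, hrun⟩ := spec_solve hG hp1 (isInput_inputState (k := k))
  obtain ⟨t, τ, hexec, ht, hτ⟩ := solve.exists_exec (RAM.inputState G k)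
  have hanswer := (hτ.var 0 (by decide)).trans hrun
  refine ⟨t, τ, hexec, ?_, fun h => by rw [hanswer, if_pos h], fun h => by rw [hanswer, if_neg h]⟩
  rw [mul_assoc]
  exact ht.trans hcost
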